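/- **Systems.** A system has input and output channels carrying finite bit strings and an internal, possibly infinite, supply of randomness. Interaction is asynchronous and there is no global time: the messages emitted on each output channel are a function of the internal randomness and of what has been received so far on each input channel, and sent messages are never withdrawn. Systems are computationally unbounded and can be composed in parallel with independent randomness ($\|$) and connected through channels; $\mathbf F^{\|n}$ denotes $n$ independent copies of $\mathbf F$. A distinguisher $D$ is a system that is connected to all channels of $\mathbf F$ and outputs a bit. Write $\mathbf F\equiv_\delta\mathbf F'$ if $|\Pr[D(\mathbf F)=1]-\Pr[D(\mathbf F')=1]|\le\delta$ for all $D$, and $\equiv$ for $\equiv_0$. There are two players, $\mathsf A$ and $\mathsf B$; $\mathsf{Comm}$ forwards every message received from one player to the other one. $\mathsf{OT}$ ($1$-out-of-$2$ oblivious transfer of bits) waits for $c\in\{0,1\}$ from $\mathsf B$ and then sends $\bot$ to $\mathsf A$; after having received $(x_0,x_1)\in\{0,1\}^2$ from $\mathsf A$, it sends $x_c$ to $\mathsf B$. **Security.** A protocol $\mathbf P=\mathbf P_{\mathsf A}\|\mathbf P_{\mathsf B}$ over a resource $\mathbf F$ consists of a system for each player. *Malicious model.* A resource is a collection $\mathbf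 F=(\mathbf F_\emptyset,\mathbf F_{\{\mathsf A\}},\mathbf F_{\{\mathsf B\}})$, where the corrupted player may have an arbitrary interface, and honest players have the same interface as in $\mathbf F_\emptyset$. $\mathbf P(\mathbf F)$ securely implements $\mathsf{OT}$ if $\mathbf P(\mathbf F_\emptyset)\equiv\mathsf{OT}$ and there are systems (simulators) $\mathbf S_{\mathsf B},\mathbf S_{\mathsf A}$ with $\mathbf P_{\mathsf A}(\mathbf F_{\{\mathsf B\}})\equiv\mathbf S_{\mathsf B}(\mathsf{OT})$ and $\mathbf P_{\mathsf B}(\mathbf F_{\{\mathsf A\}})\equiv\mathbf S_{\mathsf A}(\mathsf{OT})$. *Semi-honest model.* A resource is a collection $\mathbf F=(\mathbf F_\emptyset,\mathbf F_{\{\widehat{\mathsf A}\}},\mathbf F_{\{\widehat{\mathsf B}\}})$, where a passively corrupted player has the honest interface and additional auxiliary outputs. A passively corrupted player $p$ runs $\underline{\mathbf P}_p$, which behaves as $\mathbf P_p$ and forwards everything it sends or receives, and the auxiliary output of the resource, over auxiliary channels. $\mathbf P(\mathbf F)$ securely implements $\mathsf{OT}$ if $\mathbf P(\mathbf F_\emptyset)\equiv\mathsf{OT}$,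 $(\mathbf P_{\mathsf A}\|\underline{\mathbf P}_{\mathsf B})(\mathbf F_{\{\widehat{\mathsf B}\}})\equiv\mathbf S_{\mathsf B}(\mathsf{OT})$ and $(\underline{\mathbf P}_{\mathsf A}\|\mathbf P_{\mathsf B})(\mathbf F_{\{\widehat{\mathsf A}\}})\equiv\mathbf S_{\mathsf A}(\mathsf{OT})$ for some simulators $\mathbf S_p$ that see the inputs and outputs on the interface of $p$ but leave them unchanged, and only produce the auxiliary output. **Weak oblivious transfer.** For $X\in\{0,1\}$ let $\mathrm{PredAdv}(X\mid Y)=2\max_f\Pr[f(Y)=X]-1$. Let $p,q,\varepsilon\ge 0$. $\mathrm{WOT}(p,q,\varepsilon)$ is a set of resources without honest inputs that output a pair $(X_0,X_1)\in\{0,1\}^2$ to $\mathsf A$ and a pair $(C,Y)\in\{0,1\}^2$ to $\mathsf B$. *Semi-honest model.* A passively corrupted $\mathsf A$ gets in addition an auxiliary message $U$, and a passively corrupted $\mathsf B$ an auxiliary message $V$. With $E=X_C\oplus Y$, the resource is in $\mathrm{WOT}(p,q,\varepsilon)$ if $\Pr[E=1]\le\varepsilon$, $\mathrm{PredAdv}(X_{1-C}\mid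 C,Y,V,E)\le q$ and $\mathrm{PredAdv}(C\mid X_0,X_1,U,E)\le p$. *Malicious model.* The collection $\mathbf F$, in which a corrupted player can always behave honestly (some system attached to its interface turns $\mathbf F_{\{\mathsf A\}}$, respectively $\mathbf F_{\{\mathsf B\}}$, into a system equivalent to $\mathbf F_\emptyset$), is in $\mathrm{WOT}(p,q,\varepsilon)$ if $\mathbf F_\emptyset\equiv_\varepsilon\mathsf{ROT}$, where $\mathsf{ROT}$ chooses $(x_0,x_1,c)\in\{0,1\}^3$ uniformly at random and outputs $(x_0,x_1)$ to $\mathsf A$ and $(c,x_c)$ to $\mathsf B$; $\mathbf F_{\{\mathsf B\}}$, after the last input from $\mathsf B$, outputs a pair $(X_0,X_1)$ to $\mathsf A$ such that for every strategy of $\mathsf B$ with transcript $V$, $\mathrm{PredAdv}(X_0\oplus X_1\mid V)\le q$; and $\mathbf F_{\{\mathsf A\}}$, after the last input from $\mathsf A$, outputs a pair $(C,Y)$ to $\mathsf B$ such that for every strategy of $\mathsf A$ with transcript $U$, $\mathrm{PredAdv}(C\mid U)\le p$. **Theorem.** Let $p,q,\varepsilon\ge 0$ with $p+q+2\varepsilon\ge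 1$ and let $n\ge 0$. In the semi-honest model, there is no protocol $\mathbf P$ such that $\mathbf P(\mathbf F^{\|n}\|\mathsf{Comm})$ securely implements $\mathsf{OT}$ for every $\mathbf F\in\mathrm{WOT}(p,q,\varepsilon)$. In the malicious model, there is no such protocol either. -/

import Mathlib

open MeasureTheory

noncomputable section

namespace OTRed

/-! ### Systems

A system has input channels `I` and output channels `O`.  Channels carry finite bit strings.
The whole interaction is asynchronous and there is no global time: what a system emits on its
output channels is a function of its internal randomness and of what has been received so far on
each input channel. -/

/-- Messages: elements of `{0,1}*`. -/
abbrev Msg : Type := List Bool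

/-- The finite sequence of messages that have been sent over one channel so far. -/
abbrev Tape : Type := List Msg

instance : MeasurableSpace Tape := ⊤

instance : DiscreteMeasurableSpace Tape := ⟨fun _ => trivial⟩

/-- For each channel, the messages sent over it so far. -/
abbrev Hist (I : Type) : Type := I → Tape

/-- `h` is a (channelwise) earlier history than `h'`. -/
def Hist.Le {I : Type} (h h' : Hist I) : Prop := ∀ i, h i <+: h' i

/-- A (randomized, computationally unbounded) system.  `out ω n h` is what has been emitted after
`n` internal steps with internal randomness `ω` when `h` has been received.  The step count `n` is
private to the system (a system may emit infinitely many messages); sent messages are never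
withdrawn, which is monotonicity in `n` and `h`. -/
structure System (I O : Type) where
  Ω : Type
  [mΩ : MeasurableSpace Ω]
  P : Measure Ω
  [prob : IsProbabilityMeasure P]
  out : Ω → ℕ → Hist I → Hist O
  mono : ∀ (ω : Ω) {n n' : ℕ} {h h' : Hist I}, n ≤ n' → h.Le h' → (out ω n h).Le (out ω n' h')
  meas : ∀ n : ℕ, Measurable fun z : Ω × Hist I => out z.1 n z.2

attribute [instance] System.mΩ System.prob

namespace System

variable {I O I' O' J K E : Type}

/-- Renaming of channels: the new system has input channels `I'` and output channels `O'`; the old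
input channel `i` reads the new one `f i`, the new output channel `o` carries the old one `g o`. -/
def relabel (f : I → I') (g : O' → O) (S : System I O) : System I' O' where
  Ω := S.Ω
  P := S.P
  out ω n h := fun o => S.out ω n (fun i => h (f i)) (g o)
  mono ω _ _ _ _ hn hh := fun o => S.mono ω hn (fun i => hh (f i)) (g o)
  meas n := by
    refine measurable_pi_iff.2 fun o => ?_
    have h1 : Measurable fun z : S.Ω × Hist I' => (z.1, fun i => z.2 (f i)) :=
      measurable_fst.prodMk
        (measurable_pi_iff.2 fun i => (measurable_pi_apply (f i)).comp measurable_snd)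
    exact (measurable_pi_apply (g o)).comp ((S.meas n).comp h1)

/-- Parallel composition `S ‖ T`; the two systems use independent randomness. -/
def par (S : System I O) (T : System J K) : System (I ⊕ J) (O ⊕ K) where
  Ω := S.Ω × T.Ω
  P := S.P.prod T.P
  out ω n h :=
    Sum.elim (S.out ω.1 n fun i => h (Sum.inl i)) (T.out ω.2 n fun j => h (Sum.inr j))
  mono ω _ _ _ _ hn hh := by
    rintro (o | o)
    · exact S.mono ω.1 hn (fun i => hh (Sum.inl i)) o
    · exact T.mono ω.2 hn (fun j => hh (Sum.inr j)) o
  meas n := by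
    refine measurable_pi_iff.2 ?_
    rintro (o | o)
    · have h1 : Measurable fun z : (S.Ω × T.Ω) × Hist (I ⊕ J) =>
          (z.1.1, fun i => z.2 (Sum.inl i)) :=
        (measurable_fst.comp measurable_fst).prodMk
          (measurable_pi_iff.2 fun i => (measurable_pi_apply _).comp measurable_snd)
      exact (measurable_pi_apply o).comp ((S.meas n).comp h1)
    · have h1 : Measurable fun z : (S.Ω × T.Ω) × Hist (I ⊕ J) =>
          (z.1.2, fun j => z.2 (Sum.inr j)) :=
        (measurable_snd.comp measurable_fst).prodMk
          (measurable_pi_iff.2 fun i => (measurable_pi_apply _).comp measurable_snd)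
      exact (measurable_pi_apply o).comp ((T.meas n).comp h1)

/-- `S^{‖n}`: `n` independent copies of the same system in parallel. -/
def pow (n : ℕ) (S : System I O) : System (Fin n × I) (Fin n × O) where
  Ω := Fin n → S.Ω
  P := Measure.pi fun _ => S.P
  out ω m h := fun o => S.out (ω o.1) m (fun i => h (o.1, i)) o.2
  mono ω _ _ _ _ hn hh := fun o => S.mono (ω o.1) hn (fun i => hh (o.1, i)) o.2
  meas m := by
    refine measurable_pi_iff.2 fun o => ?_
    have h1 : Measurable fun z : (Fin n → S.Ω) × Hist (Fin n × I) =>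
        (z.1 o.1, fun i => z.2 (o.1, i)) :=
      ((measurable_pi_apply o.1).comp measurable_fst).prodMk
        (measurable_pi_iff.2 fun i => (measurable_pi_apply _).comp measurable_snd)
    exact (measurable_pi_apply o.2).comp ((S.meas m).comp h1)

/-- What has been emitted after `k` rounds of message passing, when every input channel `i` of `S`
is fed by `w i`: an external channel, or an output channel of `S` itself. -/
def loop (S : System I O) (w : I → E ⊕ O) (ω : S.Ω) (n : ℕ) (h : Hist E) : ℕ → Hist O
  | 0 => fun _ => []
  | k + 1 => S.out ω n fun i => Sum.elim h (loop S w ω n h k) (w i)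

lemma loop_mono (S : System I O) (w : I → E ⊕ O) (ω : S.Ω) {n n' : ℕ} {h h' : Hist E}
    (hn : n ≤ n') (hh : h.Le h') :
    ∀ {k k' : ℕ}, k ≤ k' → (S.loop w ω n h k).Le (S.loop w ω n' h' k')
  | 0, _, _ => fun _ => List.nil_prefix
  | k + 1, 0, hk => absurd hk (by omega)
  | k + 1, k' + 1, hk => by
    have ih := loop_mono S w ω hn hh (Nat.le_of_succ_le_succ hk)
    refine S.mono ω hn fun i => ?_
    cases w i with
    | inl e => exact hh e
    | inr o => exact ih o

lemma loop_meas (S : System I O) (w : I → E ⊕ O) (n : ℕ) :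
    ∀ k : ℕ, Measurable fun z : S.Ω × Hist E => S.loop w z.1 n z.2 k
  | 0 => measurable_const
  | k + 1 => by
    have ih := loop_meas S w n k
    have h1 : Measurable fun z : S.Ω × Hist E =>
        (z.1, fun i => Sum.elim z.2 (S.loop w z.1 n z.2 k) (w i)) := by
      refine measurable_fst.prodMk (measurable_pi_iff.2 fun i => ?_)
      cases w i with
      | inl e => exact (measurable_pi_apply e).comp measurable_snd
      | inr o => exact (measurable_pi_apply o).comp ih
    exact (S.meas n).comp h1

/-- Wiring: connect the input channels of `S` as prescribed by `w` (to external input channels `E`,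
or to output channels of `S`) and expose the output channels selected by `e`. -/
def wire (S : System I O) (w : I → E ⊕ O) (e : O' → O) : System E O' where
  Ω := S.Ω
  P := S.P
  out ω n h := fun o => S.loop w ω n h n (e o)
  mono ω _ _ _ _ hn hh := fun o => S.loop_mono w ω hn hh hn (e o)
  meas n := measurable_pi_iff.2 fun o => (measurable_pi_apply (e o)).comp (S.loop_meas w n n)

/-- The system without inputs that samples `a` from `μ` and emits the message `f a o` on each
output channel `o`. -/
def source {α : Type} (μ : PMF α) (f : α → O → Msg) : System I O where
  Ω := α
  mΩ := ⊤
  P := @PMF.toMeasure α ⊤ μ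
  prob := @PMF.toMeasure.isProbabilityMeasure α ⊤ μ
  out a _ _ := fun o => [f a o]
  mono _ _ _ _ _ _ _ := fun _ => List.prefix_rfl
  meas _ := by
    let _ : MeasurableSpace α := ⊤
    exact measurable_pi_iff.2 fun o =>
      (measurable_from_top (f := fun a : α => ([f a o] : Tape))).comp measurable_fst

/-- A deterministic system whose output is the function `f` of the input history. -/
def determ (f : Hist I → Hist O) (hf : ∀ {h h' : Hist I}, h.Le h' → (f h).Le (f h'))
    (hm : Measurable f) : System I O where
  Ω := Unit
  P := Measure.dirac ()
  out _ _ h := f h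
  mono _ _ _ _ _ _ hh := hf hh
  meas _ := hm.comp measurable_snd

end System

open OTRed.System

/-! ### Distinguishing advantage -/

/-- `Pr[D(F) = 1]`: the distinguisher `D` is connected to all channels of `F` and has one further
output channel, for its output bit; the event is that the first message there is `1`. -/
def prOne {I O : Type} (D : System O (I ⊕ Unit)) (F : System I O) : ℝ :=
  let N : System Empty Unit :=
    wire (par D F)
      (fun
        | Sum.inl o => Sum.inr (Sum.inr o)
        | Sum.inr i => Sum.inr (Sum.inl (Sum.inl i)))
      (fun _ => Sum.inl (Sum.inr ()))
  N.P.real {ω | ∃ n, (N.out ω n (fun _ => []) ()).head? = some [true]}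

/-- `F ≡_δ F'`: every distinguisher has advantage at most `δ`. -/
def Close {I O : Type} (δ : ℝ) (F F' : System I O) : Prop :=
  ∀ D : System O (I ⊕ Unit), |prOne D F - prOne D F'| ≤ δ

/-! ### Players

A two-party system has input channels `IA ⊕ IB` and output channels `OA ⊕ OB`, where `IA`, `OA`
form the interface of A and `IB`, `OB` that of B.  A player attached to the interface `I`, `O`
who offers the interface `U`, `V` is a system with inputs `U ⊕ O` and outputs `V ⊕ I`. -/

section Players

variable {IA OA IB OB U V : Type}

/-- `π(F)` for a system `π` attached to the interface of A. -/
def attachA (π : System (U ⊕ OA) (V ⊕ IA)) (F : System (IA ⊕ IB) (OA ⊕ OB)) :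
    System (U ⊕ IB) (V ⊕ OB) :=
  wire (par π F)
    (fun
      | Sum.inl (Sum.inl u) => Sum.inl (Sum.inl u)
      | Sum.inl (Sum.inr o) => Sum.inr (Sum.inr (Sum.inl o))
      | Sum.inr (Sum.inl i) => Sum.inr (Sum.inl (Sum.inr i))
      | Sum.inr (Sum.inr i) => Sum.inl (Sum.inr i))
    (fun
      | Sum.inl v => Sum.inl (Sum.inl v)
      | Sum.inr o => Sum.inr (Sum.inr o))

/-- `π(F)` for a system `π` attached to the interface of B. -/
def attachB (π : System (U ⊕ OB) (V ⊕ IB)) (F : System (IA ⊕ IB) (OA ⊕ OB)) :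
    System (IA ⊕ U) (OA ⊕ V) :=
  wire (par π F)
    (fun
      | Sum.inl (Sum.inl u) => Sum.inl (Sum.inr u)
      | Sum.inl (Sum.inr o) => Sum.inr (Sum.inr (Sum.inr o))
      | Sum.inr (Sum.inl i) => Sum.inl (Sum.inl i)
      | Sum.inr (Sum.inr i) => Sum.inr (Sum.inl (Sum.inr i)))
    (fun
      | Sum.inl o => Sum.inr (Sum.inl o)
      | Sum.inr v => Sum.inl (Sum.inl v))

end Players

/-- The communication channel: every message received from one player is sent to the
other player. -/
def Comm : System (Unit ⊕ Unit) (Unit ⊕ Unit) :=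
  determ
    (fun h => fun
      | Sum.inl _ => h (Sum.inr ())
      | Sum.inr _ => h (Sum.inl ()))
    (fun hh => by
      rintro (o | o)
      · exact hh (Sum.inr ())
      · exact hh (Sum.inl ()))
    (by
      refine measurable_pi_iff.2 ?_
      rintro (o | o)
      · exact measurable_pi_apply _
      · exact measurable_pi_apply _)

/-- `F^{‖n} ‖ Comm` as a two-party system. -/
def withComm {IA OA IB OB : Type} (n : ℕ) (F : System (IA ⊕ IB) (OA ⊕ OB)) :
    System ((Fin n × IA ⊕ Unit) ⊕ (Fin n × IB ⊕ Unit))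
      ((Fin n × OA ⊕ Unit) ⊕ (Fin n × OB ⊕ Unit)) :=
  relabel
    (fun
      | Sum.inl (k, Sum.inl i) => Sum.inl (Sum.inl (k, i))
      | Sum.inl (k, Sum.inr i) => Sum.inr (Sum.inl (k, i))
      | Sum.inr (Sum.inl _) => Sum.inl (Sum.inr ())
      | Sum.inr (Sum.inr _) => Sum.inr (Sum.inr ()))
    (fun
      | Sum.inl (Sum.inl (k, o)) => Sum.inl (k, Sum.inl o)
      | Sum.inl (Sum.inr _) => Sum.inr (Sum.inl ())
      | Sum.inr (Sum.inl (k, o)) => Sum.inl (k, Sum.inr o)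
      | Sum.inr (Sum.inr _) => Sum.inr (Sum.inr ()))
    (par (pow n F) Comm)

/-- A protocol `P = P_A ‖ P_B` over a resource with interfaces `IA, OA` and `IB, OB`, offering the
interfaces `UA, VA` to A and `UB, VB` to B. -/
structure Protocol (UA VA UB VB IA OA IB OB : Type) where
  A : System (UA ⊕ OA) (VA ⊕ IA)
  B : System (UB ⊕ OB) (VB ⊕ IB)

/-! ### The malicious model -/

/-- A collection of systems `(F_∅, F_{A}, F_{B})`: the honest players always have the same
interface as in `F_∅`, the corrupted player has an arbitrary interface. -/
structure ActiveColl (IA OA IB OB : Type) where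
  sys : System (IA ⊕ IB) (OA ⊕ OB)
  JA : Type
  KA : Type
  JB : Type
  KB : Type
  sysA : System (JA ⊕ IB) (KA ⊕ OB)
  sysB : System (IA ⊕ JB) (OA ⊕ KB)

/-- The collection `F^{‖n} ‖ Comm`. -/
def ActiveColl.withComm {IA OA IB OB : Type} (n : ℕ) (F : ActiveColl IA OA IB OB) :
    ActiveColl (Fin n × IA ⊕ Unit) (Fin n × OA ⊕ Unit)
      (Fin n × IB ⊕ Unit) (Fin n × OB ⊕ Unit) where
  sys := OTRed.withComm n F.sys
  JA := Fin n × F.JA ⊕ Unit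
  KA := Fin n × F.KA ⊕ Unit
  JB := Fin n × F.JB ⊕ Unit
  KB := Fin n × F.KB ⊕ Unit
  sysA := OTRed.withComm n F.sysA
  sysB := OTRed.withComm n F.sysB

/-- A corrupted player can always behave honestly. -/
def ActiveColl.AllowsHonest {IA OA IB OB : Type} (F : ActiveColl IA OA IB OB) : Prop :=
  (∃ H : System (IA ⊕ F.KA) (OA ⊕ F.JA), Close 0 (attachA H F.sysA) F.sys) ∧
  (∃ H : System (IB ⊕ F.KB) (OB ⊕ F.JB), Close 0 (attachB H F.sysB) F.sys)

/-- `P(F)` securely implements `G` in the malicious model with an error of at most `δ`. -/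
def ActivelySecure {UA VA UB VB IA OA IB OB : Type} (δ : ℝ)
    (P : Protocol UA VA UB VB IA OA IB OB) (F : ActiveColl IA OA IB OB)
    (G : ActiveColl UA VA UB VB) : Prop :=
  Close δ (attachA P.A (attachB P.B F.sys)) G.sys ∧
  (∃ S : System (F.JB ⊕ G.KB) (F.KB ⊕ G.JB),
    Close δ (attachA P.A F.sysB) (attachB S G.sysB)) ∧
  (∃ S : System (F.JA ⊕ G.KA) (F.KA ⊕ G.JA),
    Close δ (attachB P.B F.sysA) (attachA S G.sysA))

/-! ### The semi-honest model -/

/-- A collection of systems `(F_∅, F_{Â}, F_{B̂})`: a passively corrupted player has the same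
interface as an honest one and additional auxiliary output channels `XA` (or `XB`). -/
structure PassiveColl (IA OA IB OB : Type) where
  sys : System (IA ⊕ IB) (OA ⊕ OB)
  XA : Type
  XB : Type
  sysA : System (IA ⊕ IB) ((OA ⊕ XA) ⊕ OB)
  sysB : System (IA ⊕ IB) (OA ⊕ (OB ⊕ XB))

/-- The collection `F^{‖n} ‖ Comm`. -/
def PassiveColl.withComm {IA OA IB OB : Type} (n : ℕ) (F : PassiveColl IA OA IB OB) :
    PassiveColl (Fin n × IA ⊕ Unit) (Fin n × OA ⊕ Unit)
      (Fin n × IB ⊕ Unit) (Fin n × OB ⊕ Unit) where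
  sys := OTRed.withComm n F.sys
  XA := Fin n × F.XA
  XB := Fin n × F.XB
  sysA := relabel id
    (fun
      | Sum.inl (Sum.inl (Sum.inl (k, o))) => Sum.inl (Sum.inl (k, Sum.inl o))
      | Sum.inl (Sum.inl (Sum.inr _)) => Sum.inl (Sum.inr ())
      | Sum.inl (Sum.inr (k, x)) => Sum.inl (Sum.inl (k, Sum.inr x))
      | Sum.inr o => Sum.inr o)
    (OTRed.withComm n F.sysA)
  sysB := relabel id
    (fun
      | Sum.inl o => Sum.inl o
      | Sum.inr (Sum.inl (Sum.inl (k, o))) => Sum.inr (Sum.inl (k, Sum.inl o))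
      | Sum.inr (Sum.inl (Sum.inr _)) => Sum.inr (Sum.inr ())
      | Sum.inr (Sum.inr (k, x)) => Sum.inr (Sum.inl (k, Sum.inr x)))
    (OTRed.withComm n F.sysB)

/-- The auxiliary channels of a passively corrupted player: the auxiliary output `X` of the
resource, and copies of everything the player receives (`U ⊕ O`) and sends (`V ⊕ I`). -/
abbrev View (U V I O X : Type) : Type := X ⊕ ((U ⊕ O) ⊕ (V ⊕ I))

/-- The honest-but-curious player: behaves exactly as `π`, and forwards everything it receives or
sends, and the auxiliary output of the resource, over auxiliary channels. -/
def curious {U V I O : Type} (X : Type) (π : System (U ⊕ O) (V ⊕ I)) :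
    System (U ⊕ (O ⊕ X)) ((V ⊕ View U V I O X) ⊕ I) where
  Ω := π.Ω
  P := π.P
  out ω n h :=
    let recv : Hist (U ⊕ O) :=
      Sum.elim (fun u => h (Sum.inl u)) (fun o => h (Sum.inr (Sum.inl o)))
    let sent : Hist (V ⊕ I) := π.out ω n recv
    Sum.elim
      (Sum.elim (fun v => sent (Sum.inl v))
        (Sum.elim (fun x => h (Sum.inr (Sum.inr x))) (Sum.elim recv sent)))
      (fun i => sent (Sum.inr i))
  mono ω n n' h h' hn hh := by
    have hr : Hist.Le
        (Sum.elim (fun u => h (Sum.inl u)) (fun o => h (Sum.inr (Sum.inl o))) : Hist (U ⊕ O))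
        (Sum.elim (fun u => h' (Sum.inl u)) (fun o => h' (Sum.inr (Sum.inl o)))) := by
      rintro (u | o)
      · exact hh _
      · exact hh _
    have hs := π.mono ω hn hr
    rintro ((v | x | r | s) | i)
    · exact hs _
    · exact hh _
    · exact hr r
    · exact hs s
    · exact hs _
  meas n := by
    have hr : Measurable fun z : π.Ω × Hist (U ⊕ (O ⊕ X)) =>
        (Sum.elim (fun u => z.2 (Sum.inl u)) (fun o => z.2 (Sum.inr (Sum.inl o))) :
          Hist (U ⊕ O)) := by
      refine measurable_pi_iff.2 ?_
      rintro (u | o)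
      · exact (measurable_pi_apply _).comp measurable_snd
      · exact (measurable_pi_apply _).comp measurable_snd
    have hs := (π.meas n).comp (measurable_fst.prodMk hr)
    refine measurable_pi_iff.2 ?_
    rintro ((v | x | r | s) | i)
    · exact measurable_pi_iff.1 hs (Sum.inl v)
    · exact (measurable_pi_apply (Sum.inr (Sum.inr x))).comp
        (measurable_snd (α := π.Ω) (β := Hist (U ⊕ (O ⊕ X))))
    · exact measurable_pi_iff.1 hr r
    · exact measurable_pi_iff.1 hs s
    · exact measurable_pi_iff.1 hs (Sum.inr i)

section Observe

variable {UA VA UB VB Y X : Type}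

/-- `S(G)` for a simulator `S` that only modifies the auxiliary channels of A: it sees the inputs
and outputs on the interface of A, which it leaves unchanged, and the auxiliary output `Y` of `G`,
which it replaces by the auxiliary output `X`. -/
def observeA (S : System (UA ⊕ (VA ⊕ Y)) X) (G : System (UA ⊕ UB) ((VA ⊕ Y) ⊕ VB)) :
    System (UA ⊕ UB) ((VA ⊕ X) ⊕ VB) :=
  wire (par S G)
    (fun
      | Sum.inl (Sum.inl u) => Sum.inl (Sum.inl u)
      | Sum.inl (Sum.inr o) => Sum.inr (Sum.inr (Sum.inl o))
      | Sum.inr u => Sum.inl u)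
    (fun
      | Sum.inl (Sum.inl v) => Sum.inr (Sum.inl (Sum.inl v))
      | Sum.inl (Sum.inr x) => Sum.inl x
      | Sum.inr v => Sum.inr (Sum.inr v))

/-- `S(G)` for a simulator `S` that only modifies the auxiliary channels of B. -/
def observeB (S : System (UB ⊕ (VB ⊕ Y)) X) (G : System (UA ⊕ UB) (VA ⊕ (VB ⊕ Y))) :
    System (UA ⊕ UB) (VA ⊕ (VB ⊕ X)) :=
  wire (par S G)
    (fun
      | Sum.inl (Sum.inl u) => Sum.inl (Sum.inr u)
      | Sum.inl (Sum.inr o) => Sum.inr (Sum.inr (Sum.inr o))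
      | Sum.inr u => Sum.inl u)
    (fun
      | Sum.inl v => Sum.inr (Sum.inl v)
      | Sum.inr (Sum.inl v) => Sum.inr (Sum.inr (Sum.inl v))
      | Sum.inr (Sum.inr x) => Sum.inl x)

end Observe

/-- `P(F)` securely implements `G` in the semi-honest model with an error of at most `δ`. -/
def PassivelySecure {UA VA UB VB IA OA IB OB : Type} (δ : ℝ)
    (P : Protocol UA VA UB VB IA OA IB OB) (F : PassiveColl IA OA IB OB)
    (G : PassiveColl UA VA UB VB) : Prop :=
  Close δ (attachA P.A (attachB P.B F.sys)) G.sys ∧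
  (∃ S : System (UB ⊕ (VB ⊕ G.XB)) (View UB VB IB OB F.XB),
    Close δ (attachA P.A (attachB (curious F.XB P.B) F.sysB)) (observeB S G.sysB)) ∧
  (∃ S : System (UA ⊕ (VA ⊕ G.XA)) (View UA VA IA OA F.XA),
    Close δ (attachA (curious F.XA P.A) (attachB P.B F.sysA)) (observeA S G.sysA))

/-! ### Oblivious transfer -/

/-- A message read as one bit. -/
def asBit : Msg → Option Bool
  | [b] => some b
  | _ => none

/-- A message read as two bits. -/
def asPair : Msg → Option (Bool × Bool)
  | [b₀, b₁] => some (b₀, b₁)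
  | _ => none

/-- The first bit sent over a channel (other messages are ignored). -/
def firstBit (t : Tape) : Option Bool := (t.filterMap asBit).head?

/-- The first pair of bits sent over a channel (other messages are ignored). -/
def firstPair (t : Tape) : Option (Bool × Bool) := (t.filterMap asPair).head?

/-- `x_c`. -/
def pick (x : Bool × Bool) (c : Bool) : Bool := bif c then x.2 else x.1

/-- The notification that oblivious transfer sends to A: the empty message, once B has sent `c`. -/
def otNotify (tB : Tape) : Tape := ((firstBit tB).map fun _ => ([] : Msg)).toList

/-- What oblivious transfer sends to B: `x_c`, once `c` and `(x₀, x₁)` have been received. -/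
def otAnswer (tA tB : Tape) : Tape :=
  ((firstBit tB).bind fun c => (firstPair tA).map fun x => [pick x c]).toList

lemma head?_filterMap_prefix {α : Type} (f : Msg → Option α) {t t' : Tape} (h : t <+: t') {a : α}
    (ha : (t.filterMap f).head? = some a) : (t'.filterMap f).head? = some a := by
  obtain ⟨s, rfl⟩ := h
  rw [List.filterMap_append]
  cases hl : t.filterMap f with
  | nil => simp [hl] at ha
  | cons b l => simpa [hl] using ha

lemma toList_prefix {α : Type} {o o' : Option α} (h : ∀ a, o = some a → o' = some a) :
    o.toList <+: o'.toList := by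
  cases o with
  | none => exact List.nil_prefix
  | some a => rw [h a rfl]

/-- 1-out-of-2 oblivious transfer of bits: waits for `c` from B and then sends `⊥` to A; after
having received `(x₀, x₁)` from A it sends `x_c` to B. -/
def OT : System (Unit ⊕ Unit) (Unit ⊕ Unit) :=
  determ
    (fun h => fun
      | Sum.inl _ => otNotify (h (Sum.inr ()))
      | Sum.inr _ => otAnswer (h (Sum.inl ())) (h (Sum.inr ())))
    (fun {h h'} hh => by
      have hc : ∀ c, firstBit (h (Sum.inr ())) = some c → firstBit (h' (Sum.inr ())) = some c :=
        fun c => head?_filterMap_prefix asBit (hh _)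
      have hx : ∀ x, firstPair (h (Sum.inl ())) = some x → firstPair (h' (Sum.inl ())) = some x :=
        fun x => head?_filterMap_prefix asPair (hh _)
      rintro (o | o)
      · refine toList_prefix fun m hm => ?_
        obtain ⟨c, h1, h2⟩ := Option.map_eq_some_iff.1 hm
        exact Option.map_eq_some_iff.2 ⟨c, hc c h1, h2⟩
      · refine toList_prefix fun m hm => ?_
        obtain ⟨c, h1, h2⟩ := Option.bind_eq_some_iff.1 hm
        obtain ⟨x, h3, h4⟩ := Option.map_eq_some_iff.1 h2
        exact Option.bind_eq_some_iff.2 ⟨c, hc c h1, Option.map_eq_some_iff.2 ⟨x, hx x h3, h4⟩⟩)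
    (by
      refine measurable_pi_iff.2 ?_
      rintro (o | o)
      · exact (Measurable.of_discrete (f := otNotify)).comp (measurable_pi_apply _)
      · have h1 : Measurable fun h : Hist (Unit ⊕ Unit) => (h (Sum.inl ()), h (Sum.inr ())) :=
          (measurable_pi_apply _).prodMk (measurable_pi_apply _)
        exact (Measurable.of_discrete (f := fun z : Tape × Tape => otAnswer z.1 z.2)).comp h1)

/-- Oblivious transfer in the malicious model: the same system for all sets of corrupted players. -/
def OTActive : ActiveColl Unit Unit Unit Unit := ⟨OT, Unit, Unit, Unit, Unit, OT, OT⟩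

/-- Oblivious transfer in the semi-honest model: there is no auxiliary output. -/
def OTPassive : PassiveColl Unit Unit Unit Unit where
  sys := OT
  XA := Empty
  XB := Empty
  sysA := relabel id
    (fun
      | Sum.inl (Sum.inl v) => Sum.inl v
      | Sum.inr v => Sum.inr v) OT
  sysB := relabel id
    (fun
      | Sum.inl v => Sum.inl v
      | Sum.inr (Sum.inl v) => Sum.inr v) OT

/-- The honest randomized oblivious transfer `ROT_∅`: it chooses `x₀, x₁, c` uniformly at random and
sends `(x₀, x₁)` to A and `(c, x_c)` to B. -/
def ROT : System (Empty ⊕ Empty) (Unit ⊕ Unit) :=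
  source (PMF.uniformOfFintype (Bool × Bool × Bool)) fun w => fun
    | Sum.inl _ => [w.1, w.2.1]
    | Sum.inr _ => [w.2.2, pick (w.1, w.2.1) w.2.2]

/-! ### Weak oblivious transfer -/

/-- `Pr[A]` for an event `A` under a discrete distribution. -/
def pr {α : Type} (μ : PMF α) (A : Set α) : ℝ := (μ.toOuterMeasure A).toReal

/-- The maximal bit-prediction advantage `2 · max_f Pr[f(Y) = X] - 1` of `X` from `Y`, where `μ` is
the joint distribution of `X` and `Y`. -/
def predAdv {Y : Type} (μ : PMF (Bool × Y)) : ℝ :=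
  2 * (⨆ f : Y → Bool, pr μ {z | f z.2 = z.1}) - 1

/-- One outcome of a semi-honest weak oblivious transfer: outputs `(x₀, x₁)` to A and `(c, y)` to B,
auxiliary output `u` to a passively corrupted A and `v` to a passively corrupted B. -/
structure WOTOutcome where
  x : Bool × Bool
  c : Bool
  y : Bool
  u : Msg
  v : Msg

/-- `E = x_c ⊕ y`. -/
def WOTOutcome.E (w : WOTOutcome) : Bool := xor (pick w.x w.c) w.y

/-- The collection of systems in the semi-honest model that samples an outcome from `μ` and outputs
it to the players. -/
def wotColl (μ : PMF WOTOutcome) : PassiveColl Empty Unit Empty Unit where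
  sys := source μ fun w => fun
    | Sum.inl _ => [w.x.1, w.x.2]
    | Sum.inr _ => [w.c, w.y]
  XA := Unit
  XB := Unit
  sysA := source μ fun w => fun
    | Sum.inl (Sum.inl _) => [w.x.1, w.x.2]
    | Sum.inl (Sum.inr _) => w.u
    | Sum.inr _ => [w.c, w.y]
  sysB := source μ fun w => fun
    | Sum.inl _ => [w.x.1, w.x.2]
    | Sum.inr (Sum.inl _) => [w.c, w.y]
    | Sum.inr (Sum.inr _) => w.v

/-- `WOT(p,q,ε)` in the semi-honest model.  What the corrupted player sees consists of its regular
and of its auxiliary output. -/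
def IsPassiveWOT (p q ε : ℝ) (μ : PMF WOTOutcome) : Prop :=
  pr μ {w | w.E = true} ≤ ε ∧
  predAdv (μ.map fun w => (pick w.x (!w.c), ((w.c, w.y, w.v), w.E))) ≤ q ∧
  predAdv (μ.map fun w => (w.c, ((w.x, w.u), w.E))) ≤ p

/-- Almost surely, `F` emits nothing on the channel `o` before the last input has been received on
the channels `J` (`k j` messages on the channel `j`), and exactly one pair of bits afterwards. -/
def OutputsPairAfterLastInput {J O : Type} (F : System J O) (o : O) : Prop :=
  ∃ k : J → ℕ, ∀ h : Hist J,
    ((∀ j, k j ≤ (h j).length) →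
      ∀ᵐ ω ∂F.P, ∃ b₀ b₁ : Bool, ∃ n₀, ∀ n ≥ n₀, F.out ω n h o = [[b₀, b₁]]) ∧
    ((¬ ∀ j, k j ≤ (h j).length) → ∀ᵐ ω ∂F.P, ∀ n, F.out ω n h o = [])

/-- Some adversary strategy `S` interacts with the channels `J`, `K` of `F`, and then guesses a bit.
`guessAdv S F o g` is `Pr[guess = g(b₀, b₁)] - Pr[guess ≠ g(b₀, b₁)]`, where `(b₀, b₁)` is the pair
of bits that `F` emits on the channel `o`. -/
def guessAdv {J K O : Type} (S : System K (J ⊕ Unit)) (F : System J (K ⊕ O)) (o : O)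
    (g : Bool × Bool → Bool) : ℝ :=
  let N : System Empty (Unit ⊕ Unit) :=
    wire (par S F)
      (fun
        | Sum.inl k => Sum.inr (Sum.inr (Sum.inl k))
        | Sum.inr j => Sum.inr (Sum.inl (Sum.inl j)))
      (fun
        | Sum.inl _ => Sum.inl (Sum.inr ())
        | Sum.inr _ => Sum.inr (Sum.inr o))
  let hit (r : Bool) : ℝ := N.P.real {ω | ∃ n b,
    firstPair (N.out ω n (fun _ => []) (Sum.inr ())) = some b ∧
    firstBit (N.out ω n (fun _ => []) (Sum.inl ())) = some (xor r (g b))}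
  hit false - hit true

/-- `F_{A}` as a system for the corrupted player A (channels `J`, `K`) and an output to B. -/
def ActiveColl.advA (F : ActiveColl Empty Unit Empty Unit) : System F.JA (F.KA ⊕ Unit) :=
  relabel (fun
    | Sum.inl j => j
    | Sum.inr e => e.elim) id F.sysA

/-- `F_{B}` as a system for the corrupted player B (channels `J`, `K`) and an output to A. -/
def ActiveColl.advB (F : ActiveColl Empty Unit Empty Unit) : System F.JB (F.KB ⊕ Unit) :=
  relabel (fun
    | Sum.inl e => e.elim
    | Sum.inr j => j)
    (fun
    | Sum.inl k => Sum.inr k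
    | Sum.inr v => Sum.inl v) F.sysB

/-- `WOT(p,q,ε)` in the malicious model: with honest players it is `ROT` up to an error of `ε` (for
`ε = 0` it is equivalent to `ROT`); whatever a corrupted B does, the system finally outputs a pair
`(X₀, X₁)` to A whose exclusive or is predicted by B with advantage at most `q`; and whatever a
corrupted A does, it finally outputs a pair `(C, Y)` to B where A predicts `C` with advantage at
most `p`. -/
def IsActiveWOT (p q ε : ℝ) (F : ActiveColl Empty Unit Empty Unit) : Prop :=
  F.AllowsHonest ∧
  Close ε F.sys ROT ∧
  (OutputsPairAfterLastInput F.advB (Sum.inr ()) ∧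
    ∀ S : System F.KB (F.JB ⊕ Unit),
      guessAdv S F.advB () (fun b => xor b.1 b.2) ≤ q) ∧
  (OutputsPairAfterLastInput F.advA (Sum.inr ()) ∧
    ∀ S : System F.KA (F.JA ⊕ Unit),
      guessAdv S F.advA () (fun b => b.1) ≤ p)

/-- A protocol that uses `n` instances of weak oblivious transfer and `Comm`, and offers the
interface of oblivious transfer. -/
abbrev WOTProtocol (n : ℕ) : Type 1 :=
  Protocol Unit Unit Unit Unit (Fin n × Empty ⊕ Unit) (Fin n × Unit ⊕ Unit)
    (Fin n × Empty ⊕ Unit) (Fin n × Unit ⊕ Unit)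

end OTRed

end

open MeasureTheory

noncomputable section

namespace OTRed

open OTRed.System

/-! ### Limits of growing tapes -/

/-! In each model one resource in the class already defeats every protocol. Since p + q + 2ε ≥ 1,
the number 1 splits into weights at most p, q and 2ε (`exists_weights`). The resource draws one of
three cases with these weights and announces it to both players in the auxiliary output: either A is
told the whole output of B, or B is told the whole output of A, or all four output bits are
independent. A predicts C only in the first case, B predicts the hidden bit only in the second, and
an error occurs only in half of the third, so the bounds hold (`isPassiveWOT`, `isActiveWOT`). But
given the announcement, every possible output of A goes together with every possible output of B
(`Weights.exists_mix`). The resource is thus worth no more than communication with public randomness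
and independent private randomness (`indep_world`).

It remains to see that this does not give oblivious transfer. Security against A says that
announcements and conversation have the same law for c = 0 and c = 1. Security against B with c = 1
says that this law is the same for x = (0,0) and x = (1,0). Passing through c = 1, the law is also
the same for these two x with c = 0, although B must then output x₀ (`not_correct_of_hit`). For a
finite conversation this is absurd by a rectangle argument: take B's randomness from a run with x₀ =
1, A's randomness from a run with x₀ = 0 and the same conversation. By independence the combination
has positive probability, the conversation is again the same, and B errs (`Duel.clash`).

The real difficulty is that conversations are asynchronous and possibly infinite. The rectangle
argument needs a finite pair (a, b) in which a is a response to b and b is a response to a, and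
which is read off from the conversation by the same rule for both versions of A. Such a rule exists
because the players cannot both be stuck at (a, b) with positive probability: a conversation that
stops would be a finite one (`Duel.no_deadlock`). So at every (a, b) it is almost surely possible to
name a player who goes on, and this defines a schedule (`Duel.sched`). The schedule might starve A
before B knows the answer, in which case all messages of B get scheduled, and a fixed number of
further messages of A may be added (`Duel.part`). Comparing two events of more than half of the
total mass then finishes the argument (`Duel.measure_eq_zero`).

In the semi-honest model the simulators cannot alter the inputs, so the equalities of laws follow
from what oblivious transfer hides. In the malicious model the corrupted player runs the protocol
honestly and reports its view. A simulator for B might then query oblivious transfer with another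
choice, but the perfect correctness of the reported output forces it to ask for x_c, and it can ask
only once (`obs_congr_of_correct`). -/

/-- The tape only grows. -/
def Growing (u : ℕ → Tape) : Prop := ∀ ⦃N N' : ℕ⦄, N ≤ N' → u N <+: u N'

lemma take_prefix_take {s t : Tape} (h : s <+: t) (k : ℕ) : s.take k <+: t.take k := by
  obtain ⟨r, rfl⟩ := h
  rw [List.take_append]
  exact List.prefix_append _ _

lemma take_eq_of_prefix {s t : Tape} (h : s <+: t) {k : ℕ} (hk : k ≤ s.length) :
    t.take k = s.take k := by
  obtain ⟨r, rfl⟩ := h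
  rw [List.take_append_of_le_length hk]

/-- A tape that ever exceeds `k` messages has its first `k + 1` messages fixed from then on. A tape
that never does equals its own truncation at `k`, which is eventually constant by induction. -/
lemma Growing.exists_take {u : ℕ → Tape} (hu : Growing u) (k : ℕ) :
    ∃ v, ∃ N, ∀ N' ≥ N, (u N').take k = v := by
  induction k with
  | zero => exact ⟨[], 0, fun N' _ => by simp⟩
  | succ k ih =>
    by_cases h : ∃ N, k < (u N).length
    · obtain ⟨N, hN⟩ := h
      exact ⟨(u N).take (k + 1), N, fun N' hN' => take_eq_of_prefix (hu hN') hN⟩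
    · push Not at h
      obtain ⟨v, N, hN⟩ := ih
      refine ⟨v, N, fun N' hN' => ?_⟩
      rw [← hN N' hN', List.take_of_length_le ((h N').trans (Nat.le_succ k)),
        List.take_of_length_le (h N')]

open Classical in
/-- The first `k` messages that are ever written on a growing tape. -/
def upTo (u : ℕ → Tape) (k : ℕ) : Tape :=
  if h : ∃ v, ∃ N, ∀ N' ≥ N, (u N').take k = v then h.choose else []

lemma Growing.upTo_spec {u : ℕ → Tape} (hu : Growing u) (k : ℕ) :
    ∃ N, ∀ N' ≥ N, (u N').take k = upTo u k := by
  have h := hu.exists_take k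
  rw [upTo, dif_pos h]
  exact h.choose_spec

lemma Growing.upTo_eq_iff {u : ℕ → Tape} (hu : Growing u) (k : ℕ) (v : Tape) :
    upTo u k = v ↔ ∃ N, ∀ N' ≥ N, (u N').take k = v := by
  obtain ⟨N, hN⟩ := hu.upTo_spec k
  constructor
  · rintro rfl
    exact ⟨N, hN⟩
  · rintro ⟨N₁, h₁⟩
    rw [← hN (max N N₁) (le_max_left _ _), h₁ _ (le_max_right _ _)]

lemma Growing.upTo_take {u : ℕ → Tape} (hu : Growing u) {k J : ℕ} (hk : k ≤ J) :
    (upTo u J).take k = upTo u k := by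
  obtain ⟨N, hN⟩ := hu.upTo_spec J
  symm
  rw [hu.upTo_eq_iff]
  refine ⟨N, fun N' h' => ?_⟩
  rw [← hN N' h', List.take_take, min_eq_left hk]

lemma Growing.upTo_mono {u : ℕ → Tape} (hu : Growing u) {k J : ℕ} (hk : k ≤ J) :
    upTo u k <+: upTo u J := by
  rw [← hu.upTo_take hk]
  exact List.take_prefix _ _

lemma Growing.exists_upTo_prefix {u : ℕ → Tape} (hu : Growing u) (k : ℕ) :
    ∃ N, ∀ N' ≥ N, upTo u k <+: u N' := by
  obtain ⟨N, hN⟩ := hu.upTo_spec k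
  exact ⟨N, fun N' h' => hN N' h' ▸ List.take_prefix _ _⟩

lemma Growing.prefix_upTo {u : ℕ → Tape} (hu : Growing u) {a : Tape} {N J : ℕ}
    (ha : a <+: u N) (hJ : a.length ≤ J) : a <+: upTo u J := by
  obtain ⟨N₀, hN⟩ := hu.upTo_spec J
  rw [← hN (max N N₀) (le_max_right _ _)]
  have h1 := take_prefix_take (ha.trans (hu (le_max_left N N₀))) J
  rwa [List.take_of_length_le hJ] at h1

lemma Growing.length_upTo_le {u : ℕ → Tape} (hu : Growing u) (k : ℕ) :
    (upTo u k).length ≤ k := by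
  obtain ⟨N, hN⟩ := hu.upTo_spec k
  rw [← hN N le_rfl]
  exact List.length_take_le _ _

/-- A message that goes beyond the first `k` messages of the tape contains the next one. -/
lemma Growing.upTo_succ_prefix {u : ℕ → Tape} (hu : Growing u) {p : Tape} {N k : ℕ}
    (hp : p <+: u N) (hk : ¬ p <+: upTo u k) : upTo u (k + 1) <+: p := by
  have hlen : k < p.length := by
    by_contra h
    exact hk (hu.prefix_upTo hp (not_lt.1 h))
  have h1 := take_prefix_take (hu.prefix_upTo hp (le_refl p.length)) (k + 1)
  have h2 := take_eq_of_prefix (hu.prefix_upTo hp (le_refl p.length)) (Nat.succ_le_of_lt hlen)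
  rw [hu.upTo_take (Nat.succ_le_of_lt hlen)] at h2
  rw [h2]
  exact List.take_prefix _ _

/-! ### A conversation over two channels -/

/-- A strategy: what has been sent after `n` steps when the tape `t` has been received. -/
def Causal (f : ℕ → Tape → Tape) : Prop :=
  ∀ ⦃n n' : ℕ⦄ ⦃t t' : Tape⦄, n ≤ n' → t <+: t' → f n t <+: f n' t'

/-- The conversation of two strategies after `N` rounds. -/
def play (f g : ℕ → Tape → Tape) : ℕ → Tape × Tape
  | 0 => ([], [])
  | N + 1 => (f N (play f g N).2, g N (play f g N).1)

variable {f g : ℕ → Tape → Tape}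

lemma play_mono (hf : Causal f) (hg : Causal g) :
    ∀ {N N' : ℕ}, N ≤ N' →
      (play f g N).1 <+: (play f g N').1 ∧ (play f g N).2 <+: (play f g N').2
  | 0, _, _ => ⟨List.nil_prefix, List.nil_prefix⟩
  | N + 1, 0, h => absurd h (by omega)
  | N + 1, N' + 1, h => by
    have ih := play_mono hf hg (Nat.le_of_succ_le_succ h)
    exact ⟨hf (Nat.le_of_succ_le_succ h) ih.2, hg (Nat.le_of_succ_le_succ h) ih.1⟩

lemma growing_fst (hf : Causal f) (hg : Causal g) : Growing fun N => (play f g N).1 :=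
  fun _ _ h => (play_mono hf hg h).1

lemma growing_snd (hf : Causal f) (hg : Causal g) : Growing fun N => (play f g N).2 :=
  fun _ _ h => (play_mono hf hg h).2

/-- Whichever of `t` and `b` is longer, both `a` and `f n t` are prefixes of one tape that `f`
writes later in response to the longer one. -/
lemma Causal.compatible (hf : Causal f) {a b t : Tape} {n₀ : ℕ} (ha : a <+: f n₀ b)
    (hb : t <+: b ∨ b <+: t) (n : ℕ) : f n t <+: a ∨ a <+: f n t := by
  rcases hb with hb | hb
  · exact List.prefix_or_prefix_of_prefix (hf (le_max_left n n₀) hb)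
      (ha.trans (hf (le_max_right n n₀) List.prefix_rfl))
  · exact List.prefix_or_prefix_of_prefix (hf (le_max_left n n₀) List.prefix_rfl)
      (ha.trans (hf (le_max_right n n₀) hb))

/-- If each of two tapes can be a response to the other, then the conversation does not deviate
from them. -/
lemma play_compatible (hf : Causal f) (hg : Causal g) {a b : Tape} {n₀ m₀ : ℕ}
    (ha : a <+: f n₀ b) (hb : b <+: g m₀ a) (N : ℕ) :
    ((play f g N).1 <+: a ∨ a <+: (play f g N).1) ∧
      ((play f g N).2 <+: b ∨ b <+: (play f g N).2) := by
  induction N with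
  | zero => exact ⟨Or.inl List.nil_prefix, Or.inl List.nil_prefix⟩
  | succ N ih => exact ⟨hf.compatible ha ih.2 N, hg.compatible hb ih.1 N⟩

/-- A pair at which both strategies have come to rest bounds the whole conversation, by monotonicity
and induction on the rounds. -/
lemma play_prefix_of_closed {a b : Tape} (hf : Causal f) (hg : Causal g)
    (ha : ∀ n, f n b <+: a) (hb : ∀ n, g n a <+: b) (N : ℕ) :
    (play f g N).1 <+: a ∧ (play f g N).2 <+: b := by
  induction N with
  | zero => exact ⟨List.nil_prefix, List.nil_prefix⟩
  | succ N ih =>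
    exact ⟨(hf le_rfl ih.2).trans (ha N), (hg le_rfl ih.1).trans (hb N)⟩

lemma head?_eq_of_prefix {s t : Tape} {m m' : Msg} (h : s <+: t ∨ t <+: s)
    (hs : s.head? = some m) (ht : t.head? = some m') : m = m' := by
  have aux : ∀ {s t : Tape} {m m' : Msg}, s <+: t → s.head? = some m → t.head? = some m' →
      m = m' := by
    rintro s t m m' ⟨r, rfl⟩ hs ht
    cases s with
    | nil => simp at hs
    | cons x l =>
      simp only [List.head?_cons, List.cons_append, Option.some.injEq] at hs ht
      rw [← hs, ← ht]
  rcases h with h | h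
  · exact aux h hs ht
  · exact (aux h ht hs).symm

lemma head?_of_prefix {s t : Tape} {m : Msg} (h : s <+: t) (hs : s.head? = some m) :
    t.head? = some m := by
  obtain ⟨r, rfl⟩ := h
  cases s with
  | nil => simp at hs
  | cons x l => simpa using hs

/-! ### Output that depends on a hidden bit -/

/-- A player B who talks to two versions of a player A, finally outputs which version it is, and
sees the same conversation with both.  The randomness of A and of B is independent up to null
events. -/
structure Duel (Ω α β : Type) [MeasurableSpace Ω] where
  ρ : Measure Ω
  fin : IsFiniteMeasure ρ
  prA : Ω → α
  prB : Ω → β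
  f : Bool → α → ℕ → Tape → Tape
  g : β → ℕ → Tape → Tape
  y : β → ℕ → Tape → Tape
  causal_f : ∀ i a, Causal (f i a)
  causal_g : ∀ b, Causal (g b)
  causal_y : ∀ b, Causal (y b)
  meas : ∀ i N, Measurable fun ω => play (f i (prA ω)) (g (prB ω)) N
  indep : ∀ (s : Set α) (t : Set β), ρ (prA ⁻¹' s) ≠ 0 → ρ (prB ⁻¹' t) ≠ 0 →
    ρ (prA ⁻¹' s ∩ prB ⁻¹' t) ≠ 0
  law : ∀ a b : Tape,
    ρ {ω | ∃ N, a <+: (play (f false (prA ω)) (g (prB ω)) N).1 ∧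
      b <+: (play (f false (prA ω)) (g (prB ω)) N).2} =
    ρ {ω | ∃ N, a <+: (play (f true (prA ω)) (g (prB ω)) N).1 ∧
      b <+: (play (f true (prA ω)) (g (prB ω)) N).2}
  correct : ∀ i, ∀ᵐ ω ∂ρ, ∃ N,
    (y (prB ω) N (play (f i (prA ω)) (g (prB ω)) N).1).head? = some [i]

namespace Duel

variable {Ω α β : Type} [MeasurableSpace Ω] (S : Duel Ω α β)

/-- The messages of A. -/
def u (i : Bool) (ω : Ω) (N : ℕ) : Tape := (play (S.f i (S.prA ω)) (S.g (S.prB ω)) N).1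

/-- The messages of B. -/
def v (i : Bool) (ω : Ω) (N : ℕ) : Tape := (play (S.f i (S.prA ω)) (S.g (S.prB ω)) N).2

lemma growing_u (i : Bool) (ω : Ω) : Growing (S.u i ω) :=
  growing_fst (S.causal_f _ _) (S.causal_g _)

lemma growing_v (i : Bool) (ω : Ω) : Growing (S.v i ω) :=
  growing_snd (S.causal_f _ _) (S.causal_g _)

/-- The first `J` messages in both directions. -/
def trans (i : Bool) (J : ℕ) (ω : Ω) : Tape × Tape := (upTo (S.u i ω) J, upTo (S.v i ω) J)

lemma measurable_trans (i : Bool) (J : ℕ) : Measurable (S.trans i J) := by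
  have hu : ∀ N, Measurable fun ω => (S.u i ω N).take J := fun N =>
    (Measurable.of_discrete (f := fun t : Tape => t.take J)).comp (S.meas i N).fst
  have hv : ∀ N, Measurable fun ω => (S.v i ω N).take J := fun N =>
    (Measurable.of_discrete (f := fun t : Tape => t.take J)).comp (S.meas i N).snd
  refine Measurable.prodMk (measurable_to_countable' fun t => ?_)
    (measurable_to_countable' fun t => ?_)
  · have : (fun ω => upTo (S.u i ω) J) ⁻¹' {t} =
        {ω | ∃ N, ∀ N' ≥ N, (S.u i ω N').take J = t} := by
      ext ω
      exact (S.growing_u i ω).upTo_eq_iff J t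
    rw [this]
    simp only [Set.ofPred_exists, Set.ofPred_forall]
    exact .iUnion fun N => .iInter fun N' => .iInter fun _ => hu N' (measurableSet_singleton t)
  · have : (fun ω => upTo (S.v i ω) J) ⁻¹' {t} =
        {ω | ∃ N, ∀ N' ≥ N, (S.v i ω N').take J = t} := by
      ext ω
      exact (S.growing_v i ω).upTo_eq_iff J t
    rw [this]
    simp only [Set.ofPred_exists, Set.ofPred_forall]
    exact .iUnion fun N => .iInter fun N' => .iInter fun _ => hv N' (measurableSet_singleton t)

/-- For `a`, `b` of length at most `J`, being a prefix of the truncation is the same as being sent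
eventually, which is what `law` controls. Longer `a` or `b` give the empty event. -/
lemma map_trans_cone (J : ℕ) (a b : Tape) :
    S.ρ.map (S.trans false J) {z | a <+: z.1 ∧ b <+: z.2} =
      S.ρ.map (S.trans true J) {z | a <+: z.1 ∧ b <+: z.2} := by
  have hms : MeasurableSet {z : Tape × Tape | a <+: z.1 ∧ b <+: z.2} := .of_discrete
  rw [Measure.map_apply (S.measurable_trans _ _) hms,
    Measure.map_apply (S.measurable_trans _ _) hms]
  by_cases hJ : a.length ≤ J ∧ b.length ≤ J
  · have key : ∀ i, S.trans i J ⁻¹' {z | a <+: z.1 ∧ b <+: z.2} =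
        {ω | ∃ N, a <+: S.u i ω N ∧ b <+: S.v i ω N} := by
      intro i
      ext ω
      constructor
      · rintro ⟨h1, h2⟩
        obtain ⟨N, hN⟩ := (S.growing_u i ω).exists_upTo_prefix J
        obtain ⟨M, hM⟩ := (S.growing_v i ω).exists_upTo_prefix J
        exact ⟨max N M, h1.trans (hN _ (le_max_left _ _)), h2.trans (hM _ (le_max_right _ _))⟩
      · rintro ⟨N, h1, h2⟩
        exact ⟨(S.growing_u i ω).prefix_upTo h1 hJ.1, (S.growing_v i ω).prefix_upTo h2 hJ.2⟩
    rw [key, key]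
    exact S.law a b
  · have key : ∀ i, S.trans i J ⁻¹' {z | a <+: z.1 ∧ b <+: z.2} = ∅ := by
      intro i
      ext ω
      simp only [Set.mem_preimage, Set.mem_ofPred_eq, Set.mem_empty_iff_false, iff_false]
      rintro ⟨h1, h2⟩
      exact hJ ⟨h1.length_le.trans ((S.growing_u i ω).length_upTo_le J),
        h2.length_le.trans ((S.growing_v i ω).length_upTo_le J)⟩
    rw [key, key]

lemma prefix_strict {a s : Tape} (h : a <+: s) (hne : a ≠ s) : ∃ m, a ++ [m] <+: s := by
  obtain ⟨r, rfl⟩ := h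
  cases r with
  | nil => simp at hne
  | cons m r => exact ⟨m, r, by simp⟩

/-- An observer of growing tapes can only test cones ("at least this has been sent"). A single
transcript is a cone minus the countably many cones with one more message, so cones determine the
law. -/
lemma singleton_eq_cones (a b : Tape) : ({(a, b)} : Set (Tape × Tape)) =
    {z | a <+: z.1 ∧ b <+: z.2} \
      ((⋃ m : Msg, {z | a ++ [m] <+: z.1 ∧ b <+: z.2}) ∪
        (⋃ m : Msg, {z | a <+: z.1 ∧ b ++ [m] <+: z.2})) := by
  ext ⟨s, t⟩
  simp only [Set.mem_singleton_iff, Prod.mk.injEq, Set.mem_sdiff, Set.mem_ofPred_eq, Set.mem_union,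
    Set.mem_iUnion, not_or, not_exists, not_and]
  constructor
  · rintro ⟨rfl, rfl⟩
    refine ⟨⟨List.prefix_rfl, List.prefix_rfl⟩, fun m h => ?_, fun m _ h => ?_⟩ <;>
    · have := h.length_le
      simp at this
  · rintro ⟨⟨h1, h2⟩, h3, h4⟩
    constructor
    · by_contra hne
      obtain ⟨m, hm⟩ := prefix_strict h1 (Ne.symm hne)
      exact h3 m hm h2
    · by_contra hne
      obtain ⟨m, hm⟩ := prefix_strict h2 (Ne.symm hne)
      exact h4 m h1 hm

lemma generateFrom_cones : (inferInstance : MeasurableSpace (Tape × Tape)) =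
    MeasurableSpace.generateFrom
      (insert ∅ (Set.range fun z : Tape × Tape =>
        {w : Tape × Tape | z.1 <+: w.1 ∧ z.2 <+: w.2})) := by
  refine le_antisymm (fun s _ => ?_) (fun s _ => .of_discrete)
  have hcone : ∀ a b : Tape, MeasurableSet[MeasurableSpace.generateFrom
      (insert ∅ (Set.range fun z : Tape × Tape =>
        {w : Tape × Tape | z.1 <+: w.1 ∧ z.2 <+: w.2}))]
          {w : Tape × Tape | a <+: w.1 ∧ b <+: w.2} :=
    fun a b => MeasurableSpace.measurableSet_generateFrom (Or.inr ⟨(a, b), rfl⟩)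
  rw [← Set.biUnion_of_singleton s]
  refine MeasurableSet.biUnion s.to_countable fun z _ => ?_
  obtain ⟨a, b⟩ := z
  rw [singleton_eq_cones]
  exact (hcone a b).diff ((MeasurableSet.iUnion fun m => hcone _ _).union
    (MeasurableSet.iUnion fun m => hcone _ _))

/-- The conversation has the same distribution with both versions of A. -/
lemma map_trans (J : ℕ) : S.ρ.map (S.trans false J) = S.ρ.map (S.trans true J) := by
  have := S.fin
  refine MeasureTheory.ext_of_generate_finite _ generateFrom_cones ?_ ?_ ?_
  · rintro s (rfl | ⟨⟨a, b⟩, rfl⟩) t (rfl | ⟨⟨c, d⟩, rfl⟩) hne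
    · simp at hne
    · simp at hne
    · simp at hne
    · obtain ⟨⟨x, y⟩, ⟨h1, h2⟩, h3, h4⟩ := hne
      simp only at h1 h2 h3 h4
      refine Or.inr ?_
      -- Prefixes of a common tape are comparable, so two cones that meet intersect in the cone of
      -- the longer prefixes. Thus the cones and the empty set form a π-system.
      rcases List.prefix_or_prefix_of_prefix h1 h3 with h5 | h5 <;>
      rcases List.prefix_or_prefix_of_prefix h2 h4 with h6 | h6
      · exact ⟨(c, d), by ext w; exact ⟨fun h => ⟨⟨h5.trans h.1, h6.trans h.2⟩, h⟩, fun h => h.2⟩⟩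
      · exact ⟨(c, b), by
          ext w
          exact ⟨fun h => ⟨⟨h5.trans h.1, h.2⟩, h.1, h6.trans h.2⟩, fun h => ⟨h.2.1, h.1.2⟩⟩⟩
      · exact ⟨(a, d), by
          ext w
          exact ⟨fun h => ⟨⟨h.1, h6.trans h.2⟩, h5.trans h.1, h.2⟩, fun h => ⟨h.1.1, h.2.2⟩⟩⟩
      · exact ⟨(a, b), by ext w; exact ⟨fun h => ⟨h, h5.trans h.1, h6.trans h.2⟩, fun h => h.1⟩⟩
  · rintro s (rfl | ⟨⟨a, b⟩, rfl⟩)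
    · simp
    · exact S.map_trans_cone J a b
  · rw [Measure.map_apply (S.measurable_trans _ _) .univ,
      Measure.map_apply (S.measurable_trans _ _) .univ]
    rfl

lemma measure_trans (J : ℕ) (i j : Bool) (V : Set (Tape × Tape)) :
    S.ρ {ω | S.trans i J ω ∈ V} = S.ρ {ω | S.trans j J ω ∈ V} := by
  have key : ∀ i, S.ρ {ω | S.trans i J ω ∈ V} = S.ρ.map (S.trans i J) V := fun i =>
    (Measure.map_apply (S.measurable_trans i J) .of_discrete).symm
  rw [key, key]
  cases i <;> cases j
  · rfl
  · rw [S.map_trans]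
  · rw [S.map_trans]
  · rfl

end Duel

/-- A truncation that does not fill its allowance is the whole tape: nothing more is ever written.
-/
lemma Growing.prefix_of_length_upTo_lt {u : ℕ → Tape} (hu : Growing u) {J : ℕ}
    (h : (upTo u J).length < J) (N : ℕ) : u N <+: upTo u J := by
  obtain ⟨M, hM⟩ := hu.upTo_spec J
  have h1 := hM (max N M) (le_max_right _ _)
  rw [← h1, List.length_take] at h
  rw [← h1, List.take_of_length_le (by omega)]
  exact hu (le_max_left _ _)

/-! ### The rectangle argument, absence of deadlock, and a schedule for asynchronous conversations.
-/

namespace Duel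

variable {Ω α β : Type} [MeasurableSpace Ω] (S : Duel Ω α β)

lemma exists_mem_of_ae {s : Set Ω} {ρ : Measure Ω} (hs : ρ s ≠ 0) {p : Ω → Prop}
    (hp : ∀ᵐ ω ∂ρ, p ω) : ∃ ω ∈ s, p ω :=
  ((frequently_ae_mem_iff.2 hs).and_eventually hp).exists

/-- B cannot take part in a conversation that is possible for the wrong version of A. -/
lemma clash (i : Bool) {a b : Tape}
    (h1 : S.ρ (S.prA ⁻¹' {x | ∃ n, a <+: S.f i x n b}) ≠ 0)
    (h2 : S.ρ (S.prB ⁻¹' {z | (∃ n, b <+: S.g z n a) ∧ ∃ n, (S.y z n a).head? = some [!i]}) ≠ 0) :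
    False := by
  -- By independence A's and B's randomness can be chosen at one `ω`, where moreover B almost surely
  -- answers `i`. The actual conversation there is compatible with `(a, b)`, on which B answers
  -- `!i`.
  obtain ⟨ω, ⟨⟨n₀, ha⟩, ⟨m₀, hb⟩, k₀, hk⟩, N, hN⟩ :=
    exists_mem_of_ae (S.indep _ _ h1 h2) (S.correct i)
  have hc := (play_compatible (S.causal_f i _) (S.causal_g _) ha hb N).1
  have hy : ([i] : Msg) = [!i] := by
    refine head?_eq_of_prefix ?_ hN hk
    rcases hc with hc | hc
    · exact List.prefix_or_prefix_of_prefix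
        (S.causal_y _ (le_max_left N k₀) hc) (S.causal_y _ (le_max_right N k₀) List.prefix_rfl)
    · exact List.prefix_or_prefix_of_prefix
        (S.causal_y _ (le_max_left N k₀) List.prefix_rfl) (S.causal_y _ (le_max_right N k₀) hc)
  cases i <;> simp at hy

/-- The two players do not wait for each other forever. -/
lemma no_deadlock (i : Bool) {a b : Tape}
    (h1 : S.ρ (S.prA ⁻¹' {x | ∀ n, S.f i x n b <+: a}) ≠ 0)
    (h2 : S.ρ (S.prB ⁻¹' {z | ∀ n, S.g z n a <+: b}) ≠ 0) : False := by
  -- One more than both lengths, so that truncating at `J` certifies that a conversation confined to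
  -- `(a, b)` has ended.
  set J := max a.length b.length + 1 with hJ
  have hpos := S.indep _ _ h1 h2
  have hsub : S.prA ⁻¹' {x | ∀ n, S.f i x n b <+: a} ∩ S.prB ⁻¹' {z | ∀ n, S.g z n a <+: b} ⊆
      ⋃ w : {w : Tape × Tape // w.1.length < J ∧ w.2.length < J}, {ω | S.trans i J ω = w.1} := by
    rintro ω ⟨ha, hb⟩
    have hp := play_prefix_of_closed (S.causal_f i _) (S.causal_g _) ha hb
    obtain ⟨N, hN⟩ := (S.growing_u i ω).exists_upTo_prefix J
    obtain ⟨M, hM⟩ := (S.growing_v i ω).exists_upTo_prefix J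
    refine Set.mem_iUnion.2 ⟨⟨S.trans i J ω, ?_, ?_⟩, rfl⟩
    · have := ((hN N le_rfl).trans (hp N).1).length_le
      exact lt_of_le_of_lt this (by omega)
    · have := ((hM M le_rfl).trans (hp M).2).length_le
      exact lt_of_le_of_lt this (by omega)
  -- There are only countably many finished transcripts, so one of them has positive measure.
  obtain ⟨⟨w, hw1, hw2⟩, hw⟩ : ∃ w : {w : Tape × Tape // w.1.length < J ∧ w.2.length < J},
      S.ρ {ω | S.trans i J ω = w.1} ≠ 0 := by
    by_contra hcon
    push Not at hcon
    exact hpos (measure_mono_null hsub (measure_iUnion_null hcon))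
  -- The laws of the truncated transcripts agree, so the other version of A ends with the same
  -- transcript `w` with positive measure.
  have hall : ∀ j, S.ρ {ω | S.trans j J ω = w} ≠ 0 := fun j => by
    have := S.measure_trans J j i {w}
    simp only [Set.mem_singleton_iff] at this
    rwa [this]
  have hend : ∀ j ω, S.trans j J ω = w → (∀ N, S.u j ω N <+: w.1) ∧ (∀ N, S.v j ω N <+: w.2) := by
    rintro j ω rfl
    exact ⟨(S.growing_u j ω).prefix_of_length_upTo_lt hw1,
      (S.growing_v j ω).prefix_of_length_upTo_lt hw2⟩
  -- In a finished conversation both halves are responses to each other and B's answer depends on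
  -- `w.1` alone. A's part is taken from the runs with version `i`, B's part from those with version
  -- `!i`.
  refine S.clash i (a := w.1) (b := w.2) ?_ ?_
  · refine fun h0 => hall i (measure_mono_null ?_ h0)
    rintro ω hω
    obtain ⟨N, hN⟩ := (S.growing_u i ω).exists_upTo_prefix J
    refine ⟨N, ?_⟩
    have h3 : w.1 <+: S.u i ω (N + 1) := by
      have := hN (N + 1) (Nat.le_succ N)
      rw [← hω]
      exact this
    exact h3.trans (S.causal_f i _ le_rfl ((hend i ω hω).2 N))
  · intro h0
    obtain ⟨ω, hω, hbad⟩ := exists_mem_of_ae (hall !i)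
      ((measure_eq_zero_iff_ae_notMem.1 h0).and (S.correct !i))
    obtain ⟨N, hN⟩ := hbad.2
    refine hbad.1 ⟨?_, N, ?_⟩
    · obtain ⟨M, hM⟩ := (S.growing_v (!i) ω).exists_upTo_prefix J
      refine ⟨M, ?_⟩
      have h3 : w.2 <+: S.v (!i) ω (M + 1) := by
        have := hM (M + 1) (Nat.le_succ M)
        rw [← hω]
        exact this
      exact h3.trans (S.causal_g _ le_rfl ((hend _ ω hω).1 M))
    · exact head?_of_prefix (S.causal_y _ le_rfl ((hend _ ω hω).1 N)) hN

/-- After the messages `a` from A and `b` from B, it is A who goes on, whatever B does. -/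
def Turn (a b : Tape) : Prop := ∀ i, S.ρ (S.prA ⁻¹' {x | ∀ n, S.f i x n b <+: a}) = 0

/-- If it is not A's turn, then some version of A rests with positive measure, so by `no_deadlock` B
almost surely does not. One null set serves all `a` and `b` because tapes are countable. -/
lemma ae_turn : ∀ᵐ ω ∂S.ρ, ∀ a b, (S.Turn a b → ∀ i, ∃ n, ¬ S.f i (S.prA ω) n b <+: a) ∧
    (¬ S.Turn a b → ∃ n, ¬ S.g (S.prB ω) n a <+: b) := by
  refine ae_all_iff.2 fun a => ae_all_iff.2 fun b => ?_
  by_cases h : S.Turn a b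
  · have h1 : ∀ᵐ ω ∂S.ρ, ∀ i, ∃ n, ¬ S.f i (S.prA ω) n b <+: a := by
      refine ae_all_iff.2 fun i => ?_
      filter_upwards [measure_eq_zero_iff_ae_notMem.1 (h i)] with ω hω
      simpa using hω
    filter_upwards [h1] with ω hω
    exact ⟨fun _ => hω, fun h' => absurd h h'⟩
  · have h0 : S.ρ (S.prB ⁻¹' {z | ∀ n, S.g z n a <+: b}) = 0 := by
      by_contra hne
      exact h fun i => by_contra fun h1 => S.no_deadlock i h1 hne
    filter_upwards [measure_eq_zero_iff_ae_notMem.1 h0] with ω hω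
    exact ⟨fun h' => absurd h' h, fun _ => by simpa using hω⟩

open Classical in
/-- The number of messages of both players after `j` messages, if each message is written by the
player whose turn it is; `s k` and `t k` are the first `k` messages of A and of B. -/
def sched (s t : ℕ → Tape) : ℕ → ℕ × ℕ
  | 0 => (0, 0)
  | j + 1 =>
    let q := sched s t j
    if S.Turn (s q.1) (t q.2) then (q.1 + 1, q.2) else (q.1, q.2 + 1)

lemma sched_sum (s t : ℕ → Tape) (j : ℕ) : (S.sched s t j).1 + (S.sched s t j).2 = j := by
  induction j with
  | zero => rfl
  | succ j ih =>
    simp only [sched]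
    split_ifs <;> simp only <;> omega

/-- The first `j` decisions look only at `s k` and `t k` with `k < j`, so the schedule can be
computed from a truncated transcript. -/
lemma sched_congr {s t s' t' : ℕ → Tape} :
    ∀ {j : ℕ}, (∀ k < j, s k = s' k ∧ t k = t' k) → S.sched s t j = S.sched s' t' j
  | 0, _ => rfl
  | j + 1, h => by
    have ih := sched_congr (j := j) fun k hk => h k (hk.trans (Nat.lt_succ_self j))
    have hs := S.sched_sum s' t' j
    simp only [sched]
    rw [ih, (h _ (by omega : (S.sched s' t' j).1 < j + 1)).1,
      (h _ (by omega : (S.sched s' t' j).2 < j + 1)).2]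

lemma sched_mono (s t : ℕ → Tape) {j j' : ℕ} (h : j ≤ j') :
    (S.sched s t j).1 ≤ (S.sched s t j').1 ∧ (S.sched s t j).2 ≤ (S.sched s t j').2 := by
  induction h with
  | refl => exact ⟨le_rfl, le_rfl⟩
  | step _ ih =>
    simp only [sched]
    split_ifs <;> simp only <;> omega

/-- The scheduled messages of both players are responses to those of the other one. -/
lemma sched_responds : ∀ᵐ ω ∂S.ρ, ∀ i j,
    (∃ n, upTo (S.u i ω) (S.sched (upTo (S.u i ω)) (upTo (S.v i ω)) j).1 <+:
      S.f i (S.prA ω) n (upTo (S.v i ω) (S.sched (upTo (S.u i ω)) (upTo (S.v i ω)) j).2)) ∧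
    (∃ n, upTo (S.v i ω) (S.sched (upTo (S.u i ω)) (upTo (S.v i ω)) j).2 <+:
      S.g (S.prB ω) n (upTo (S.u i ω) (S.sched (upTo (S.u i ω)) (upTo (S.v i ω)) j).1)) := by
  filter_upwards [S.ae_turn] with ω hω i j
  have hu := S.growing_u i ω
  have hv := S.growing_v i ω
  induction j with
  | zero =>
    have h0 : ∀ u : ℕ → Tape, Growing u → upTo u 0 = [] := fun u hu =>
      List.length_eq_zero_iff.1 (Nat.le_zero.1 (hu.length_upTo_le 0))
    simp only [sched, h0 _ hu, h0 _ hv]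
    exact ⟨⟨0, List.nil_prefix⟩, ⟨0, List.nil_prefix⟩⟩
  | succ j ih =>
    simp only [sched]
    set q := S.sched (upTo (S.u i ω)) (upTo (S.v i ω)) j
    obtain ⟨⟨n, hn⟩, ⟨m, hm⟩⟩ := ih
    split_ifs with h
    · obtain ⟨k, hk⟩ := (hω _ _).1 h i
      refine ⟨⟨k, ?_⟩, ⟨m, hm.trans (S.causal_g _ le_rfl (hu.upTo_mono (Nat.le_succ _)))⟩⟩
      obtain ⟨N, hN⟩ := hv.exists_upTo_prefix q.2
      refine hu.upTo_succ_prefix (N := max k N + 1) ?_ hk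
      exact S.causal_f i _ (le_max_left _ _) (hN _ (le_max_right _ _))
    · obtain ⟨k, hk⟩ := (hω _ _).2 h
      refine ⟨⟨n, hn.trans (S.causal_f i _ le_rfl (hv.upTo_mono (Nat.le_succ _)))⟩, ⟨k, ?_⟩⟩
      obtain ⟨N, hN⟩ := hu.exists_upTo_prefix q.1
      refine hv.upTo_succ_prefix (N := max k N + 1) ?_ hk
      exact S.causal_g _ (le_max_left _ _) (hN _ (le_max_right _ _))

/-- A common part of the conversations with both versions of A. -/
def part (k j : ℕ) (s t : ℕ → Tape) : Tape × Tape :=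
  (s (max k (S.sched s t j).1), t (S.sched s t j).2)

/-- The part is a function of the first `max k j` messages in each direction, the same function for
both versions of A. Hence its law does not depend on the version. -/
lemma part_eq_trans (i : Bool) (k j : ℕ) (ω : Ω) :
    S.part k j (upTo (S.u i ω)) (upTo (S.v i ω)) =
      S.part k j (fun l => (S.trans i (max k j) ω).1.take l)
        (fun l => (S.trans i (max k j) ω).2.take l) := by
  have h : ∀ l ≤ max k j, upTo (S.u i ω) l = (S.trans i (max k j) ω).1.take l ∧
      upTo (S.v i ω) l = (S.trans i (max k j) ω).2.take l := fun l hl =>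
    ⟨((S.growing_u i ω).upTo_take hl).symm, ((S.growing_v i ω).upTo_take hl).symm⟩
  have hs := S.sched_congr (j := j) fun l hl => h l (hl.le.trans (le_max_right _ _))
  have hsum := S.sched_sum (fun l => (S.trans i (max k j) ω).1.take l)
    (fun l => (S.trans i (max k j) ω).2.take l) j
  simp only [part, hs]
  rw [(h _ (by omega)).1, (h _ (by omega)).2]

/-- Continuity from below holds for outer measures as well, so `E` need not be measurable. Half of
the mass is chosen because two disjoint events cannot both exceed it. -/
lemma eventually_half {E : ℕ → Set Ω} (hE : ∀ᵐ ω ∂S.ρ, ∃ k, ∀ k' ≥ k, ω ∈ E k')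
    (h0 : S.ρ ≠ 0) : ∃ k, S.ρ Set.univ / 2 < S.ρ (E k) := by
  have := S.fin
  have hmono : Monotone fun k => ⋂ k' ≥ k, E k' := fun k l hkl =>
    Set.biInter_subset_biInter_left fun k' (hk' : l ≤ k') => hkl.trans hk'
  have htend := tendsto_measure_iUnion_atTop (μ := S.ρ) hmono
  have huniv : S.ρ (⋃ k, ⋂ k' ≥ k, E k') = S.ρ Set.univ := by
    refine measure_congr (Filter.eventuallyEq_univ.2 ?_)
    filter_upwards [hE] with ω hω
    obtain ⟨k, hk⟩ := hω
    exact Set.mem_iUnion.2 ⟨k, Set.mem_iInter₂.2 hk⟩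
  rw [huniv] at htend
  have hlt : S.ρ Set.univ / 2 < S.ρ Set.univ :=
    ENNReal.half_lt_self (by simpa using h0) (measure_ne_top _ _)
  obtain ⟨k, hk⟩ := (htend.eventually (lt_mem_nhds hlt)).exists
  exact ⟨k, hk.trans_le (measure_mono (Set.biInter_subset_of_mem (le_refl k)))⟩

/-- Cut the conversation so that, on more than half of the mass, the cut determines B's answer in
the runs with version `true`, and A's half of the cut is a response to B's half in the runs with
version `false`. B's half is always a response to A's half. The cut has the same law in both
versions, so some value of it admits both behaviours, against `clash`. -/
theorem measure_eq_zero : S.ρ = 0 := by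
  by_contra h0
  have := S.fin
  -- the output is known after `k` messages of A
  obtain ⟨k, hk⟩ := S.eventually_half
    (E := fun k => {ω | ∃ n, (S.y (S.prB ω) n (upTo (S.u true ω) k)).head? = some [true]}) (by
      filter_upwards [S.correct true] with ω hω
      obtain ⟨N, hN⟩ := hω
      refine ⟨(S.u true ω N).length, fun k' hk' => ⟨N, ?_⟩⟩
      exact head?_of_prefix (S.causal_y _ le_rfl
        ((S.growing_u true ω).prefix_upTo List.prefix_rfl hk')) hN) h0
  -- these messages of A are responses to the scheduled messages of B
  obtain ⟨j, hj⟩ := S.eventually_half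
    (E := fun j => {ω | ∃ n, (S.part k j (upTo (S.u false ω)) (upTo (S.v false ω))).1 <+:
      S.f false (S.prA ω) n (S.part k j (upTo (S.u false ω)) (upTo (S.v false ω))).2}) (by
      filter_upwards [S.sched_responds] with ω hω
      have hu := S.growing_u false ω
      have hv := S.growing_v false ω
      by_cases hb : ∃ j, k ≤ (S.sched (upTo (S.u false ω)) (upTo (S.v false ω)) j).1
      · obtain ⟨j, hj⟩ := hb
        refine ⟨j, fun j' hj' => ?_⟩
        simp only [part]
        rw [max_eq_right (hj.trans (S.sched_mono _ _ hj').1)]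
        exact (hω false j').1
      · push Not at hb
        obtain ⟨N, hN⟩ := hu.exists_upTo_prefix k
        refine ⟨k + (S.v false ω N).length, fun j' hj' => ?_⟩
        simp only [part]
        rw [max_eq_left (hb j').le]
        have hsum := S.sched_sum (upTo (S.u false ω)) (upTo (S.v false ω)) j'
        have hb' := hb j'
        refine ⟨N, (hN (N + 1) (Nat.le_succ N)).trans (S.causal_f false _ le_rfl ?_)⟩
        exact hv.prefix_upTo (N := N) List.prefix_rfl (by unfold Duel.v at *; omega)) h0
  set T : Bool → Ω → Tape × Tape := fun i ω => S.part k j (upTo (S.u i ω)) (upTo (S.v i ω)) with hT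
  -- Values of the cut at which version `false` of A almost never responds. Each value lies in `F₀`,
  -- where A's event is null, or outside, where B's event is null.
  set F₀ : Set (Tape × Tape) := {w | S.ρ ({ω | T false ω = w} ∩
    {ω | ∃ n, (T false ω).1 <+: S.f false (S.prA ω) n (T false ω).2}) = 0} with hF₀
  have hlaw : ∀ V : Set (Tape × Tape), S.ρ {ω | T false ω ∈ V} = S.ρ {ω | T true ω ∈ V} := by
    intro V
    have := S.measure_trans (max k j) false true {z | S.part k j (fun l => z.1.take l)
      (fun l => z.2.take l) ∈ V}
    simp only [hT, part_eq_trans]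
    exact this
  have hnull : S.ρ ({ω | T false ω ∈ F₀} ∩
      {ω | ∃ n, (T false ω).1 <+: S.f false (S.prA ω) n (T false ω).2}) = 0 := by
    refine measure_mono_null ?_ (measure_biUnion_null_iff F₀.to_countable |>.2 fun w hw => hw)
    rintro ω ⟨h1, h2⟩
    exact Set.mem_biUnion h1 ⟨rfl, h2⟩
  have hnull' : S.ρ ({ω | T true ω ∈ F₀ᶜ} ∩
      {ω | ∃ n, (S.y (S.prB ω) n (upTo (S.u true ω) k)).head? = some [true]}) = 0 := by
    rw [measure_eq_zero_iff_ae_notMem]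
    -- Outside `F₀` version `false` of A can take part in the cut, so by `clash` B cannot take part
    -- in it and answer `true`.
    have hz : ∀ w ∈ F₀ᶜ, S.ρ (S.prB ⁻¹' {z | (∃ n, w.2 <+: S.g z n w.1) ∧
        ∃ n, (S.y z n w.1).head? = some [!false]}) = 0 := by
      intro w hw
      by_contra hne
      refine S.clash false ?_ hne
      refine fun h1 => hw (measure_mono_null ?_ h1)
      rintro ω ⟨rfl, h2⟩
      exact h2
    have hz' : ∀ᵐ ω ∂S.ρ, ∀ w ∈ F₀ᶜ, ω ∉ S.prB ⁻¹' {z | (∃ n, w.2 <+: S.g z n w.1) ∧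
        ∃ n, (S.y z n w.1).head? = some [!false]} :=
      (ae_ball_iff F₀ᶜ.to_countable).2 fun w hw => measure_eq_zero_iff_ae_notMem.1 (hz w hw)
    filter_upwards [hz', S.sched_responds] with ω h1 h2
    rintro ⟨h3, n, hn⟩
    refine h1 _ h3 ⟨?_, n, ?_⟩
    · obtain ⟨m, hm⟩ := (h2 true j).2
      exact ⟨m, hm.trans (S.causal_g _ le_rfl
        ((S.growing_u true ω).upTo_mono (le_max_right _ _)))⟩
    · exact head?_of_prefix (S.causal_y _ le_rfl
        ((S.growing_u true ω).upTo_mono (le_max_left _ _))) hn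
  have hmeas : MeasurableSet {ω | T true ω ∈ F₀} := by
    simp only [hT, part_eq_trans]
    exact S.measurable_trans true (max k j) (t := {z | S.part k j (fun l => z.1.take l)
      (fun l => z.2.take l) ∈ F₀}) .of_discrete
  have hle1 : S.ρ {ω | ∃ n, (T false ω).1 <+: S.f false (S.prA ω) n (T false ω).2} ≤
      S.ρ {ω | T true ω ∈ F₀}ᶜ := by
    rw [← show S.ρ {ω | T false ω ∈ F₀ᶜ} = S.ρ {ω | T true ω ∈ F₀}ᶜ from
      hlaw F₀ᶜ]
    refine (measure_mono fun ω hω => ?_).trans ((measure_union_le _ _).trans_eq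
      ((congrArg (_ + ·) hnull).trans (add_zero _)))
    by_cases h : T false ω ∈ F₀
    · exact Or.inr ⟨h, hω⟩
    · exact Or.inl h
  have hle2 : S.ρ {ω | ∃ n, (S.y (S.prB ω) n (upTo (S.u true ω) k)).head? = some [true]} ≤
      S.ρ {ω | T true ω ∈ F₀} := by
    refine (measure_mono fun ω hω => ?_).trans ((measure_union_le _ _).trans_eq
      ((congrArg (_ + ·) hnull').trans (add_zero _)))
    by_cases h : T true ω ∈ F₀
    · exact Or.inl h
    · exact Or.inr ⟨h, hω⟩
  -- The two events exceed half of the mass each, but are bounded by complementary events.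
  have hsum := ENNReal.add_lt_add (hk.trans_le hle2) (hj.trans_le hle1)
  rw [measure_add_measure_compl hmeas, ENNReal.add_halves] at hsum
  exact lt_irrefl _ hsum

end Duel

/-! ### The wiring of a distinguisher and of a player -/

section Wiring

variable {I O IA OA IB OB U V J K : Type}

/-- The wiring of a distinguisher. -/
def wireD : O ⊕ I → Empty ⊕ ((I ⊕ Unit) ⊕ O)
  | Sum.inl o => Sum.inr (Sum.inr o)
  | Sum.inr i => Sum.inr (Sum.inl (Sum.inl i))

/-- The wiring of a system that is attached to the interface of A. -/
def wireA : (U ⊕ K) ⊕ (J ⊕ IB) → (U ⊕ IB) ⊕ ((V ⊕ J) ⊕ (K ⊕ OB))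
  | Sum.inl (Sum.inl u) => Sum.inl (Sum.inl u)
  | Sum.inl (Sum.inr o) => Sum.inr (Sum.inr (Sum.inl o))
  | Sum.inr (Sum.inl i) => Sum.inr (Sum.inl (Sum.inr i))
  | Sum.inr (Sum.inr i) => Sum.inl (Sum.inr i)

/-- The wiring of a system that is attached to the interface of B. -/
def wireB : (U ⊕ K) ⊕ (IA ⊕ J) → (IA ⊕ U) ⊕ ((V ⊕ J) ⊕ (OA ⊕ K))
  | Sum.inl (Sum.inl u) => Sum.inl (Sum.inr u)
  | Sum.inl (Sum.inr o) => Sum.inr (Sum.inr (Sum.inr o))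
  | Sum.inr (Sum.inl i) => Sum.inl (Sum.inl i)
  | Sum.inr (Sum.inr i) => Sum.inr (Sum.inl (Sum.inr i))

/-- The exposed channels of a system that is attached to the interface of A. -/
def exposeA : V ⊕ OB → (V ⊕ J) ⊕ (K ⊕ OB)
  | Sum.inl v => Sum.inl (Sum.inl v)
  | Sum.inr o => Sum.inr (Sum.inr o)

/-- The exposed channels of a system that is attached to the interface of B. -/
def exposeB : OA ⊕ V → (V ⊕ J) ⊕ (OA ⊕ K)
  | Sum.inl o => Sum.inr (Sum.inl o)
  | Sum.inr v => Sum.inl (Sum.inl v)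

lemma prOne_eq (D : System O (I ⊕ Unit)) (F : System I O) :
    prOne D F = (D.P.prod F.P).real {ω | ∃ n,
      ((par D F).loop wireD ω n (fun _ => []) n (Sum.inl (Sum.inr ()))).head? = some [true]} := by
  have : (wireD : O ⊕ I → Empty ⊕ ((I ⊕ Unit) ⊕ O)) = (fun
        | Sum.inl o => Sum.inr (Sum.inr o)
        | Sum.inr i => Sum.inr (Sum.inl (Sum.inl i))) := by
    funext x
    rcases x with x | x <;> rfl
  rw [this]
  rfl

lemma attachA_eq (π : System (U ⊕ K) (V ⊕ J)) (F : System (J ⊕ IB) (K ⊕ OB)) :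
    attachA π F = wire (par π F) wireA exposeA := by
  unfold attachA
  congr 1
  funext x
  rcases x with (x | x) | (x | x) <;> rfl

lemma attachB_eq (π : System (U ⊕ K) (V ⊕ J)) (F : System (IA ⊕ J) (OA ⊕ K)) :
    attachB π F = wire (par π F) wireB exposeB := by
  unfold attachB
  congr 1
  funext x
  rcases x with (x | x) | (x | x) <;> rfl

lemma wire_out_congr {E O' : Type} (S : System I O) {w w' : I → E ⊕ O} {e e' : O' → O}
    (hw : ∀ i, w i = w' i) (he : ∀ o, e o = e' o) (ω : S.Ω) (n : ℕ) (h : Hist E) :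
    (wire S w e).out ω n h = fun o => S.loop w' ω n h n (e' o) := by
  obtain rfl : w = w' := funext hw
  obtain rfl : e = e' := funext he
  rfl

lemma attachA_out (π : System (U ⊕ K) (V ⊕ J)) (F : System (J ⊕ IB) (K ⊕ OB)) (ω : π.Ω × F.Ω)
    (n : ℕ) (h : Hist (U ⊕ IB)) :
    (attachA π F).out ω n h = fun o => (par π F).loop wireA ω n h n (exposeA o) :=
  wire_out_congr _ (by rintro ((_ | _) | (_ | _)) <;> rfl) (by rintro (_ | _) <;> rfl) _ _ _

lemma attachB_out (π : System (U ⊕ K) (V ⊕ J)) (F : System (IA ⊕ J) (OA ⊕ K)) (ω : π.Ω × F.Ω)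
    (n : ℕ) (h : Hist (IA ⊕ U)) :
    (attachB π F).out ω n h = fun o => (par π F).loop wireB ω n h n (exposeB o) :=
  wire_out_congr _ (by rintro ((_ | _) | (_ | _)) <;> rfl) (by rintro (_ | _) <;> rfl) _ _ _

end Wiring

/-! ### Tests -/

lemma Hist.Le.refl {I : Type} (h : Hist I) : h.Le h := fun _ => List.prefix_rfl

lemma Hist.Le.elim {I J : Type} {h h' : Hist I} {k k' : Hist J} (h1 : h.Le h') (h2 : k.Le k') :
    Hist.Le (Sum.elim h k : Hist (I ⊕ J)) (Sum.elim h' k') := by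
  rintro (i | j)
  · exact h1 i
  · exact h2 j

/-- A test of what has been received, which remains successful when more is received. -/
structure Test (O : Type) where
  holds : Hist O → Prop
  mono : ∀ {h h' : Hist O}, h.Le h' → holds h → holds h'
  meas : MeasurableSet {h | holds h}

/-- The probability that the test finally succeeds if `F` receives `h₀`. -/
def obs {I O : Type} (F : System I O) (h₀ : Hist I) (T : Test O) : ℝ :=
  F.P.real {ω | ∃ n, T.holds (F.out ω n h₀)}

open Classical in
/-- The output of a distinguisher that waits until the test succeeds. -/
def Test.bit {O : Type} (T : Test O) (h : Hist O) : Tape := if T.holds h then [[true]] else []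

lemma Test.bit_mono {O : Type} (T : Test O) {h h' : Hist O} (hh : h.Le h') :
    T.bit h <+: T.bit h' := by
  unfold Test.bit
  split_ifs with h1 h2
  · exact List.prefix_rfl
  · exact absurd (T.mono hh h1) h2
  · exact List.nil_prefix
  · exact List.nil_prefix

lemma Test.measurable_bit {O : Type} (T : Test O) : Measurable T.bit := by
  unfold Test.bit
  exact Measurable.ite T.meas measurable_const measurable_const

lemma Test.head?_bit {O : Type} (T : Test O) (h : Hist O) :
    (T.bit h).head? = some [true] ↔ T.holds h := by
  unfold Test.bit
  split_ifs with h1 <;> simp [h1]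

variable {I O I' O' IA OA IB OB U V J K UA VA UB VB : Type}

/-- The distinguisher that sends `h₀` and waits until the test succeeds. -/
def probe (h₀ : Hist I) (T : Test O) : System O (I ⊕ Unit) :=
  determ (fun h => Sum.elim h₀ fun _ => T.bit h)
    (fun hh => by
      rintro (i | _)
      · exact List.prefix_rfl
      · exact T.bit_mono hh)
    (by
      refine measurable_pi_iff.2 ?_
      rintro (i | _)
      · exact measurable_const
      · exact T.measurable_bit)

lemma prOne_probe (h₀ : Hist I) (T : Test O) (F : System I O) :
    prOne (probe h₀ T) F = obs F h₀ T := by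
  let x : Unit × F.Ω → ℕ → ℕ → Hist _ :=
    fun ω n k => (par (probe h₀ T) F).loop wireD ω n (fun _ => []) k
  -- Three rounds of message passing: `h₀` is sent, `F` answers, the test sees the answer.
  have hout : ∀ ω n, x ω (n + 3) (n + 3) (Sum.inl (Sum.inr ())) = T.bit (F.out ω.2 (n + 3) h₀) :=
    fun _ _ => rfl
  have hset : {ω | ∃ n, (x ω n n (Sum.inl (Sum.inr ()))).head? = some [true]} =
      Set.univ ×ˢ {ω | ∃ n, T.holds (F.out ω n h₀)} := by
    ext ω
    simp only [Set.mem_ofPred_eq, Set.mem_prod, Set.mem_univ, true_and]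
    constructor
    · rintro ⟨n, hn⟩
      have h1 := head?_of_prefix ((par (probe h₀ T) F).loop_mono wireD ω (Nat.le_add_right n 3)
        (Hist.Le.refl _) (Nat.le_add_right n 3) (Sum.inl (Sum.inr ()))) hn
      exact ⟨_, (T.head?_bit _).1 h1⟩
    · rintro ⟨n, hn⟩
      refine ⟨n + 3, ?_⟩
      rw [hout, T.head?_bit]
      exact T.mono (F.mono _ (Nat.le_add_right n 3) (Hist.Le.refl _)) hn
  rw [prOne_eq]
  change ((Measure.dirac ()).prod F.P).real
    {ω | ∃ n, (x ω n n (Sum.inl (Sum.inr ()))).head? = some [true]} = _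
  rw [hset, Measure.real, Measure.prod_prod]
  simp [obs, Measure.real]

lemma Close.obs_eq {F F' : System I O} (h : Close 0 F F') (h₀ : Hist I) (T : Test O) :
    obs F h₀ T = obs F' h₀ T := by
  have := h (probe h₀ T)
  rw [prOne_probe, prOne_probe] at this
  exact sub_eq_zero.1 (abs_eq_zero.1 (le_antisymm this (abs_nonneg _)))

/-- The distinguisher that runs `π` on the interface of B. -/
def absorbB (π : System (U ⊕ K) (V ⊕ J)) (hA : Hist IA) (hU : Hist U) (T : Test (OA ⊕ V)) :
    System (OA ⊕ K) ((IA ⊕ J) ⊕ Unit) where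
  Ω := π.Ω
  P := π.P
  out ω n h :=
    let s : Hist (V ⊕ J) := π.out ω n (Sum.elim hU fun k => h (Sum.inr k))
    Sum.elim (Sum.elim hA fun j => s (Sum.inr j))
      fun _ => T.bit (Sum.elim (fun o => h (Sum.inl o)) fun v => s (Sum.inl v))
  mono ω n n' h h' hn hh := by
    have hs := π.mono ω hn (Hist.Le.elim (Hist.Le.refl hU) fun k => hh (Sum.inr k))
    rintro ((i | j) | _)
    · exact List.prefix_rfl
    · exact hs _
    · exact T.bit_mono (Hist.Le.elim (fun o => hh (Sum.inl o)) fun v => hs (Sum.inl v))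
  meas n := by
    have hr : Measurable fun z : π.Ω × Hist (OA ⊕ K) =>
        (Sum.elim hU (fun k => z.2 (Sum.inr k)) : Hist (U ⊕ K)) := by
      refine measurable_pi_iff.2 ?_
      rintro (u | k)
      · exact measurable_const
      · exact (measurable_pi_apply _).comp measurable_snd
    have hs := (π.meas n).comp (measurable_fst.prodMk hr)
    refine measurable_pi_iff.2 ?_
    rintro ((i | j) | _)
    · exact measurable_const
    · exact measurable_pi_iff.1 hs (Sum.inr j)
    · refine T.measurable_bit.comp (measurable_pi_iff.2 ?_)
      rintro (o | v)
      · exact (measurable_pi_apply (Sum.inl o)).comp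
          (measurable_snd (α := π.Ω) (β := Hist (OA ⊕ K)))
      · exact measurable_pi_iff.1 hs (Sum.inl v)

/-- Both networks consist of `π` and `F`. They differ only in that the input `hA` reaches `F` one
round later when the distinguisher sends it, so each network is bounded by the other up to a delay
of one round. -/
lemma prOne_absorbB (π : System (U ⊕ K) (V ⊕ J)) (hA : Hist IA) (hU : Hist U) (T : Test (OA ⊕ V))
    (F : System (IA ⊕ J) (OA ⊕ K)) :
    prOne (absorbB π hA hU T) F = obs (attachB π F) (Sum.elim hA hU) T := by
  rw [prOne_eq, attachB_eq]
  let X : System _ _ := par (absorbB π hA hU T) F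
  let Y : System _ _ := par π F
  let h₀ : Hist (IA ⊕ U) := Sum.elim hA hU
  let x : π.Ω × F.Ω → ℕ → ℕ → Hist _ := fun ω n k => X.loop wireD ω n (fun _ => []) k
  let y : π.Ω × F.Ω → ℕ → ℕ → Hist _ := fun ω n k => Y.loop wireB ω n h₀ k
  have hxy : ∀ ω n k, (∀ o, x ω n k (Sum.inr o) <+: y ω n k (Sum.inr o)) ∧
      (∀ j, x ω n k (Sum.inl (Sum.inl (Sum.inr j))) <+: y ω n k (Sum.inl (Sum.inr j))) ∧
      (∀ i, x ω n k (Sum.inl (Sum.inl (Sum.inl i))) <+: hA i) := by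
    intro ω n k
    induction k with
    | zero => exact ⟨fun _ => List.nil_prefix, fun _ => List.nil_prefix, fun _ => List.nil_prefix⟩
    | succ k ih =>
      refine ⟨F.mono ω.2 le_rfl ?_, fun j => π.mono ω.1 le_rfl ?_ (Sum.inr j),
        fun i => List.prefix_rfl⟩
      · rintro (i | j)
        · exact ih.2.2 i
        · exact ih.2.1 j
      · rintro (u | k)
        · exact List.prefix_rfl
        · exact ih.1 (Sum.inr k)
  have hyx : ∀ ω n k, (∀ o, y ω n k (Sum.inr o) <+: x ω n (k + 1) (Sum.inr o)) ∧
      (∀ j, y ω n k (Sum.inl (Sum.inr j)) <+: x ω n (k + 1) (Sum.inl (Sum.inl (Sum.inr j)))) := by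
    intro ω n k
    induction k with
    | zero => exact ⟨fun _ => List.nil_prefix, fun _ => List.nil_prefix⟩
    | succ k ih =>
      refine ⟨F.mono ω.2 le_rfl ?_, fun j => π.mono ω.1 le_rfl ?_ (Sum.inr j)⟩
      · rintro (i | j)
        · exact List.prefix_rfl
        · exact ih.2 j
      · rintro (u | k)
        · exact List.prefix_rfl
        · exact ih.1 (Sum.inr k)
  have hset : {ω | ∃ n, (x ω n n (Sum.inl (Sum.inr ()))).head? = some [true]} =
      {ω | ∃ n, T.holds ((wire Y wireB exposeB).out ω n h₀)} := by
    ext ω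
    constructor
    · rintro ⟨n, hn⟩
      have h1 := head?_of_prefix (X.loop_mono wireD ω (Nat.le_succ n) (Hist.Le.refl _)
        (Nat.le_succ n) (Sum.inl (Sum.inr ()))) hn
      have h2 := (T.head?_bit _).1 h1
      refine ⟨n + 1, T.mono ?_ h2⟩
      rintro (o | v)
      · exact ((hxy ω (n + 1) n).1 (Sum.inl o)).trans
          (Y.loop_mono wireB ω le_rfl (Hist.Le.refl _) (Nat.le_succ n) (Sum.inr (Sum.inl o)))
      · refine π.mono ω.1 le_rfl ?_ (Sum.inl v)
        rintro (u | k)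
        · exact List.prefix_rfl
        · exact (hxy ω (n + 1) n).1 (Sum.inr k)
    · rintro ⟨n, hn⟩
      refine ⟨n + 2, (T.head?_bit _).2 (T.mono ?_ hn)⟩
      rintro (o | v)
      · exact (Y.loop_mono wireB ω (Nat.le_add_right n 2) (Hist.Le.refl _) le_rfl
          (Sum.inr (Sum.inl o))).trans ((hyx ω (n + 2) n).1 (Sum.inl o))
      · refine (Y.loop_mono wireB ω (Nat.le_add_right n 2) (Hist.Le.refl _) (Nat.le_succ n)
          (Sum.inl (Sum.inl v))).trans ?_
        refine π.mono ω.1 le_rfl ?_ (Sum.inl v)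
        rintro (u | k)
        · exact List.prefix_rfl
        · exact (hyx ω (n + 2) n).1 (Sum.inr k)
  exact congrArg (fun s => (π.P.prod F.P).real s) hset

/-- The distinguisher that runs `π` on the interface of A. -/
def absorbA (π : System (U ⊕ K) (V ⊕ J)) (hU : Hist U) (hB : Hist IB) (T : Test (V ⊕ OB)) :
    System (K ⊕ OB) ((J ⊕ IB) ⊕ Unit) where
  Ω := π.Ω
  P := π.P
  out ω n h :=
    let s : Hist (V ⊕ J) := π.out ω n (Sum.elim hU fun k => h (Sum.inl k))
    Sum.elim (Sum.elim (fun j => s (Sum.inr j)) hB)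
      fun _ => T.bit (Sum.elim (fun v => s (Sum.inl v)) fun o => h (Sum.inr o))
  mono ω n n' h h' hn hh := by
    have hs := π.mono ω hn (Hist.Le.elim (Hist.Le.refl hU) fun k => hh (Sum.inl k))
    rintro ((j | i) | _)
    · exact hs _
    · exact List.prefix_rfl
    · exact T.bit_mono (Hist.Le.elim (fun v => hs (Sum.inl v)) fun o => hh (Sum.inr o))
  meas n := by
    have hr : Measurable fun z : π.Ω × Hist (K ⊕ OB) =>
        (Sum.elim hU (fun k => z.2 (Sum.inl k)) : Hist (U ⊕ K)) := by
      refine measurable_pi_iff.2 ?_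
      rintro (u | k)
      · exact measurable_const
      · exact (measurable_pi_apply _).comp measurable_snd
    have hs := (π.meas n).comp (measurable_fst.prodMk hr)
    refine measurable_pi_iff.2 ?_
    rintro ((j | i) | _)
    · exact measurable_pi_iff.1 hs (Sum.inr j)
    · exact measurable_const
    · refine T.measurable_bit.comp (measurable_pi_iff.2 ?_)
      rintro (v | o)
      · exact measurable_pi_iff.1 hs (Sum.inl v)
      · exact (measurable_pi_apply (Sum.inr o)).comp
          (measurable_snd (α := π.Ω) (β := Hist (K ⊕ OB)))

lemma prOne_absorbA (π : System (U ⊕ K) (V ⊕ J)) (hU : Hist U) (hB : Hist IB) (T : Test (V ⊕ OB))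
    (F : System (J ⊕ IB) (K ⊕ OB)) :
    prOne (absorbA π hU hB T) F = obs (attachA π F) (Sum.elim hU hB) T := by
  rw [prOne_eq, attachA_eq]
  let X : System _ _ := par (absorbA π hU hB T) F
  let Y : System _ _ := par π F
  let h₀ : Hist (U ⊕ IB) := Sum.elim hU hB
  let x : π.Ω × F.Ω → ℕ → ℕ → Hist _ := fun ω n k => X.loop wireD ω n (fun _ => []) k
  let y : π.Ω × F.Ω → ℕ → ℕ → Hist _ := fun ω n k => Y.loop wireA ω n h₀ k
  have hxy : ∀ ω n k, (∀ o, x ω n k (Sum.inr o) <+: y ω n k (Sum.inr o)) ∧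
      (∀ j, x ω n k (Sum.inl (Sum.inl (Sum.inl j))) <+: y ω n k (Sum.inl (Sum.inr j))) ∧
      (∀ i, x ω n k (Sum.inl (Sum.inl (Sum.inr i))) <+: hB i) := by
    intro ω n k
    induction k with
    | zero => exact ⟨fun _ => List.nil_prefix, fun _ => List.nil_prefix, fun _ => List.nil_prefix⟩
    | succ k ih =>
      refine ⟨F.mono ω.2 le_rfl ?_, fun j => π.mono ω.1 le_rfl ?_ (Sum.inr j),
        fun i => List.prefix_rfl⟩
      · rintro (j | i)
        · exact ih.2.1 j
        · exact ih.2.2 i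
      · rintro (u | k)
        · exact List.prefix_rfl
        · exact ih.1 (Sum.inl k)
  have hyx : ∀ ω n k, (∀ o, y ω n k (Sum.inr o) <+: x ω n (k + 1) (Sum.inr o)) ∧
      (∀ j, y ω n k (Sum.inl (Sum.inr j)) <+: x ω n (k + 1) (Sum.inl (Sum.inl (Sum.inl j)))) := by
    intro ω n k
    induction k with
    | zero => exact ⟨fun _ => List.nil_prefix, fun _ => List.nil_prefix⟩
    | succ k ih =>
      refine ⟨F.mono ω.2 le_rfl ?_, fun j => π.mono ω.1 le_rfl ?_ (Sum.inr j)⟩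
      · rintro (j | i)
        · exact ih.2 j
        · exact List.prefix_rfl
      · rintro (u | k)
        · exact List.prefix_rfl
        · exact ih.1 (Sum.inl k)
  have hset : {ω | ∃ n, (x ω n n (Sum.inl (Sum.inr ()))).head? = some [true]} =
      {ω | ∃ n, T.holds ((wire Y wireA exposeA).out ω n h₀)} := by
    ext ω
    constructor
    · rintro ⟨n, hn⟩
      have h1 := head?_of_prefix (X.loop_mono wireD ω (Nat.le_succ n) (Hist.Le.refl _)
        (Nat.le_succ n) (Sum.inl (Sum.inr ()))) hn
      have h2 := (T.head?_bit _).1 h1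
      refine ⟨n + 1, T.mono ?_ h2⟩
      rintro (v | o)
      · refine π.mono ω.1 le_rfl ?_ (Sum.inl v)
        rintro (u | k)
        · exact List.prefix_rfl
        · exact (hxy ω (n + 1) n).1 (Sum.inl k)
      · exact ((hxy ω (n + 1) n).1 (Sum.inr o)).trans
          (Y.loop_mono wireA ω le_rfl (Hist.Le.refl _) (Nat.le_succ n) (Sum.inr (Sum.inr o)))
    · rintro ⟨n, hn⟩
      refine ⟨n + 2, (T.head?_bit _).2 (T.mono ?_ hn)⟩
      rintro (v | o)
      · refine (Y.loop_mono wireA ω (Nat.le_add_right n 2) (Hist.Le.refl _) (Nat.le_succ n)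
          (Sum.inl (Sum.inl v))).trans ?_
        refine π.mono ω.1 le_rfl ?_ (Sum.inl v)
        rintro (u | k)
        · exact List.prefix_rfl
        · exact (hyx ω (n + 2) n).1 (Sum.inl k)
      · exact (Y.loop_mono wireA ω (Nat.le_add_right n 2) (Hist.Le.refl _) le_rfl
          (Sum.inr (Sum.inr o))).trans ((hyx ω (n + 2) n).1 (Sum.inr o))
  exact congrArg (fun s => (π.P.prod F.P).real s) hset

/-- Attaching the same system to equivalent systems. -/
lemma Close.obs_attachB_eq {F F' : System (IA ⊕ J) (OA ⊕ K)} (h : Close 0 F F')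
    (π : System (U ⊕ K) (V ⊕ J)) (hA : Hist IA) (hU : Hist U) (T : Test (OA ⊕ V)) :
    obs (attachB π F) (Sum.elim hA hU) T = obs (attachB π F') (Sum.elim hA hU) T := by
  rw [← prOne_absorbB, ← prOne_absorbB]
  exact sub_eq_zero.1 (abs_eq_zero.1 (le_antisymm (h _) (abs_nonneg _)))

lemma Close.obs_attachA_eq {F F' : System (J ⊕ IB) (K ⊕ OB)} (h : Close 0 F F')
    (π : System (U ⊕ K) (V ⊕ J)) (hU : Hist U) (hB : Hist IB) (T : Test (V ⊕ OB)) :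
    obs (attachA π F) (Sum.elim hU hB) T = obs (attachA π F') (Sum.elim hU hB) T := by
  rw [← prOne_absorbA, ← prOne_absorbA]
  exact sub_eq_zero.1 (abs_eq_zero.1 (le_antisymm (h _) (abs_nonneg _)))

/-! ### Two players who are connected by a channel -/

lemma prefix_of_eq {s t : Tape} (h : s = t) : s <+: t := h ▸ List.prefix_rfl

section Run

variable {IA OA IB OB UA VA UB VB : Type}

/-- A resource that, except for fixed messages, only forwards messages from A to B and from B to A:
`recA t` is what A receives when `t` has been sent by B on the channel `iB`. -/
structure Forwards (R : System (IA ⊕ IB) (OA ⊕ OB)) (ω : R.Ω) (iA : IA) (iB : IB)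
    (recA : Tape → Hist OA) (recB : Tape → Hist OB) : Prop where
  out : ∀ n h, R.out ω n h = Sum.elim (recA (h (Sum.inr iB))) (recB (h (Sum.inl iA)))
  monoA : ∀ {t t'}, t <+: t' → (recA t).Le (recA t')
  monoB : ∀ {t t'}, t <+: t' → (recB t).Le (recB t')

/-- What a player with external input `hU` sends on the channel `i`. -/
def strategy {U V I O : Type} (π : System (U ⊕ O) (V ⊕ I)) (ω : π.Ω) (hU : Hist U) (i : I)
    (rec : Tape → Hist O) (n : ℕ) (t : Tape) : Tape :=
  π.out ω n (Sum.elim hU (rec t)) (Sum.inr i)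

/-- What a player with external input `hU` outputs. -/
def output {U V I O : Type} (π : System (U ⊕ O) (V ⊕ I)) (ω : π.Ω) (hU : Hist U)
    (rec : Tape → Hist O) (n : ℕ) (t : Tape) : Hist V :=
  fun v => π.out ω n (Sum.elim hU (rec t)) (Sum.inl v)

lemma out_mono {U V I O : Type} (π : System (U ⊕ O) (V ⊕ I)) (ω : π.Ω) (hU : Hist U)
    {n n' : ℕ} {r r' : Hist O} (hn : n ≤ n') (h : r.Le r') :
    (π.out ω n (Sum.elim hU r)).Le (π.out ω n' (Sum.elim hU r')) :=
  π.mono ω hn (Hist.Le.elim (Hist.Le.refl hU) h)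

lemma causal_strategy {U V I O : Type} (π : System (U ⊕ O) (V ⊕ I)) (ω : π.Ω) (hU : Hist U) (i : I)
    {rec : Tape → Hist O} (hrec : ∀ {t t'}, t <+: t' → (rec t).Le (rec t')) :
    Causal (strategy π ω hU i rec) :=
  fun _ _ _ _ hn ht => out_mono π ω hU hn (hrec ht) (Sum.inr i)

lemma output_mono {U V I O : Type} (π : System (U ⊕ O) (V ⊕ I)) (ω : π.Ω) (hU : Hist U)
    {rec : Tape → Hist O} (hrec : ∀ {t t'}, t <+: t' → (rec t).Le (rec t')) {n n' : ℕ} {t t' : Tape}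
    (hn : n ≤ n') (ht : t <+: t') : (output π ω hU rec n t).Le (output π ω hU rec n' t') :=
  fun v => out_mono π ω hU hn (hrec ht) (Sum.inl v)

variable (πA : System (UA ⊕ OA) (VA ⊕ IA)) (πB : System (UB ⊕ OB) (VB ⊕ IB))
  (R : System (IA ⊕ IB) (OA ⊕ OB)) (ωA : πA.Ω) (ωB : πB.Ω) (ωR : R.Ω) {iA : IA} {iB : IB}
  {recA : Tape → Hist OA} {recB : Tape → Hist OB} (hA : Hist UA) (hB : Hist UB)

/-- The state of the conversation and the outputs of the players after `N` rounds. -/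
def outputs (πA : System (UA ⊕ OA) (VA ⊕ IA)) (πB : System (UB ⊕ OB) (VB ⊕ IB)) (ωA : πA.Ω)
    (ωB : πB.Ω) (iA : IA) (iB : IB) (recA : Tape → Hist OA) (recB : Tape → Hist OB) (hA : Hist UA)
    (hB : Hist UB) (N : ℕ) : Hist (VA ⊕ VB) :=
  Sum.elim (output πA ωA hA recA N
      (play (strategy πA ωA hA iA recA) (strategy πB ωB hB iB recB) N).2)
    (output πB ωB hB recB N
      (play (strategy πA ωA hA iA recA) (strategy πB ωB hB iB recB) N).1)

variable (hR : Forwards R ωR iA iB recA recB)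

include hR

/-- A message from A passes through the resource, the player B, and the resource again. From three
internal rounds on, the joined system therefore acts like B answering immediately. -/
lemma Forwards.joinB_out (n : ℕ) (h : Hist (IA ⊕ UB)) :
    (attachB πB R).out (ωB, ωR) (n + 3) h =
      Sum.elim (recA (strategy πB ωB (fun u => h (Sum.inr u)) iB recB (n + 3) (h (Sum.inl iA))))
        (output πB ωB (fun u => h (Sum.inr u)) recB (n + 3) (h (Sum.inl iA))) := by
  refine (attachB_out _ _ _ _ _).trans ?_
  let x : ℕ → Hist _ := fun k => (par πB R).loop wireB (ωB, ωR) (n + 3) h k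
  have hR1 : ∀ k, (fun o => x (k + 1) (Sum.inr o)) =
      Sum.elim (recA (x k (Sum.inl (Sum.inr iB)))) (recB (h (Sum.inl iA))) := fun k =>
    hR.out (n + 3) _
  have hB1 : ∀ k, (fun o => x (k + 2) (Sum.inl o)) =
      πB.out ωB (n + 3) (Sum.elim (fun u => h (Sum.inr u)) (recB (h (Sum.inl iA)))) := by
    intro k
    have h1 : (fun o => x (k + 2) (Sum.inl o)) = πB.out ωB (n + 3)
        (fun i => Sum.elim h (x (k + 1)) (wireB (Sum.inl i))) := rfl
    rw [h1]
    congr 1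
    funext i
    rcases i with u | o
    · rfl
    · exact congrFun (hR1 k) (Sum.inr o)
  funext o
  rcases o with o | v
  · have h1 := congrFun (hR1 (n + 2)) (Sum.inl o)
    have h2 := congrFun (hB1 n) (Sum.inr iB)
    refine h1.trans ?_
    simp only [Sum.elim_inl]
    exact congrArg (fun t => recA t o) h2
  · exact congrFun (hB1 (n + 1)) (Sum.inl v)

lemma Forwards.joinA_out (n : ℕ) (h : Hist (UA ⊕ IB)) :
    (attachA πA R).out (ωA, ωR) (n + 3) h =
      Sum.elim (output πA ωA (fun u => h (Sum.inl u)) recA (n + 3) (h (Sum.inr iB)))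
        (recB (strategy πA ωA (fun u => h (Sum.inl u)) iA recA (n + 3) (h (Sum.inr iB)))) := by
  refine (attachA_out _ _ _ _ _).trans ?_
  let x : ℕ → Hist _ := fun k => (par πA R).loop wireA (ωA, ωR) (n + 3) h k
  have hR1 : ∀ k, (fun o => x (k + 1) (Sum.inr o)) =
      Sum.elim (recA (h (Sum.inr iB))) (recB (x k (Sum.inl (Sum.inr iA)))) := fun k =>
    hR.out (n + 3) _
  have hA1 : ∀ k, (fun o => x (k + 2) (Sum.inl o)) =
      πA.out ωA (n + 3) (Sum.elim (fun u => h (Sum.inl u)) (recA (h (Sum.inr iB)))) := by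
    intro k
    have h1 : (fun o => x (k + 2) (Sum.inl o)) = πA.out ωA (n + 3)
        (fun i => Sum.elim h (x (k + 1)) (wireA (Sum.inl i))) := rfl
    rw [h1]
    congr 1
    funext i
    rcases i with u | o
    · rfl
    · exact congrFun (hR1 k) (Sum.inl o)
  funext o
  rcases o with v | o
  · exact congrFun (hA1 (n + 1)) (Sum.inl v)
  · have h1 := congrFun (hR1 (n + 2)) (Sum.inr o)
    have h2 := congrFun (hA1 n) (Sum.inr iA)
    refine h1.trans ?_
    simp only [Sum.elim_inr]
    exact congrArg (fun t => recB t o) h2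

/-- The conversation on the network, where B and the resource are joined first. -/
lemma Forwards.outAB (T : Test (VA ⊕ VB)) :
    (∃ n, T.holds ((attachA πA (attachB πB R)).out (ωA, ωB, ωR) n (Sum.elim hA hB))) ↔
      ∃ N, T.holds (outputs πA πB ωA ωB iA iB recA recB hA hB N) := by
  set fA := strategy πA ωA hA iA recA with hfA
  set fB := strategy πB ωB hB iB recB with hfB
  have cA : Causal fA := causal_strategy πA ωA hA iA hR.monoA
  have cB : Causal fB := causal_strategy πB ωB hB iB hR.monoB
  let G := attachB πB R
  let x : ℕ → ℕ → Hist _ := fun n k =>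
    (par πA G).loop wireA (ωA, ωB, ωR) n (Sum.elim hA hB) k
  have hA1 : ∀ n k, (fun o => x n (k + 1) (Sum.inl o)) =
      πA.out ωA n (Sum.elim hA fun o => x n k (Sum.inr (Sum.inl o))) := by
    intro n k
    have h1 : (fun o => x n (k + 1) (Sum.inl o)) = πA.out ωA n
        (fun i => Sum.elim (Sum.elim hA hB) (x n k) (wireA (Sum.inl i))) := rfl
    rw [h1]
    congr 1
    funext i
    rcases i with i | i <;> rfl
  have hG1 : ∀ n k, (fun o => x (n + 3) (k + 1) (Sum.inr o)) =
      Sum.elim (recA (fB (n + 3) (x (n + 3) k (Sum.inl (Sum.inr iA)))))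
        (output πB ωB hB recB (n + 3) (x (n + 3) k (Sum.inl (Sum.inr iA)))) := by
    intro n k
    have h1 : (fun o => x (n + 3) (k + 1) (Sum.inr o)) = G.out (ωB, ωR) (n + 3)
        (fun i => Sum.elim (Sum.elim hA hB) (x (n + 3) k) (wireA (Sum.inr i))) := rfl
    rw [h1]
    exact hR.joinB_out πB R ωB ωR n _
  have hxA : ∀ n k o, x n (k + 1) (Sum.inl o) =
      πA.out ωA n (Sum.elim hA fun o => x n k (Sum.inr (Sum.inl o))) o := fun n k =>
    congrFun (hA1 n k)
  have hxG : ∀ n k o, x (n + 3) (k + 1) (Sum.inr (Sum.inl o)) =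
      recA (fB (n + 3) (x (n + 3) k (Sum.inl (Sum.inr iA)))) o := fun n k o =>
    congrFun (hG1 n k) (Sum.inl o)
  have hxV : ∀ n k v, x (n + 3) (k + 1) (Sum.inr (Sum.inr v)) =
      output πB ωB hB recB (n + 3) (x (n + 3) k (Sum.inl (Sum.inr iA))) v := fun n k v =>
    congrFun (hG1 n k) (Sum.inr v)
  have hxm : ∀ {n n' k k'}, n ≤ n' → k ≤ k' → (x n k).Le (x n' k') := fun hn hk =>
    (par πA G).loop_mono wireA (ωA, ωB, ωR) hn (Hist.Le.refl _) hk
  -- `play` uses the step count `N` in round `N + 1`, so an offset of `n + 3` makes its players at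
  -- least as advanced as those of the network.
  have up : ∀ n k, (Hist.Le (fun o => x (n + 3) k (Sum.inr (Sum.inl o)))
      (recA (play fA fB (n + 3 + k)).2)) ∧
      x (n + 3) k (Sum.inl (Sum.inr iA)) <+: (play fA fB (n + 3 + k)).1 := by
    intro n k
    induction k with
    | zero => exact ⟨fun _ => List.nil_prefix, List.nil_prefix⟩
    | succ k ih =>
      exact ⟨fun o =>
          (prefix_of_eq (hxG n k o)).trans (hR.monoA (cB (Nat.le_add_right _ _) ih.2) o),
        (prefix_of_eq (hxA (n + 3) k _)).trans (out_mono πA ωA hA (Nat.le_add_right _ _) ih.1 _)⟩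
  -- Player and joined system need one network round each for one round of `play`, and one more
  -- round delivers the fixed messages of the resource.
  have low : ∀ n k, k ≤ n + 3 → (recA (play fA fB k).2).Le
        (fun o => x (n + 3) (2 * k + 1) (Sum.inr (Sum.inl o))) ∧
      (play fA fB k).1 <+: x (n + 3) (2 * k + 1) (Sum.inl (Sum.inr iA)) := by
    intro n k hk
    induction k with
    | zero =>
      exact ⟨fun o => (hR.monoA List.nil_prefix o).trans (prefix_of_eq (hxG n 0 o).symm),
        List.nil_prefix⟩
    | succ k ih =>
      obtain ⟨ih1, ih2⟩ := ih (by omega)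
      have hle : (x (n + 3) (2 * k + 1 + 1)).Le (x (n + 3) (2 * (k + 1) + 1)) :=
        hxm le_rfl (by omega)
      exact ⟨fun o => ((hR.monoA (cB (by omega) ih2) o).trans
          (prefix_of_eq (hxG n (2 * k + 1) o).symm)).trans (hle _),
        ((out_mono πA ωA hA (by omega) ih1 _).trans
          (prefix_of_eq (hxA (n + 3) (2 * k + 1) _).symm)).trans (hle _)⟩
  have hout : ∀ n, (attachA πA G).out (ωA, ωB, ωR) n (Sum.elim hA hB) =
      fun o => x n n (exposeA o) := fun n => attachA_out _ _ _ _ _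
  constructor
  · rintro ⟨n, hn⟩
    replace hn : T.holds (fun o => x n n (exposeA o)) := hout n ▸ hn
    have hle : (x n n).Le (x (n + 3) (n + 3 + 1)) := hxm (by omega) (by omega)
    refine ⟨n + 3 + (n + 3), T.mono ?_ hn⟩
    rintro (v | v)
    · exact ((hle _).trans (prefix_of_eq (hxA (n + 3) (n + 3) (Sum.inl v)))).trans
        (out_mono πA ωA hA (by omega) (up n (n + 3)).1 _)
    · exact ((hle _).trans (prefix_of_eq (hxV n (n + 3) v))).trans
        (output_mono πB ωB hB hR.monoB (by omega) (up n (n + 3)).2 v)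
  · rintro ⟨N, hN⟩
    have hle : (x (2 * N + 1 + 3) (2 * N + 1 + 1)).Le (x (2 * N + 1 + 3) (2 * N + 1 + 3)) :=
      hxm le_rfl (by omega)
    refine ⟨2 * N + 1 + 3, (hout _).symm ▸ T.mono ?_ hN⟩
    rintro (v | v)
    · exact ((out_mono πA ωA hA (by omega) (low (2 * N + 1) N (by omega)).1 _).trans
        (prefix_of_eq (hxA (2 * N + 1 + 3) (2 * N + 1) (Sum.inl v)).symm)).trans (hle _)
    · exact ((output_mono πB ωB hB hR.monoB (by omega) (low (2 * N + 1) N (by omega)).2 v).trans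
        (prefix_of_eq (hxV (2 * N + 1) (2 * N + 1) v).symm)).trans (hle _)

/-- The conversation on the network, where A and the resource are joined first. -/
lemma Forwards.outBA (T : Test (VA ⊕ VB)) :
    (∃ n, T.holds ((attachB πB (attachA πA R)).out (ωB, ωA, ωR) n (Sum.elim hA hB))) ↔
      ∃ N, T.holds (outputs πA πB ωA ωB iA iB recA recB hA hB N) := by
  set fA := strategy πA ωA hA iA recA with hfA
  set fB := strategy πB ωB hB iB recB with hfB
  have cA : Causal fA := causal_strategy πA ωA hA iA hR.monoA
  have cB : Causal fB := causal_strategy πB ωB hB iB hR.monoB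
  let G := attachA πA R
  let x : ℕ → ℕ → Hist _ := fun n k =>
    (par πB G).loop wireB (ωB, ωA, ωR) n (Sum.elim hA hB) k
  have hB1 : ∀ n k, (fun o => x n (k + 1) (Sum.inl o)) =
      πB.out ωB n (Sum.elim hB fun o => x n k (Sum.inr (Sum.inr o))) := by
    intro n k
    have h1 : (fun o => x n (k + 1) (Sum.inl o)) = πB.out ωB n
        (fun i => Sum.elim (Sum.elim hA hB) (x n k) (wireB (Sum.inl i))) := rfl
    rw [h1]
    congr 1
    funext i
    rcases i with i | i <;> rfl
  have hG1 : ∀ n k, (fun o => x (n + 3) (k + 1) (Sum.inr o)) =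
      Sum.elim (output πA ωA hA recA (n + 3) (x (n + 3) k (Sum.inl (Sum.inr iB))))
        (recB (fA (n + 3) (x (n + 3) k (Sum.inl (Sum.inr iB))))) := by
    intro n k
    have h1 : (fun o => x (n + 3) (k + 1) (Sum.inr o)) = G.out (ωA, ωR) (n + 3)
        (fun i => Sum.elim (Sum.elim hA hB) (x (n + 3) k) (wireB (Sum.inr i))) := rfl
    rw [h1]
    exact hR.joinA_out πA R ωA ωR n _
  have hxB : ∀ n k o, x n (k + 1) (Sum.inl o) =
      πB.out ωB n (Sum.elim hB fun o => x n k (Sum.inr (Sum.inr o))) o := fun n k =>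
    congrFun (hB1 n k)
  have hxG : ∀ n k o, x (n + 3) (k + 1) (Sum.inr (Sum.inr o)) =
      recB (fA (n + 3) (x (n + 3) k (Sum.inl (Sum.inr iB)))) o := fun n k o =>
    congrFun (hG1 n k) (Sum.inr o)
  have hxV : ∀ n k v, x (n + 3) (k + 1) (Sum.inr (Sum.inl v)) =
      output πA ωA hA recA (n + 3) (x (n + 3) k (Sum.inl (Sum.inr iB))) v := fun n k v =>
    congrFun (hG1 n k) (Sum.inl v)
  have hxm : ∀ {n n' k k'}, n ≤ n' → k ≤ k' → (x n k).Le (x n' k') := fun hn hk =>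
    (par πB G).loop_mono wireB (ωB, ωA, ωR) hn (Hist.Le.refl _) hk
  have up : ∀ n k, (Hist.Le (fun o => x (n + 3) k (Sum.inr (Sum.inr o)))
      (recB (play fA fB (n + 3 + k)).1)) ∧
      x (n + 3) k (Sum.inl (Sum.inr iB)) <+: (play fA fB (n + 3 + k)).2 := by
    intro n k
    induction k with
    | zero => exact ⟨fun _ => List.nil_prefix, List.nil_prefix⟩
    | succ k ih =>
      exact ⟨fun o =>
          (prefix_of_eq (hxG n k o)).trans (hR.monoB (cA (Nat.le_add_right _ _) ih.2) o),
        (prefix_of_eq (hxB (n + 3) k _)).trans (out_mono πB ωB hB (Nat.le_add_right _ _) ih.1 _)⟩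
  have low : ∀ n k, k ≤ n + 3 → (recB (play fA fB k).1).Le
        (fun o => x (n + 3) (2 * k + 1) (Sum.inr (Sum.inr o))) ∧
      (play fA fB k).2 <+: x (n + 3) (2 * k + 1) (Sum.inl (Sum.inr iB)) := by
    intro n k hk
    induction k with
    | zero =>
      exact ⟨fun o => (hR.monoB List.nil_prefix o).trans (prefix_of_eq (hxG n 0 o).symm),
        List.nil_prefix⟩
    | succ k ih =>
      obtain ⟨ih1, ih2⟩ := ih (by omega)
      have hle : (x (n + 3) (2 * k + 1 + 1)).Le (x (n + 3) (2 * (k + 1) + 1)) :=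
        hxm le_rfl (by omega)
      exact ⟨fun o => ((hR.monoB (cA (by omega) ih2) o).trans
          (prefix_of_eq (hxG n (2 * k + 1) o).symm)).trans (hle _),
        ((out_mono πB ωB hB (by omega) ih1 _).trans
          (prefix_of_eq (hxB (n + 3) (2 * k + 1) _).symm)).trans (hle _)⟩
  have hout : ∀ n, (attachB πB G).out (ωB, ωA, ωR) n (Sum.elim hA hB) =
      fun o => x n n (exposeB o) := fun n => attachB_out _ _ _ _ _
  constructor
  · rintro ⟨n, hn⟩
    replace hn : T.holds (fun o => x n n (exposeB o)) := hout n ▸ hn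
    have hle : (x n n).Le (x (n + 3) (n + 3 + 1)) := hxm (by omega) (by omega)
    refine ⟨n + 3 + (n + 3), T.mono ?_ hn⟩
    rintro (v | v)
    · exact ((hle _).trans (prefix_of_eq (hxV n (n + 3) v))).trans
        (output_mono πA ωA hA hR.monoA (by omega) (up n (n + 3)).2 v)
    · exact ((hle _).trans (prefix_of_eq (hxB (n + 3) (n + 3) (Sum.inl v)))).trans
        (out_mono πB ωB hB (by omega) (up n (n + 3)).1 _)
  · rintro ⟨N, hN⟩
    have hle : (x (2 * N + 1 + 3) (2 * N + 1 + 1)).Le (x (2 * N + 1 + 3) (2 * N + 1 + 3)) :=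
      hxm le_rfl (by omega)
    refine ⟨2 * N + 1 + 3, (hout _).symm ▸ T.mono ?_ hN⟩
    rintro (v | v)
    · exact ((output_mono πA ωA hA hR.monoA (by omega) (low (2 * N + 1) N (by omega)).2 v).trans
        (prefix_of_eq (hxV (2 * N + 1) (2 * N + 1) v).symm)).trans (hle _)
    · exact ((out_mono πB ωB hB (by omega) (low (2 * N + 1) N (by omega)).1 _).trans
        (prefix_of_eq (hxB (2 * N + 1 + 3) (2 * N + 1) (Sum.inl v)).symm)).trans (hle _)

end Run

/-! ### Weak oblivious transfer that can be implemented by communication -/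

/-- `some true`: A knows the outputs of B; `some false`: B knows the outputs of A; `none`: the
outputs of A and B are independent. -/
abbrev Leader : Type := Option Bool

abbrev Seed : Type := Leader × Bool × Bool × Bool × Bool

/-- The part of the outcome that both players know. -/
def announce : Seed → Msg
  | (some t, b₁, b₂, _, _) => [true, t, b₁, b₂]
  | (none, _, _, _, _) => [false]

/-- The outputs of weak oblivious transfer with the given seed. -/
def wotOutcome : Seed → WOTOutcome
  | (some true, c, y, r, s) =>
    ⟨bif c then (r, y) else (y, r), c, y, announce (some true, c, y, r, s),
      announce (some true, c, y, r, s)⟩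
  | (some false, x₀, x₁, c, s) =>
    ⟨(x₀, x₁), c, pick (x₀, x₁) c, announce (some false, x₀, x₁, c, s),
      announce (some false, x₀, x₁, c, s)⟩
  | (none, x₀, x₁, c, y) =>
    ⟨(x₀, x₁), c, y, announce (none, x₀, x₁, c, y), announce (none, x₀, x₁, c, y)⟩

/-- The probabilities of the three cases. -/
structure Weights where
  w : Leader → ℝ
  nonneg : ∀ t, 0 ≤ w t
  sum_eq : w (some true) + w (some false) + w none = 1

/-! ### How well the hidden bits of the three-case mixture can be predicted. -/

namespace Weights

variable (W : Weights)

lemma sum_seed : ∑ s : Seed, ENNReal.ofReal (W.w s.1 / 16) = 1 := by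
  rw [← ENNReal.ofReal_sum_of_nonneg fun s _ => div_nonneg (W.nonneg _) (by norm_num)]
  have h := W.sum_eq
  rw [← ENNReal.ofReal_one]
  congr 1
  simp [Fintype.sum_prod_type, Fintype.sum_option]
  linarith

/-- The distribution of the seed. -/
def seedDist : PMF Seed := PMF.ofFintype (fun s => ENNReal.ofReal (W.w s.1 / 16)) W.sum_seed

/-- The distribution of the outcome. -/
def dist : PMF WOTOutcome := W.seedDist.map wotOutcome

lemma pr_map {β : Type} (g : WOTOutcome → β) (A : Set β) [DecidablePred (· ∈ A)] :
    pr (W.dist.map g) A = ∑ s : Seed, W.w s.1 / 16 * if g (wotOutcome s) ∈ A then 1 else 0 := by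
  rw [pr, dist, PMF.map_comp, PMF.toOuterMeasure_map_apply, seedDist,
    PMF.toOuterMeasure_ofFintype_apply, tsum_fintype, ENNReal.toReal_sum]
  · refine Finset.sum_congr rfl fun s _ => ?_
    have h0 : 0 ≤ W.w s.1 / 16 := div_nonneg (W.nonneg _) (by norm_num)
    by_cases h : g (wotOutcome s) ∈ A
    · have h' : s ∈ g ∘ wotOutcome ⁻¹' A := h
      rw [Set.indicator_of_mem h', ENNReal.toReal_ofReal h0, if_pos h, mul_one]
    · have h' : s ∉ g ∘ wotOutcome ⁻¹' A := h
      rw [Set.indicator_of_notMem h', if_neg h, mul_zero]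
      rfl
  · intro s _
    unfold Set.indicator
    split_ifs
    · exact ENNReal.ofReal_ne_top
    · exact ENNReal.zero_ne_top

lemma sum_le {F : Seed → ℝ} {α β γ : ℝ} (h1 : ∑ z, F (some true, z) ≤ 16 * α)
    (h2 : ∑ z, F (some false, z) ≤ 16 * β) (h3 : ∑ z, F (none, z) ≤ 16 * γ) :
    ∑ s : Seed, W.w s.1 / 16 * F s ≤
      W.w (some true) * α + W.w (some false) * β + W.w none * γ := by
  have e1 : ∑ s : Seed, W.w s.1 / 16 * F s = W.w none / 16 * ∑ z, F (none, z) +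
      (W.w (some true) / 16 * ∑ z, F (some true, z) +
        W.w (some false) / 16 * ∑ z, F (some false, z)) := by
    rw [Fintype.sum_prod_type, Fintype.sum_option, Fintype.sum_bool]
    simp only [Finset.mul_sum]
  rw [e1]
  have := mul_le_mul_of_nonneg_left h1 (W.nonneg (some true))
  have := mul_le_mul_of_nonneg_left h2 (W.nonneg (some false))
  have := mul_le_mul_of_nonneg_left h3 (W.nonneg none)
  linarith

/-- Weighted guesses of a bit that are unbiased add up to nothing if the bit is hidden. -/
structure Guess (K : Type) (m : ℝ) where
  φ : K → Bool → ℝ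
  add : ∀ k, φ k true + φ k false = m
  le : ∀ k x, φ k x ≤ 1

lemma sum_bits (F : Bool × Bool × Bool × Bool → ℝ) : ∑ z, F z =
    F (true, true, true, true) + F (true, true, true, false) +
    F (true, true, false, true) + F (true, true, false, false) +
    F (true, false, true, true) + F (true, false, true, false) +
    F (true, false, false, true) + F (true, false, false, false) +
    F (false, true, true, true) + F (false, true, true, false) +
    F (false, true, false, true) + F (false, true, false, false) +
    F (false, false, true, true) + F (false, false, true, false) +
    F (false, false, false, true) + F (false, false, false, false) := by
  simp only [Fintype.sum_prod_type, Fintype.sum_bool]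
  ring

lemma sum_le_of_le_one {F : Bool × Bool × Bool × Bool → ℝ} (h : ∀ z, F z ≤ 1) :
    ∑ z, F z ≤ 16 * 1 := by
  refine (Finset.sum_le_sum fun z _ => h z).trans ?_
  simp

/-- In the case `some false` B knows everything, so only the trivial bound 1 is used. In the other
cases the seeds that differ in the bit hidden from B contribute in pairs with sum `m`, even if `E`
is known. With `m = 1` this bounds a success probability, with `m = 0` an advantage. -/
lemma guess_other {m : ℝ} (G : Guess ((Bool × Bool × Msg) × Bool) m) :
    ∑ s : Seed, W.w s.1 / 16 * G.φ
      (((wotOutcome s).c, (wotOutcome s).y, (wotOutcome s).v), (wotOutcome s).E)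
      (pick (wotOutcome s).x (!(wotOutcome s).c)) ≤
    W.w (some true) * (m / 2) + W.w (some false) * 1 + W.w none * (m / 2) := by
  refine W.sum_le ?_ ?_ ?_
  · rw [sum_bits]
    simp only [wotOutcome, WOTOutcome.E, pick, announce, cond_true, cond_false, Bool.not_true,
      Bool.not_false, bne_self_eq_false]
    have h := fun c y => G.add ((c, y, [true, true, c, y]), false)
    linarith [h true true, h true false, h false true, h false false]
  · exact sum_le_of_le_one fun z => G.le _ _
  · rw [sum_bits]
    simp only [wotOutcome, WOTOutcome.E, pick, announce, cond_true, cond_false, Bool.not_true,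
      Bool.not_false, Bool.xor_self, Bool.xor_true, Bool.xor_false]
    have h := fun c y E => G.add ((c, y, [false]), E)
    linarith [h true true true, h true false true, h false true true, h false false true,
      h true true false, h true false false, h false true false, h false false false]

lemma guess_xor {m : ℝ} (G : Guess (Bool × Bool × Msg) m) :
    ∑ s : Seed, W.w s.1 / 16 * G.φ
      ((wotOutcome s).c, (wotOutcome s).y, (wotOutcome s).v)
      (xor (wotOutcome s).x.1 (wotOutcome s).x.2) ≤
    W.w (some true) * (m / 2) + W.w (some false) * 1 + W.w none * (m / 2) := by
  refine W.sum_le ?_ ?_ ?_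
  · rw [sum_bits]
    simp only [wotOutcome, announce, cond_true, cond_false, Bool.not_false, Bool.xor_self,
      Bool.xor_true, Bool.xor_false]
    have h := fun c y => G.add (c, y, [true, true, c, y])
    linarith [h true true, h true false, h false true, h false false]
  · exact sum_le_of_le_one fun z => G.le _ _
  · rw [sum_bits]
    simp only [wotOutcome, announce, Bool.not_false, Bool.xor_self, Bool.xor_true,
      Bool.xor_false]
    have h := fun c y => G.add (c, y, [false])
    linarith [h true true, h true false, h false true, h false false]

/-- In the independent case `E` tells nothing about `c`, because `y` masks `x_c`. In the case `some
false` A is told only its own bits and `E = 0`, so `c` is still uniform for A. -/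
lemma guess_choice {m : ℝ} (G : Guess (((Bool × Bool) × Msg) × Bool) m) :
    ∑ s : Seed, W.w s.1 / 16 * G.φ
      (((wotOutcome s).x, (wotOutcome s).u), (wotOutcome s).E) (wotOutcome s).c ≤
    W.w (some true) * 1 + W.w (some false) * (m / 2) + W.w none * (m / 2) := by
  refine W.sum_le ?_ ?_ ?_
  · exact sum_le_of_le_one fun z => G.le _ _
  · rw [sum_bits]
    simp only [wotOutcome, WOTOutcome.E, pick, announce, cond_true, cond_false, Bool.xor_self]
    have h := fun x y => G.add (((x, y), [true, false, x, y]), false)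
    linarith [h true true, h true false, h false true, h false false]
  · rw [sum_bits]
    simp only [wotOutcome, WOTOutcome.E, pick, announce, cond_true, cond_false,
      Bool.not_false, Bool.xor_self, Bool.xor_true, Bool.xor_false]
    have h := fun x y E => G.add (((x, y), [false]), E)
    linarith [h true true true, h true false true, h false true true, h false false true,
      h true true false, h true false false, h false true false, h false false false]

lemma predAdv_le {K : Type} (X : WOTOutcome → Bool) (Y : WOTOutcome → K) {r : ℝ}
    (h : ∀ G : Guess K 1, ∑ s : Seed, W.w s.1 / 16 * G.φ (Y (wotOutcome s)) (X (wotOutcome s)) ≤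
      (1 + r) / 2) :
    predAdv (W.dist.map fun o => (X o, Y o)) ≤ r := by
  have hs : (⨆ f : K → Bool, pr (W.dist.map fun o => (X o, Y o)) {z | f z.2 = z.1}) ≤
      (1 + r) / 2 := by
    refine ciSup_le fun f => ?_
    rw [pr_map]
    -- A deterministic predictor is a weighted guess with `m = 1`, since it is right for exactly one
    -- value of the bit.
    refine h ⟨fun k x => if f k = x then 1 else 0, fun k => ?_, fun k x => ?_⟩
    · cases f k <;> simp
    · split_ifs <;> norm_num
  unfold predAdv
  linarith

lemma isPassiveWOT {p q ε : ℝ} (hp : W.w (some true) ≤ p) (hq : W.w (some false) ≤ q)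
    (hε : W.w none / 2 ≤ ε) : IsPassiveWOT p q ε W.dist := by
  have hsum := W.sum_eq
  refine ⟨?_, ?_, ?_⟩
  · have h1 := W.pr_map id {w | w.E = true}
    rw [PMF.map_id] at h1
    rw [h1]
    refine (W.sum_le (α := 0) (β := 0) (γ := 1 / 2) ?_ ?_ ?_).trans (by linarith)
    · rw [sum_bits]; simp [wotOutcome, WOTOutcome.E, pick]
    · rw [sum_bits]; simp [wotOutcome, WOTOutcome.E, pick]
    · rw [sum_bits]; simp [wotOutcome, WOTOutcome.E, pick]; norm_num
  · refine W.predAdv_le (fun w => pick w.x (!w.c)) (fun w => ((w.c, w.y, w.v), w.E)) fun G => ?_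
    exact (W.guess_other G).trans (by linarith)
  · refine W.predAdv_le (fun w => w.c) (fun w => ((w.x, w.u), w.E)) fun G => ?_
    exact (W.guess_choice G).trans (by linarith)

end Weights

/-! ### The real networks -/

instance : MeasurableSpace WOTOutcome := ⊤

instance : DiscreteMeasurableSpace WOTOutcome := ⟨fun _ => trivial⟩

lemma measurableSet_eval {O : Type} (o : O) (s : Set Tape) :
    MeasurableSet {h : Hist O | h o ∈ s} :=
  measurable_pi_apply o (MeasurableSet.of_discrete (s := s))

/-- The test whether the messages `w` have been received on the channels `ix`, and at least `a` and
`b` on the channels `ia` and `ib`. -/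
def viewTest {O : Type} {n : ℕ} (ix : Fin n → O) (ia ib : O) (w : Fin n → Msg) (a b : Tape) :
    Test O where
  holds h := (∀ k, [w k] <+: h (ix k)) ∧ a <+: h ia ∧ b <+: h ib
  mono hh h := ⟨fun k => (h.1 k).trans (hh _), h.2.1.trans (hh _), h.2.2.trans (hh _)⟩
  meas := by
    have key : ∀ (o : O) (t : Tape), MeasurableSet {h : Hist O | t <+: h o} := fun o t =>
      measurableSet_eval o {s | t <+: s}
    have h1 : MeasurableSet {h : Hist O | ∀ k, [w k] <+: h (ix k)} := by
      rw [Set.ofPred_forall]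
      exact .iInter fun k => key _ _
    exact h1.inter ((key _ _).inter (key _ _))

/-- The test whether the first message on a channel is `m`. -/
def headTest {O : Type} (o : O) (m : Msg) : Test O where
  holds h := (h o).head? = some m
  mono hh h := head?_of_prefix (hh o) h
  meas := measurableSet_eval o {s : Tape | s.head? = some m}

/-- The curious player, whose input channels are renamed. -/
lemma spy_out {U V I O X E : Type} (π : System (U ⊕ O) (V ⊕ I)) (f : U ⊕ (O ⊕ X) → E) (ω : π.Ω)
    (n : ℕ) (h : Hist E) (hU : Hist U) (r : Hist O) (x : Hist X)
    (h1 : ∀ u, h (f (Sum.inl u)) = hU u) (h2 : ∀ o, h (f (Sum.inr (Sum.inl o))) = r o)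
    (h3 : ∀ o, h (f (Sum.inr (Sum.inr o))) = x o) :
    (relabel f id (curious X π)).out ω n h =
      Sum.elim (Sum.elim (fun v => π.out ω n (Sum.elim hU r) (Sum.inl v))
          (Sum.elim x (Sum.elim (Sum.elim hU r) (π.out ω n (Sum.elim hU r)))))
        (fun i => π.out ω n (Sum.elim hU r) (Sum.inr i)) := by
  have hr : (Sum.elim (fun u => h (f (Sum.inl u))) fun o => h (f (Sum.inr (Sum.inl o))) :
      Hist (U ⊕ O)) = Sum.elim hU r := by
    funext i
    rcases i with u | o
    · exact h1 u
    · exact h2 o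
  rw [← hr]
  funext o
  rcases o with (v | y | y | y) | i
  · rfl
  · exact h3 y
  · rfl
  · rfl
  · rfl

section World

variable {n : ℕ} (P : WOTProtocol n)

/-- The input of A. -/
def inA (x : Bool × Bool) : Hist Unit := fun _ => [[x.1, x.2]]

/-- The input of B. -/
def inB (c : Bool) : Hist Unit := fun _ => [[c]]

/-- What A receives if B sends `t`. -/
def recA (o : Fin n → WOTOutcome) (t : Tape) : Hist (Fin n × Unit ⊕ Unit) :=
  Sum.elim (fun k => [[(o k.1).x.1, (o k.1).x.2]]) fun _ => t

/-- What B receives if A sends `t`. -/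
def recB (o : Fin n → WOTOutcome) (t : Tape) : Hist (Fin n × Unit ⊕ Unit) :=
  Sum.elim (fun k => [[(o k.1).c, (o k.1).y]]) fun _ => t

/-- The randomness of both players and the outputs of weak oblivious transfer. -/
abbrev World : Type := P.A.Ω × P.B.Ω × (Fin n → WOTOutcome) × Unit

/-- The strategy of A. -/
def stratA (x : Bool × Bool) (ω : World P) : ℕ → Tape → Tape :=
  strategy P.A ω.1 (inA x) (Sum.inr ()) (recA ω.2.2.1)

/-- The strategy of B. -/
def stratB (c : Bool) (ω : World P) : ℕ → Tape → Tape :=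
  strategy P.B ω.2.1 (inB c) (Sum.inr ()) (recB ω.2.2.1)

/-- The output of B. -/
def outB (c : Bool) (ω : World P) (N : ℕ) (t : Tape) : Tape :=
  output P.B ω.2.1 (inB c) (recB ω.2.2.1) N t ()

lemma recA_mono (o : Fin n → WOTOutcome) {t t' : Tape} (h : t <+: t') :
    (recA o t).Le (recA o t') :=
  Hist.Le.elim (Hist.Le.refl _) fun _ => h

lemma recB_mono (o : Fin n → WOTOutcome) {t t' : Tape} (h : t <+: t') :
    (recB o t).Le (recB o t') :=
  Hist.Le.elim (Hist.Le.refl _) fun _ => h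

lemma causal_stratA (x : Bool × Bool) (ω : World P) : Causal (stratA P x ω) :=
  causal_strategy P.A ω.1 _ _ (recA_mono _)

lemma causal_stratB (c : Bool) (ω : World P) : Causal (stratB P c ω) :=
  causal_strategy P.B ω.2.1 _ _ (recB_mono _)

/-- The messages `a` and `b` are finally sent. -/
def Reach (x : Bool × Bool) (c : Bool) (a b : Tape) (ω : World P) : Prop :=
  ∃ N, a <+: (play (stratA P x ω) (stratB P c ω) N).1 ∧
    b <+: (play (stratA P x ω) (stratB P c ω) N).2

variable (W : Weights)

/-- The joint distribution of the randomness. -/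
def worldMeasure : Measure (World P) :=
  P.A.P.prod (P.B.P.prod ((Measure.pi fun _ : Fin n => W.dist.toMeasure).prod (Measure.dirac ())))

instance : IsProbabilityMeasure (worldMeasure P W) := by
  unfold worldMeasure
  infer_instance

lemma forwards_sys (o : Fin n → WOTOutcome) :
    Forwards (withComm n (wotColl W.dist).sys) (o, ()) (Sum.inr ()) (Sum.inr ())
      (recA o) (recB o) where
  out m h := by
    funext c
    rcases c with (⟨k, u⟩ | u) | (⟨k, u⟩ | u) <;> rfl
  monoA := recA_mono o
  monoB := recB_mono o

lemma obs_honest (x : Bool × Bool) (c : Bool) (m : Msg) :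
    obs (attachA P.A (attachB P.B (withComm n (wotColl W.dist).sys)))
        (Sum.elim (inA x) (inB c)) (headTest (Sum.inr ()) m) =
      (worldMeasure P W).real {ω | ∃ N,
        (outB P c ω N (play (stratA P x ω) (stratB P c ω) N).1).head? = some m} := by
  refine congrArg (fun s => (worldMeasure P W).real s) ?_
  ext ⟨ωA, ωB, o, u⟩
  exact Forwards.outAB P.A P.B (withComm n (wotColl W.dist).sys) ωA ωB (o, ()) (inA x) (inB c)
    (forwards_sys W o) _

/-! ### Views of players who follow the protocol and report everything they see. -/

section Spy

variable {E : Type}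

/-- The test of the view of a curious B. -/
def viewTestB (w : Fin n → Msg) (a b : Tape) : Test (Unit ⊕ (Unit ⊕ View Unit Unit
    (Fin n × Empty ⊕ Unit) (Fin n × Unit ⊕ Unit) (Fin n × Unit))) :=
  viewTest (fun k => Sum.inr (Sum.inr (Sum.inl (k, ()))))
    (Sum.inr (Sum.inr (Sum.inr (Sum.inl (Sum.inr (Sum.inr ()))))))
    (Sum.inr (Sum.inr (Sum.inr (Sum.inr (Sum.inr (Sum.inr ())))))) w a b

/-- The test of the view of a curious A. -/
def viewTestA (w : Fin n → Msg) (a b : Tape) : Test ((Unit ⊕ View Unit Unit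
    (Fin n × Empty ⊕ Unit) (Fin n × Unit ⊕ Unit) (Fin n × Unit)) ⊕ Unit) :=
  viewTest (fun k => Sum.inl (Sum.inr (Sum.inl (k, ()))))
    (Sum.inl (Sum.inr (Sum.inr (Sum.inr (Sum.inr (Sum.inr ()))))))
    (Sum.inl (Sum.inr (Sum.inr (Sum.inl (Sum.inr (Sum.inr ())))))) w a b

/-- On its input channels, renamed by `f`, a curious player receives `r` from the resource as an
honest player, and `x` on the auxiliary channels. -/
structure Spy (f : Unit ⊕ ((Fin n × Unit ⊕ Unit) ⊕ Fin n × Unit) → Unit ⊕ E)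
    (r : Tape → Hist (Fin n × Unit ⊕ Unit)) (x : Fin n → Msg) (rec : Tape → Hist E) : Prop where
  input : ∀ (hU : Hist Unit) t u, (Sum.elim hU (rec t) : Hist (Unit ⊕ E)) (f (Sum.inl u)) = hU u
  regular : ∀ (hU : Hist Unit) t c,
    (Sum.elim hU (rec t) : Hist (Unit ⊕ E)) (f (Sum.inr (Sum.inl c))) = r t c
  extra : ∀ (hU : Hist Unit) t k,
    (Sum.elim hU (rec t) : Hist (Unit ⊕ E)) (f (Sum.inr (Sum.inr k))) = [x k.1]

variable {f : Unit ⊕ ((Fin n × Unit ⊕ Unit) ⊕ Fin n × Unit) → Unit ⊕ E}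
  {r : Tape → Hist (Fin n × Unit ⊕ Unit)} {x : Fin n → Msg} {rec : Tape → Hist E}

lemma Spy.out (h : Spy f r x rec) {V I : Type} (π : System (Unit ⊕ (Fin n × Unit ⊕ Unit)) (V ⊕ I))
    (ω : π.Ω) (m : ℕ) (hU : Hist Unit) (t : Tape) :
    (relabel f id (curious (Fin n × Unit) π)).out ω m (Sum.elim hU (rec t)) =
      Sum.elim (Sum.elim (fun v => π.out ω m (Sum.elim hU (r t)) (Sum.inl v))
          (Sum.elim (fun k => [x k.1])
            (Sum.elim (Sum.elim hU (r t)) (π.out ω m (Sum.elim hU (r t))))))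
        (fun i => π.out ω m (Sum.elim hU (r t)) (Sum.inr i)) :=
  spy_out π f ω m _ hU (r t) _ (h.input hU t) (h.regular hU t) (h.extra hU t)

lemma Spy.strategy_eq (h : Spy f r x rec) {V I : Type}
    (π : System (Unit ⊕ (Fin n × Unit ⊕ Unit)) (V ⊕ I)) (ω : π.Ω) (hU : Hist Unit) (i : I) :
    strategy (relabel f id (curious (Fin n × Unit) π)) ω hU i rec = strategy π ω hU i r := by
  funext m t
  exact congrFun (h.out π ω m hU t) (Sum.inr i)

lemma Spy.output_eq (h : Spy f r x rec) {V I : Type}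
    (π : System (Unit ⊕ (Fin n × Unit ⊕ Unit)) (V ⊕ I)) (ω : π.Ω) (hU : Hist Unit) (m : ℕ)
    (t : Tape) :
    output (relabel f id (curious (Fin n × Unit) π)) ω hU rec m t =
      Sum.elim (output π ω hU r m t) (Sum.elim (fun k => [x k.1])
            (Sum.elim (Sum.elim hU (r t)) (π.out ω m (Sum.elim hU (r t))))) := by
  funext v
  exact congrFun (h.out π ω m hU t) (Sum.inl v)

lemma singleton_prefix_singleton {w v : Msg} : ([w] : Tape) <+: [v] ↔ v = w := by
  constructor
  · rintro ⟨s, hs⟩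
    simp at hs
    exact hs.1.symm
  · rintro rfl
    exact List.prefix_rfl

variable {o : Fin n → WOTOutcome} (ωA : P.A.Ω) (ωB : P.B.Ω)

lemma Spy.viewB {x : Fin n → Msg} (h : Spy f (recB o) x rec) (z : Bool × Bool) (c : Bool)
    (w : Fin n → Msg) (a b : Tape) :
    (∃ N, (viewTestB w a b).holds
      (outputs P.A (relabel f id (curious (Fin n × Unit) P.B)) ωA ωB (Sum.inr ()) (Sum.inr ())
        (recA o) rec (inA z) (inB c) N)) ↔
      (∀ k, x k = w k) ∧ Reach P z c a b (ωA, ωB, o, ()) := by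
  have hs := h.strategy_eq P.B ωB (inB c) (Sum.inr ())
  -- The copy of what B sends is computed from what B has received after `N` rounds, so it is what
  -- `play` holds one round later. This shift does not matter for what is eventually sent.
  have key : ∀ N, (viewTestB w a b).holds
      (outputs P.A (relabel f id (curious (Fin n × Unit) P.B)) ωA ωB (Sum.inr ()) (Sum.inr ())
        (recA o) rec (inA z) (inB c) N) ↔ (∀ k, x k = w k) ∧
      a <+: (play (stratA P z (ωA, ωB, o, ())) (stratB P c (ωA, ωB, o, ())) N).1 ∧
      b <+: (play (stratA P z (ωA, ωB, o, ())) (stratB P c (ωA, ωB, o, ())) (N + 1)).2 := by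
    intro N
    unfold outputs
    rw [hs, h.output_eq]
    simp only [← singleton_prefix_singleton]
    rfl
  simp only [key]
  constructor
  · rintro ⟨N, h1, h2, h3⟩
    exact ⟨h1, N + 1, h2.trans (play_mono (causal_stratA P _ _) (causal_stratB P _ _)
      (Nat.le_succ N)).1, h3⟩
  · rintro ⟨h1, N, h2, h3⟩
    exact ⟨N, h1, h2, h3.trans (play_mono (causal_stratA P _ _) (causal_stratB P _ _)
      (Nat.le_succ N)).2⟩

lemma Spy.headB {x : Fin n → Msg} (h : Spy f (recB o) x rec) (z : Bool × Bool) (c : Bool)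
    (m : Msg) :
    (∃ N, (headTest (Sum.inr (Sum.inl ())) m).holds
      (outputs P.A (relabel f id (curious (Fin n × Unit) P.B)) ωA ωB (Sum.inr ()) (Sum.inr ())
        (recA o) rec (inA z) (inB c) N)) ↔
      ∃ N, (outB P c (ωA, ωB, o, ()) N (play (stratA P z (ωA, ωB, o, ()))
        (stratB P c (ωA, ωB, o, ())) N).1).head? = some m := by
  have hs := h.strategy_eq P.B ωB (inB c) (Sum.inr ())
  refine exists_congr fun N => ?_
  unfold outputs
  rw [hs, h.output_eq]
  rfl

lemma Spy.viewA {x : Fin n → Msg} (h : Spy f (recA o) x rec) (z : Bool × Bool) (c : Bool)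
    (w : Fin n → Msg) (a b : Tape) :
    (∃ N, (viewTestA w a b).holds
      (outputs (relabel f id (curious (Fin n × Unit) P.A)) P.B ωA ωB (Sum.inr ()) (Sum.inr ())
        rec (recB o) (inA z) (inB c) N)) ↔
      (∀ k, x k = w k) ∧ Reach P z c a b (ωA, ωB, o, ()) := by
  have hs := h.strategy_eq P.A ωA (inA z) (Sum.inr ())
  have key : ∀ N, (viewTestA w a b).holds
      (outputs (relabel f id (curious (Fin n × Unit) P.A)) P.B ωA ωB (Sum.inr ()) (Sum.inr ())
        rec (recB o) (inA z) (inB c) N) ↔ (∀ k, x k = w k) ∧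
      a <+: (play (stratA P z (ωA, ωB, o, ())) (stratB P c (ωA, ωB, o, ())) (N + 1)).1 ∧
      b <+: (play (stratA P z (ωA, ωB, o, ())) (stratB P c (ωA, ωB, o, ())) N).2 := by
    intro N
    unfold outputs
    rw [hs, h.output_eq]
    simp only [← singleton_prefix_singleton]
    rfl
  simp only [key]
  constructor
  · rintro ⟨N, h1, h2, h3⟩
    exact ⟨h1, N + 1, h2, h3.trans (play_mono (causal_stratA P _ _) (causal_stratB P _ _)
      (Nat.le_succ N)).2⟩
  · rintro ⟨h1, N, h2, h3⟩
    exact ⟨N, h1, h2.trans (play_mono (causal_stratA P _ _) (causal_stratB P _ _)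
      (Nat.le_succ N)).1, h3⟩

end Spy
end World

/-- Exchange of the first two components. -/
def swapEquiv (α β γ : Type) [MeasurableSpace α] [MeasurableSpace β] [MeasurableSpace γ] :
    α × β × γ ≃ᵐ β × α × γ :=
  MeasurableEquiv.prodAssoc.symm.trans
    ((MeasurableEquiv.prodCongr MeasurableEquiv.prodComm (MeasurableEquiv.refl γ)).trans
      MeasurableEquiv.prodAssoc)

lemma measurePreserving_swapEquiv {α β γ : Type} [MeasurableSpace α] [MeasurableSpace β]
    [MeasurableSpace γ] (μ : Measure α) (ν : Measure β) (τ : Measure γ) [SFinite μ] [SFinite ν]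
    [SFinite τ] :
    MeasurePreserving (swapEquiv α β γ) (μ.prod (ν.prod τ)) (ν.prod (μ.prod τ)) := by
  have h1 := (measurePreserving_prodAssoc μ ν τ).symm MeasurableEquiv.prodAssoc
  have h2 := (Measure.measurePreserving_swap (μ := μ) (ν := ν)).prod (MeasurePreserving.id τ)
  exact (measurePreserving_prodAssoc ν μ τ).comp (h2.comp h1)

/-! ### The views in both models as events on one probability space. -/

section World

variable {n : ℕ} (P : WOTProtocol n) (W : Weights)

lemma announce_eq {o : WOTOutcome} (h : o ∈ W.dist.support) : o.u = o.v := by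
  rw [Weights.dist, PMF.support_map] at h
  obtain ⟨s, -, rfl⟩ := h
  rcases s with ⟨_ | _ | _, _⟩ <;> rfl

lemma ae_announce : ∀ᵐ ω ∂worldMeasure P W, ∀ k, (ω.2.2.1 k).u = (ω.2.2.1 k).v := by
  have h1 : ∀ᵐ o ∂W.dist.toMeasure, o.u = o.v := by
    rw [ae_iff, PMF.toMeasure_apply_eq_zero_iff _ .of_discrete]
    exact Set.disjoint_left.2 fun o h h' => h' (announce_eq W h)
  have h2 : ∀ᵐ o ∂(Measure.pi fun _ : Fin n => W.dist.toMeasure), ∀ k, (o k).u = (o k).v :=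
    ae_all_iff.2 fun k => (Measure.quasiMeasurePreserving_eval
      (fun _ : Fin n => W.dist.toMeasure) k).ae (p := fun o => o.u = o.v) h1
  exact Measure.quasiMeasurePreserving_snd.ae
    (Measure.quasiMeasurePreserving_snd.ae (Measure.quasiMeasurePreserving_fst.ae h2))

/-- The messages `a` and `b` are finally sent, and the common information is `w`. -/
def hit (x : Bool × Bool) (c : Bool) (w : Fin n → Msg) (a b : Tape) : Set (World P) :=
  {ω | (∀ k, (ω.2.2.1 k).u = w k) ∧ Reach P x c a b ω}

/-- The auxiliary outputs of A and B agree almost surely, so the views of both corrupted players can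
be compared through the same event. -/
lemma measure_hit (x : Bool × Bool) (c : Bool) (w : Fin n → Msg) (a b : Tape) :
    (worldMeasure P W).real {ω | (∀ k, (ω.2.2.1 k).v = w k) ∧ Reach P x c a b ω} =
      (worldMeasure P W).real (hit P x c w a b) := by
  refine measureReal_congr ?_
  filter_upwards [ae_announce P W] with ω hω
  refine propext (and_congr_left fun _ => forall_congr' fun k => ?_)
  rw [hω k]

lemma forwards_passiveA (o : Fin n → WOTOutcome) :
    Forwards ((wotColl W.dist).withComm n).sysA (o, ()) (Sum.inr ()) (Sum.inr ())
      (fun t => Sum.elim (recA o t) fun k => [(o k.1).u]) (recB o) where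
  out m h := by
    funext c
    rcases c with ((⟨k, u⟩ | u) | ⟨k, u⟩) | (⟨k, u⟩ | u) <;> rfl
  monoA h := Hist.Le.elim (recA_mono o h) (Hist.Le.refl _)
  monoB := recB_mono o

lemma forwards_passiveB (o : Fin n → WOTOutcome) :
    Forwards ((wotColl W.dist).withComm n).sysB (o, ()) (Sum.inr ()) (Sum.inr ())
      (recA o) (fun t => Sum.elim (recB o t) fun k => [(o k.1).v]) where
  out m h := by
    funext c
    rcases c with (⟨k, u⟩ | u) | ((⟨k, u⟩ | u) | ⟨k, u⟩) <;> rfl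
  monoA := recA_mono o
  monoB h := Hist.Le.elim (recB_mono o h) (Hist.Le.refl _)

lemma spy_passive (r : Tape → Hist (Fin n × Unit ⊕ Unit)) (x : Fin n → Msg) :
    Spy id r x (fun t => Sum.elim (r t) fun k => [x k.1]) :=
  ⟨fun _ _ _ => rfl, fun _ _ _ => rfl, fun _ _ _ => rfl⟩

lemma obs_passiveA (x : Bool × Bool) (c : Bool) (w : Fin n → Msg) (a b : Tape) :
    obs (attachA (curious (Fin n × Unit) P.A) (attachB P.B ((wotColl W.dist).withComm n).sysA))
        (Sum.elim (inA x) (inB c)) (viewTestA w a b) =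
      (worldMeasure P W).real (hit P x c w a b) := by
  refine congrArg (fun s => (worldMeasure P W).real s) ?_
  ext ⟨ωA, ωB, o, u⟩
  exact (Forwards.outAB (curious (Fin n × Unit) P.A) P.B ((wotColl W.dist).withComm n).sysA
    ωA ωB (o, ()) (inA x) (inB c) (forwards_passiveA W o) _).trans
    ((spy_passive (recA o) fun k => (o k).u).viewA P ωA ωB x c w a b)

lemma obs_passiveB (x : Bool × Bool) (c : Bool) (w : Fin n → Msg) (a b : Tape) :
    obs (attachA P.A (attachB (curious (Fin n × Unit) P.B) ((wotColl W.dist).withComm n).sysB))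
        (Sum.elim (inA x) (inB c)) (viewTestB w a b) =
      (worldMeasure P W).real (hit P x c w a b) := by
  rw [← measure_hit]
  refine congrArg (fun s => (worldMeasure P W).real s) ?_
  ext ⟨ωA, ωB, o, u⟩
  exact (Forwards.outAB P.A (curious (Fin n × Unit) P.B) ((wotColl W.dist).withComm n).sysB
    ωA ωB (o, ()) (inA x) (inB c) (forwards_passiveB W o) _).trans
    ((spy_passive (recB o) fun k => (o k).v).viewB P ωA ωB x c w a b)

/-- The renaming of the channels of a curious player in the malicious model. -/
def spyChannel : Unit ⊕ ((Fin n × Unit ⊕ Unit) ⊕ Fin n × Unit) →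
    Unit ⊕ (Fin n × (Unit ⊕ Unit) ⊕ Unit)
  | Sum.inl u => Sum.inl u
  | Sum.inr (Sum.inl (Sum.inl (k, u))) => Sum.inr (Sum.inl (k, Sum.inl u))
  | Sum.inr (Sum.inl (Sum.inr u)) => Sum.inr (Sum.inr u)
  | Sum.inr (Sum.inr (k, u)) => Sum.inr (Sum.inl (k, Sum.inr u))

/-- The curious player in the malicious model. -/
def spy {V I : Type} (n : ℕ) (π : System (Unit ⊕ (Fin n × Unit ⊕ Unit)) (V ⊕ I)) :
    System (Unit ⊕ (Fin n × (Unit ⊕ Unit) ⊕ Unit))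
      ((V ⊕ View Unit V I (Fin n × Unit ⊕ Unit) (Fin n × Unit)) ⊕ I) :=
  relabel spyChannel id (curious (Fin n × Unit) π)

/-- What a corrupted player receives if he receives `z` as an honest player, and `x`. -/
def recSpy (z x : Fin n → Msg) (t : Tape) : Hist (Fin n × (Unit ⊕ Unit) ⊕ Unit) :=
  Sum.elim (fun k => Sum.elim (fun _ => [z k.1]) (fun _ => [x k.1]) k.2) fun _ => t

lemma recSpy_mono (z x : Fin n → Msg) {t t' : Tape} (h : t <+: t') :
    (recSpy z x t).Le (recSpy z x t') :=
  Hist.Le.elim (Hist.Le.refl _) fun _ => h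

lemma spy_active (z x : Fin n → Msg) :
    Spy spyChannel (fun t => Sum.elim (fun k => [z k.1]) fun _ => t) x (recSpy z x) where
  input _ _ _ := rfl
  regular _ _ c := by rcases c with ⟨k, u⟩ | u <;> rfl
  extra _ _ _ := rfl

lemma forwards_activeA (o : Fin n → WOTOutcome) :
    Forwards (withComm n (wotColl W.dist).sysA) (o, ()) (Sum.inr ()) (Sum.inr ())
      (recSpy (fun k => [(o k).x.1, (o k).x.2]) fun k => (o k).u) (recB o) where
  out m h := by
    funext c
    rcases c with (⟨k, (u | u)⟩ | u) | (⟨k, u⟩ | u) <;> rfl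
  monoA := recSpy_mono _ _
  monoB := recB_mono o

lemma forwards_activeB (o : Fin n → WOTOutcome) :
    Forwards (withComm n (wotColl W.dist).sysB) (o, ()) (Sum.inr ()) (Sum.inr ())
      (recA o) (recSpy (fun k => [(o k).c, (o k).y]) fun k => (o k).v) where
  out m h := by
    funext c
    rcases c with (⟨k, u⟩ | u) | (⟨k, (u | u)⟩ | u) <;> rfl
  monoA := recA_mono o
  monoB := recSpy_mono _ _

lemma obs_activeA (x : Bool × Bool) (c : Bool) (w : Fin n → Msg) (a b : Tape) :
    obs (attachA (spy n P.A) (attachB P.B (withComm n (wotColl W.dist).sysA)))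
        (Sum.elim (inA x) (inB c)) (viewTestA w a b) =
      (worldMeasure P W).real (hit P x c w a b) := by
  refine congrArg (fun s => (worldMeasure P W).real s) ?_
  ext ⟨ωA, ωB, o, u⟩
  exact (Forwards.outAB (spy n P.A) P.B (withComm n (wotColl W.dist).sysA)
    ωA ωB (o, ()) (inA x) (inB c) (forwards_activeA W o) _).trans
    ((spy_active (fun k => [(o k).x.1, (o k).x.2]) fun k => (o k).u).viewA P (o := o)
      ωA ωB x c w a b)

/-- In the network with a corrupted B, A and the resource are joined first. Only the order of the
independent random sources changes. -/
lemma obs_swap (T : Test _) (x : Bool × Bool) (c : Bool) (s : Set (World P))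
    (h : ∀ ωA ωB o, (∃ N, T.holds (outputs P.A (spy n P.B) ωA ωB (Sum.inr ()) (Sum.inr ()) (recA o)
      (recSpy (fun k => [(o k).c, (o k).y]) fun k => (o k).v) (inA x) (inB c) N)) ↔
        (ωA, ωB, o, ()) ∈ s) :
    obs (attachB (spy n P.B) (attachA P.A (withComm n (wotColl W.dist).sysB)))
        (Sum.elim (inA x) (inB c)) T = (worldMeasure P W).real s := by
  have hmp := measurePreserving_swapEquiv P.B.P P.A.P
    ((Measure.pi fun _ : Fin n => W.dist.toMeasure).prod (Measure.dirac ()))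
  have h1 := congrArg ENNReal.toReal (hmp.measure_preimage_equiv s)
  refine Eq.trans ?_ h1
  refine congrArg (fun s => (P.B.P.prod (P.A.P.prod
    ((Measure.pi fun _ : Fin n => W.dist.toMeasure).prod (Measure.dirac ())))).real s) ?_
  ext ⟨ωB, ωA, o, u⟩
  exact (Forwards.outBA P.A (spy n P.B) (withComm n (wotColl W.dist).sysB)
    ωA ωB (o, ()) (inA x) (inB c) (forwards_activeB W o) _).trans (h ωA ωB o)

lemma obs_activeB (x : Bool × Bool) (c : Bool) (w : Fin n → Msg) (a b : Tape) :
    obs (attachB (spy n P.B) (attachA P.A (withComm n (wotColl W.dist).sysB)))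
        (Sum.elim (inA x) (inB c)) (viewTestB w a b) =
      (worldMeasure P W).real (hit P x c w a b) := by
  rw [← measure_hit]
  exact obs_swap P W _ x c _ fun ωA ωB o =>
    (spy_active (fun k => [(o k).c, (o k).y]) fun k => (o k).v).viewB P (o := o) ωA ωB x c w a b

lemma obs_activeB_output (x : Bool × Bool) (c : Bool) (m : Msg) :
    obs (attachB (spy n P.B) (attachA P.A (withComm n (wotColl W.dist).sysB)))
        (Sum.elim (inA x) (inB c)) (headTest (Sum.inr (Sum.inl ())) m) =
      (worldMeasure P W).real {ω | ∃ N,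
        (outB P c ω N (play (stratA P x ω) (stratB P c ω) N).1).head? = some m} :=
  obs_swap P W _ x c _ fun ωA ωB o =>
    (spy_active (fun k => [(o k).c, (o k).y]) fun k => (o k).v).headB P (o := o) ωA ωB x c m

/-! ### From equally distributed conversations to a contradiction -/

lemma measurable_play (x : Bool × Bool) (c : Bool) (N : ℕ) :
    Measurable fun ω : World P => play (stratA P x ω) (stratB P c ω) N := by
  have hw : Measurable fun ω : World P => ω.2.2.1 := by fun_prop
  induction N with
  | zero => exact measurable_const
  | succ N ih =>
    refine Measurable.prodMk ?_ ?_
    · have h1 : Measurable fun ω : World P => (ω.1, (Sum.elim (inA x)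
          (recA ω.2.2.1 (play (stratA P x ω) (stratB P c ω) N).2) :
            Hist (Unit ⊕ (Fin n × Unit ⊕ Unit)))) := by
        refine measurable_fst.prodMk (measurable_pi_iff.2 ?_)
        rintro (u | ⟨k, u⟩ | u)
        · exact measurable_const
        · exact (Measurable.of_discrete (f := fun o : WOTOutcome => ([[o.x.1, o.x.2]] : Tape))).comp
            ((measurable_pi_apply k).comp hw)
        · exact ih.snd
      exact (measurable_pi_apply _).comp ((P.A.meas N).comp h1)
    · have h1 : Measurable fun ω : World P => (ω.2.1, (Sum.elim (inB c)
          (recB ω.2.2.1 (play (stratA P x ω) (stratB P c ω) N).1) :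
            Hist (Unit ⊕ (Fin n × Unit ⊕ Unit)))) := by
        refine (measurable_fst.comp measurable_snd).prodMk (measurable_pi_iff.2 ?_)
        rintro (u | ⟨k, u⟩ | u)
        · exact measurable_const
        · exact (Measurable.of_discrete (f := fun o : WOTOutcome => ([[o.c, o.y]] : Tape))).comp
            ((measurable_pi_apply k).comp hw)
        · exact ih.fst
      exact (measurable_pi_apply _).comp ((P.B.meas N).comp h1)

end World

lemma Weights.mem_support_iff (W : Weights) (o : WOTOutcome) :
    o ∈ W.dist.support ↔ ∃ s : Seed, ENNReal.ofReal (W.w s.1 / 16) ≠ 0 ∧ wotOutcome s = o := by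
  rw [Weights.dist, PMF.support_map]
  refine exists_congr fun s => and_congr_left fun _ => ?_
  exact PMF.mem_support_ofFintype_iff _ _

/-- Given the common information, every output of A is possible together with every output of
B. -/
lemma Weights.exists_mix (W : Weights) {o o' : WOTOutcome} (h : o ∈ W.dist.support)
    (h' : o' ∈ W.dist.support) (hu : o.u = o'.u) :
    ∃ o'' ∈ W.dist.support, o''.u = o.u ∧ o''.x = o.x ∧ o''.c = o'.c ∧ o''.y = o'.y := by
  obtain ⟨⟨l, b₁, b₂, b₃, b₄⟩, hs, rfl⟩ := (W.mem_support_iff o).1 h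
  obtain ⟨⟨l', b₁', b₂', b₃', b₄'⟩, hs', rfl⟩ := (W.mem_support_iff o').1 h'
  rcases l with _ | _ | _ <;> rcases l' with _ | _ | _ <;>
    simp only [wotOutcome, announce, List.cons.injEq, Bool.false_eq_true, Bool.true_eq_false,
      false_and, and_false, and_true, true_and, reduceCtorEq] at hu
  -- With independent bits the two halves of the seeds are recombined. In the two other cases the
  -- announcement fixes one player's output, and the outcome that supplies the other player's output
  -- serves as it stands.
  · exact ⟨wotOutcome (none, b₁, b₂, b₃', b₄'),
      (W.mem_support_iff _).2 ⟨(none, b₁, b₂, b₃', b₄'), hs, rfl⟩,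
      rfl, rfl, rfl, rfl⟩
  · obtain ⟨rfl, rfl⟩ := hu
    exact ⟨_, h', rfl, rfl, rfl, rfl⟩
  · obtain ⟨rfl, rfl⟩ := hu
    exact ⟨_, h, rfl, rfl, rfl, rfl⟩

instance : Countable WOTOutcome := by
  have hinj : Function.Injective fun o : WOTOutcome => (o.x, o.c, o.y, o.u, o.v) := by
    rintro ⟨x, c, y, u, v⟩ ⟨x', c', y', u', v'⟩ h
    simp only [Prod.mk.injEq] at h
    simp only [WOTOutcome.mk.injEq]
    exact h
  exact hinj.countable

/-! ### Independence given the announcements, and the contradiction. -/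

section World

variable {n : ℕ} (P : WOTProtocol n) (W : Weights)

lemma worldMeasure_rect (s : Set P.A.Ω) (t : Set P.B.Ω) (o : Fin n → WOTOutcome) :
    worldMeasure P W (s ×ˢ (t ×ˢ ({o} ×ˢ Set.univ))) = P.A.P s * (P.B.P t * ∏ k, W.dist (o k)) := by
  rw [worldMeasure, Measure.prod_prod, Measure.prod_prod, Measure.prod_prod, Measure.pi_singleton]
  simp only [measure_univ, mul_one]
  congr 2
  exact Finset.prod_congr rfl fun k _ => PMF.toMeasure_apply_singleton _ _ (.of_discrete)

/-- The common information is `w`. -/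
def common (w : Fin n → Msg) : Set (World P) := {ω | ∀ k, (ω.2.2.1 k).u = w k}

lemma measurableSet_common (w : Fin n → Msg) : MeasurableSet (common P w) := by
  have hw : Measurable fun ω : World P => ω.2.2.1 := by fun_prop
  unfold common
  rw [Set.ofPred_forall]
  exact .iInter fun k => ((measurable_pi_apply k).comp hw)
    (MeasurableSet.of_discrete (s := {o : WOTOutcome | o.u = w k}))

/-- The vectors of outcomes are countable, so an event of positive measure has a slice of positive
measure with fixed outcomes. This slice lies in a product of its projections to the randomness of A
and of B, so neither projection is null. -/
lemma exists_outcome {w : Fin n → Msg} {s : Set (World P)}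
    (h : (worldMeasure P W).restrict (common P w) s ≠ 0) :
    ∃ o : Fin n → WOTOutcome, (∀ k, (o k).u = w k) ∧ (∀ k, o k ∈ W.dist.support) ∧
      P.A.P {ωA | ∃ ωB, (ωA, ωB, o, ()) ∈ s} ≠ 0 ∧
      P.B.P {ωB | ∃ ωA, (ωA, ωB, o, ()) ∈ s} ≠ 0 := by
  by_contra hcon
  push Not at hcon
  refine h ?_
  rw [Measure.restrict_apply' (measurableSet_common P w)]
  have hsub : s ∩ common P w ⊆ ⋃ o : {o : Fin n → WOTOutcome // ∀ k, (o k).u = w k},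
      {ωA | ∃ ωB, (ωA, ωB, o.1, ()) ∈ s} ×ˢ
        ({ωB | ∃ ωA, (ωA, ωB, o.1, ()) ∈ s} ×ˢ ({o.1} ×ˢ Set.univ)) := by
    rintro ⟨ωA, ωB, o, u⟩ ⟨h1, h2⟩
    exact Set.mem_iUnion.2 ⟨⟨o, h2⟩, ⟨ωB, h1⟩, ⟨ωA, h1⟩, rfl, trivial⟩
  refine measure_mono_null hsub (measure_iUnion_null fun o => ?_)
  rw [worldMeasure_rect]
  by_cases hsupp : ∀ k, o.1 k ∈ W.dist.support
  · by_cases hA : P.A.P {ωA | ∃ ωB, (ωA, ωB, o.1, ()) ∈ s} = 0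
    · rw [hA, zero_mul]
    · rw [hcon o.1 o.2 hsupp hA, zero_mul, mul_zero]
  · push Not at hsupp
    obtain ⟨k, hk⟩ := hsupp
    rw [Finset.prod_eq_zero (Finset.mem_univ k) ((PMF.apply_eq_zero_iff W.dist _).2 hk), mul_zero,
      mul_zero]

/-- The responses of the resource to what the other player has sent. -/
abbrev Responses (O : Type) : Type :=
  {rec : Tape → Hist O // ∀ {t t' : Tape}, t <+: t' → (rec t).Le (rec t')}

/-- Each event has a non-null slice at some outcomes with announcements `w`. By `exists_mix` there
are possible outcomes that give A what it receives in one slice and B what it receives in the other.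
Private randomness is independent, so the events meet there in positive measure. -/
lemma indep_world {w : Fin n → Msg}
    (s : Set (P.A.Ω × Responses (Fin n × Unit ⊕ Unit)))
    (t : Set (P.B.Ω × Responses (Fin n × Unit ⊕ Unit)))
    (hs : (worldMeasure P W).restrict (common P w)
      ((fun ω => (ω.1, ⟨recA ω.2.2.1, recA_mono _⟩)) ⁻¹' s) ≠ 0)
    (ht : (worldMeasure P W).restrict (common P w)
      ((fun ω => (ω.2.1, ⟨recB ω.2.2.1, recB_mono _⟩)) ⁻¹' t) ≠ 0) :
    (worldMeasure P W).restrict (common P w)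
      ((fun ω => (ω.1, ⟨recA ω.2.2.1, recA_mono _⟩)) ⁻¹' s ∩
        (fun ω => (ω.2.1, ⟨recB ω.2.2.1, recB_mono _⟩)) ⁻¹' t) ≠ 0 := by
  obtain ⟨o, ho1, ho2, hoA, -⟩ := exists_outcome P W hs
  obtain ⟨o', ho1', ho2', -, hoB⟩ := exists_outcome P W ht
  choose m hm1 hm2 hm3 hm4 hm5 using fun k =>
    W.exists_mix (ho2 k) (ho2' k) ((ho1 k).trans (ho1' k).symm)
  have hA : recA m = recA o := by
    unfold recA
    simp only [hm3]
  have hB : recB m = recB o' := by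
    unfold recB
    simp only [hm4, hm5]
  rw [Measure.restrict_apply' (measurableSet_common P w)]
  have hpos : worldMeasure P W ({ωA | (ωA, (⟨recA o, recA_mono _⟩ : Responses _)) ∈ s} ×ˢ
      ({ωB | (ωB, (⟨recB o', recB_mono _⟩ : Responses _)) ∈ t} ×ˢ ({m} ×ˢ Set.univ))) ≠ 0 := by
    rw [worldMeasure_rect]
    refine mul_ne_zero (fun h0 => hoA (measure_mono_null ?_ h0))
      (mul_ne_zero (fun h0 => hoB (measure_mono_null ?_ h0)) ?_)
    · rintro ωA ⟨ωB, h⟩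
      exact h
    · rintro ωB ⟨ωA, h⟩
      exact h
    · exact Finset.prod_ne_zero_iff.2 fun k _ => (PMF.mem_support_iff _ _).1 (hm1 k)
  refine fun h0 => hpos (measure_mono_null ?_ h0)
  rintro ⟨ωA, ωB, o'', u⟩ ⟨h1, h2, rfl, -⟩
  refine ⟨⟨?_, ?_⟩, fun k => (hm2 k).trans (ho1 k)⟩
  · rw [Set.mem_preimage]
    simp only [hA]
    exact h1
  · rw [Set.mem_preimage]
    simp only [hB]
    exact h2

/-- There is no protocol where B learns which of two inputs A has, although the conversation is
the same. -/
theorem not_correct_of_hit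
    (hA : ∀ x w a b, (worldMeasure P W).real (hit P x false w a b) =
      (worldMeasure P W).real (hit P x true w a b))
    (hB : ∀ w a b, (worldMeasure P W).real (hit P (false, false) true w a b) =
      (worldMeasure P W).real (hit P (true, false) true w a b))
    (hc : ∀ x c, (worldMeasure P W).real {ω | ∃ N,
        (outB P c ω N (play (stratA P x ω) (stratB P c ω) N).1).head? = some [pick x c]} = 1) :
    False := by
  obtain ⟨o₀, ho₀⟩ := W.dist.support_nonempty
  -- Any announcements of positive probability would do.
  let w : Fin n → Msg := fun _ => o₀.u
  have hae : ∀ x c, ∀ᵐ ω ∂worldMeasure P W, ∃ N,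
      (outB P c ω N (play (stratA P x ω) (stratB P c ω) N).1).head? = some [pick x c] := by
    intro x c
    have h1 := hc x c
    have hm : MeasurableSet {ω : World P | ∃ N,
        (outB P c ω N (play (stratA P x ω) (stratB P c ω) N).1).head? = some [pick x c]} := by
      have hw : Measurable fun ω : World P => ω.2.2.1 := by fun_prop
      rw [Set.ofPred_exists]
      refine .iUnion fun N => ?_
      have h2 : Measurable fun ω : World P => (ω.2.1, (Sum.elim (inB c)
          (recB ω.2.2.1 (play (stratA P x ω) (stratB P c ω) N).1) :
            Hist (Unit ⊕ (Fin n × Unit ⊕ Unit)))) := by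
        refine (measurable_fst.comp measurable_snd).prodMk (measurable_pi_iff.2 ?_)
        rintro (u | ⟨k, u⟩ | u)
        · exact measurable_const
        · exact (Measurable.of_discrete (f := fun o : WOTOutcome => ([[o.c, o.y]] : Tape))).comp
            ((measurable_pi_apply k).comp hw)
        · exact (measurable_play P x c N).fst
      exact ((measurable_pi_apply (Sum.inl ())).comp ((P.B.meas N).comp h2))
        (MeasurableSet.of_discrete (s := {t : Tape | t.head? = some [pick x c]}))
    rw [Measure.real, ENNReal.toReal_eq_one_iff] at h1
    exact (mem_ae_iff_prob_eq_one hm).2 h1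
  let S : Duel (World P) (P.A.Ω × Responses (Fin n × Unit ⊕ Unit))
      (P.B.Ω × Responses (Fin n × Unit ⊕ Unit)) :=
    { ρ := (worldMeasure P W).restrict (common P w)
      fin := inferInstance
      prA := fun ω => (ω.1, ⟨recA ω.2.2.1, recA_mono _⟩)
      prB := fun ω => (ω.2.1, ⟨recB ω.2.2.1, recB_mono _⟩)
      f := fun i a => strategy P.A a.1 (inA (i, false)) (Sum.inr ()) a.2.1
      g := fun b => strategy P.B b.1 (inB false) (Sum.inr ()) b.2.1
      y := fun b N t => output P.B b.1 (inB false) b.2.1 N t ()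
      causal_f := fun i a => causal_strategy P.A a.1 _ _ a.2.2
      causal_g := fun b => causal_strategy P.B b.1 _ _ b.2.2
      causal_y := fun b _ _ _ _ hn ht => output_mono P.B b.1 _ b.2.2 hn ht ()
      meas := fun i N => measurable_play P (i, false) false N
      indep := indep_world P W
      law := fun a b => by
        -- Change B's choice to `true`, which A does not notice, then A's first bit, which B does
        -- not notice with this choice, and change the choice back.
        have h1 : (worldMeasure P W).real (hit P (false, false) false w a b) =
            (worldMeasure P W).real (hit P (true, false) false w a b) := by
          rw [hA, hB, ← hA]
        have h2 := (measureReal_eq_measureReal_iff).1 h1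
        have key : ∀ i, (worldMeasure P W).restrict (common P w)
            {ω | Reach P (i, false) false a b ω} =
              worldMeasure P W (hit P (i, false) false w a b) := by
          intro i
          rw [Measure.restrict_apply' (measurableSet_common P w)]
          congr 1
          exact Set.inter_comm _ _
        exact (key false).trans (h2.trans (key true).symm)
      correct := fun i => ae_restrict_of_ae (hae (i, false) false) }
  have hzero := S.measure_eq_zero
  have hpos : worldMeasure P W (Set.univ ×ˢ (Set.univ ×ˢ ({fun _ => o₀} ×ˢ Set.univ))) ≠ 0 := by
    rw [worldMeasure_rect, measure_univ, measure_univ, one_mul, one_mul]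
    exact Finset.prod_ne_zero_iff.2 fun k _ => (PMF.mem_support_iff _ _).1 ho₀
  have h1 : (worldMeasure P W).restrict (common P w) Set.univ = 0 := by
    rw [show (worldMeasure P W).restrict (common P w) = 0 from hzero]
    rfl
  rw [Measure.restrict_apply' (measurableSet_common P w), Set.univ_inter] at h1
  refine hpos (measure_mono_null ?_ h1)
  rintro ⟨ωA, ωB, o, u⟩ ⟨-, -, rfl, -⟩ k
  rfl

end World

/-! ### The ideal networks -/

section Blind

variable {I O IA OA IB OB U V J K UA VA UB VB X Y : Type}

/-- What A receives does not depend on whether B sends `hB` or `hB'`. -/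
def BlindA (F : System (IA ⊕ IB) (OA ⊕ OB)) (hB hB' : Hist IB) : Prop :=
  ∀ ω n (hA : Hist IA) o, F.out ω n (Sum.elim hA hB) (Sum.inl o) =
    F.out ω n (Sum.elim hA hB') (Sum.inl o)

/-- What B receives does not depend on whether A sends `hA` or `hA'`, if B sends `hB`. -/
def BlindB (F : System (IA ⊕ IB) (OA ⊕ OB)) (hA hA' : Hist IA) (hB : Hist IB) : Prop :=
  ∀ ω n o, F.out ω n (Sum.elim hA hB) (Sum.inr o) = F.out ω n (Sum.elim hA' hB) (Sum.inr o)

/-- By induction on the rounds, neither `π` nor what `F` tells `π` depends on B's input, although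
what `F` tells B may. -/
lemma BlindA.attachA {F : System (J ⊕ IB) (K ⊕ OB)} {hB hB' : Hist IB} (h : BlindA F hB hB')
    (π : System (U ⊕ K) (V ⊕ J)) : BlindA (attachA π F) hB hB' := by
  intro (ω : π.Ω × F.Ω) n hU v
  refine (congrFun (attachA_out π F ω n _) _).trans
    (.trans ?_ (congrFun (attachA_out π F ω n _) _).symm)
  let x : Hist IB → ℕ → Hist _ := fun hB k => (par π F).loop wireA ω n (Sum.elim hU hB) k
  have hπ : ∀ hB k, (fun o => x hB (k + 1) (Sum.inl o)) =
      π.out ω.1 n (Sum.elim hU fun o => x hB k (Sum.inr (Sum.inl o))) := by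
    intro hB k
    refine (show (fun o => x hB (k + 1) (Sum.inl o)) = π.out ω.1 n
      (fun i => Sum.elim (Sum.elim hU hB) (x hB k) (wireA (Sum.inl i))) from rfl).trans ?_
    congr 1
    funext i
    rcases i with i | i <;> rfl
  have hF : ∀ hB k, (fun o => x hB (k + 1) (Sum.inr o)) =
      F.out ω.2 n (Sum.elim (fun j => x hB k (Sum.inl (Sum.inr j))) hB) := by
    intro hB k
    refine (show (fun o => x hB (k + 1) (Sum.inr o)) = F.out ω.2 n
      (fun i => Sum.elim (Sum.elim hU hB) (x hB k) (wireA (Sum.inr i))) from rfl).trans ?_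
    congr 1
    funext i
    rcases i with i | i <;> rfl
  have key : ∀ k, (∀ o, x hB k (Sum.inl o) = x hB' k (Sum.inl o)) ∧
      ∀ o, x hB k (Sum.inr (Sum.inl o)) = x hB' k (Sum.inr (Sum.inl o)) := by
    intro k
    induction k with
    | zero => exact ⟨fun _ => rfl, fun _ => rfl⟩
    | succ k ih =>
      refine ⟨congrFun ((hπ hB k).trans (.trans ?_ (hπ hB' k).symm)), fun o =>
        (congrFun (hF hB k) (Sum.inl o)).trans (.trans ?_ (congrFun (hF hB' k) (Sum.inl o)).symm)⟩
      · rw [funext ih.2]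
      · rw [funext fun j => ih.1 (Sum.inr j)]
        exact h _ _ _ _
  exact (key n).1 (Sum.inl v)

/-- The wiring of a simulator that only changes the auxiliary output of A. -/
def wireOA : (UA ⊕ (VA ⊕ Y)) ⊕ (UA ⊕ UB) → (UA ⊕ UB) ⊕ (X ⊕ ((VA ⊕ Y) ⊕ VB))
  | Sum.inl (Sum.inl u) => Sum.inl (Sum.inl u)
  | Sum.inl (Sum.inr o) => Sum.inr (Sum.inr (Sum.inl o))
  | Sum.inr u => Sum.inl u

/-- The exposed channels of a simulator that only changes the auxiliary output of A. -/
def exposeOA : (VA ⊕ X) ⊕ VB → X ⊕ ((VA ⊕ Y) ⊕ VB)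
  | Sum.inl (Sum.inl v) => Sum.inr (Sum.inl (Sum.inl v))
  | Sum.inl (Sum.inr x) => Sum.inl x
  | Sum.inr v => Sum.inr (Sum.inr v)

/-- The wiring of a simulator that only changes the auxiliary output of B. -/
def wireOB : (UB ⊕ (VB ⊕ Y)) ⊕ (UA ⊕ UB) → (UA ⊕ UB) ⊕ (X ⊕ (VA ⊕ (VB ⊕ Y)))
  | Sum.inl (Sum.inl u) => Sum.inl (Sum.inr u)
  | Sum.inl (Sum.inr o) => Sum.inr (Sum.inr (Sum.inr o))
  | Sum.inr u => Sum.inl u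

/-- The exposed channels of a simulator that only changes the auxiliary output of B. -/
def exposeOB : VA ⊕ (VB ⊕ X) → X ⊕ (VA ⊕ (VB ⊕ Y))
  | Sum.inl v => Sum.inr (Sum.inl v)
  | Sum.inr (Sum.inl v) => Sum.inr (Sum.inr (Sum.inl v))
  | Sum.inr (Sum.inr x) => Sum.inl x

lemma observeA_out (S : System (UA ⊕ (VA ⊕ Y)) X) (G : System (UA ⊕ UB) ((VA ⊕ Y) ⊕ VB))
    (ω : S.Ω × G.Ω) (n : ℕ) (h : Hist (UA ⊕ UB)) :
    (observeA S G).out ω n h = fun o => (par S G).loop wireOA ω n h n (exposeOA o) :=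
  wire_out_congr _ (by rintro ((_ | _) | _) <;> rfl) (by rintro ((_ | _) | _) <;> rfl) _ _ _

lemma observeB_out (S : System (UB ⊕ (VB ⊕ Y)) X) (G : System (UA ⊕ UB) (VA ⊕ (VB ⊕ Y)))
    (ω : S.Ω × G.Ω) (n : ℕ) (h : Hist (UA ⊕ UB)) :
    (observeB S G).out ω n h = fun o => (par S G).loop wireOB ω n h n (exposeOB o) :=
  wire_out_congr _ (by rintro ((_ | _) | _) <;> rfl) (by rintro (_ | _ | _) <;> rfl) _ _ _

lemma BlindA.observeA {G : System (UA ⊕ UB) ((VA ⊕ Y) ⊕ VB)} {hB hB' : Hist UB}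
    (h : BlindA G hB hB') (S : System (UA ⊕ (VA ⊕ Y)) X) : BlindA (observeA S G) hB hB' := by
  intro (ω : S.Ω × G.Ω) n hA o
  refine (congrFun (observeA_out S G ω n _) _).trans
    (.trans ?_ (congrFun (observeA_out S G ω n _) _).symm)
  let x : Hist UB → ℕ → Hist _ := fun hB k => (par S G).loop wireOA ω n (Sum.elim hA hB) k
  have hS : ∀ hB k, (fun o => x hB (k + 1) (Sum.inl o)) =
      S.out ω.1 n (Sum.elim hA fun o => x hB k (Sum.inr (Sum.inl o))) := by
    intro hB k
    refine (show (fun o => x hB (k + 1) (Sum.inl o)) = S.out ω.1 n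
      (fun i => Sum.elim (Sum.elim hA hB) (x hB k) (wireOA (Sum.inl i))) from rfl).trans ?_
    congr 1
    funext i
    rcases i with i | i <;> rfl
  have hG : ∀ hB k, (fun o => x hB (k + 1) (Sum.inr o)) = G.out ω.2 n (Sum.elim hA hB) :=
    fun _ _ => rfl
  have key : ∀ k, (∀ o, x hB k (Sum.inl o) = x hB' k (Sum.inl o)) ∧
      ∀ o, x hB k (Sum.inr (Sum.inl o)) = x hB' k (Sum.inr (Sum.inl o)) := by
    intro k
    induction k with
    | zero => exact ⟨fun _ => rfl, fun _ => rfl⟩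
    | succ k ih =>
      refine ⟨congrFun ((hS hB k).trans (.trans ?_ (hS hB' k).symm)), fun o => h _ _ _ o⟩
      rw [funext ih.2]
  rcases o with o | o
  · exact (key n).2 (Sum.inl o)
  · exact (key n).1 o

/-- The simulator cannot change B's input, so it sees only what `G` tells B for this very `hB`, and
this does not depend on A's input. -/
lemma BlindB.observeB {G : System (UA ⊕ UB) (VA ⊕ (VB ⊕ Y))} {hA hA' : Hist UA} {hB : Hist UB}
    (h : BlindB G hA hA' hB) (S : System (UB ⊕ (VB ⊕ Y)) X) :
    BlindB (observeB S G) hA hA' hB := by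
  intro (ω : S.Ω × G.Ω) n o
  refine (congrFun (observeB_out S G ω n _) _).trans
    (.trans ?_ (congrFun (observeB_out S G ω n _) _).symm)
  let x : Hist UA → ℕ → Hist _ := fun hA k => (par S G).loop wireOB ω n (Sum.elim hA hB) k
  have hS : ∀ hA k, (fun o => x hA (k + 1) (Sum.inl o)) =
      S.out ω.1 n (Sum.elim hB fun o => x hA k (Sum.inr (Sum.inr o))) := by
    intro hA k
    refine (show (fun o => x hA (k + 1) (Sum.inl o)) = S.out ω.1 n
      (fun i => Sum.elim (Sum.elim hA hB) (x hA k) (wireOB (Sum.inl i))) from rfl).trans ?_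
    congr 1
    funext i
    rcases i with i | i <;> rfl
  have key : ∀ k, (∀ o, x hA k (Sum.inl o) = x hA' k (Sum.inl o)) ∧
      ∀ o, x hA k (Sum.inr (Sum.inr o)) = x hA' k (Sum.inr (Sum.inr o)) := by
    intro k
    induction k with
    | zero => exact ⟨fun _ => rfl, fun _ => rfl⟩
    | succ k ih =>
      refine ⟨congrFun ((hS hA k).trans (.trans ?_ (hS hA' k).symm)), fun o => h _ _ o⟩
      rw [funext ih.2]
  rcases o with o | o
  · exact (key n).2 (Sum.inl o)
  · exact (key n).1 o

end Blind

lemma measurableSet_holds {I O : Type} (F : System I O) (h₀ : Hist I) (T : Test O) :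
    MeasurableSet {ω | ∃ n, T.holds (F.out ω n h₀)} := by
  rw [Set.ofPred_exists]
  exact .iUnion fun n => ((F.meas n).comp (measurable_id.prodMk measurable_const)) T.meas

lemma ae_of_obs_eq_one {I O : Type} {F : System I O} {h₀ : Hist I} {T : Test O}
    (h : obs F h₀ T = 1) : ∀ᵐ ω ∂F.P, ∃ n, T.holds (F.out ω n h₀) := by
  rw [obs, Measure.real, ENNReal.toReal_eq_one_iff] at h
  exact (mem_ae_iff_prob_eq_one (measurableSet_holds F h₀ T)).2 h

lemma obs_OT (x : Bool × Bool) (c : Bool) :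
    obs OT (Sum.elim (inA x) (inB c)) (headTest (Sum.inr ()) [pick x c]) = 1 := by
  have h : {ω | ∃ n, (headTest (Sum.inr ()) [pick x c]).holds
      (OT.out ω n (Sum.elim (inA x) (inB c)))} = Set.univ :=
    Set.eq_univ_of_forall fun _ => ⟨0, rfl⟩
  rw [obs, h]
  exact probReal_univ

lemma blindA_OT (c c' : Bool) : BlindA OT (inB c) (inB c') := fun _ _ _ _ => rfl

section View

variable {n : ℕ} (w : Fin n → Msg) (a b : Tape)

lemma BlindA.obs_eq {F : System (Unit ⊕ Unit) ((Unit ⊕ View Unit Unit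
    (Fin n × Empty ⊕ Unit) (Fin n × Unit ⊕ Unit) (Fin n × Unit)) ⊕ Unit)} {hB hB' : Hist Unit}
    (h : BlindA F hB hB') (hA : Hist Unit) :
    obs F (Sum.elim hA hB) (viewTestA w a b) = obs F (Sum.elim hA hB') (viewTestA w a b) := by
  refine congrArg (fun s => F.P.real s) (Set.ext fun ω => exists_congr fun m => ?_)
  simp only [viewTestA, viewTest, h ω m hA]

lemma BlindB.obs_eq {F : System (Unit ⊕ Unit) (Unit ⊕ (Unit ⊕ View Unit Unit
    (Fin n × Empty ⊕ Unit) (Fin n × Unit ⊕ Unit) (Fin n × Unit)))} {hA hA' hB : Hist Unit}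
    (h : BlindB F hA hA' hB) :
    obs F (Sum.elim hA hB) (viewTestB w a b) = obs F (Sum.elim hA' hB) (viewTestB w a b) := by
  refine congrArg (fun s => F.P.real s) (Set.ext fun ω => exists_congr fun m => ?_)
  simp only [viewTestB, viewTest, h ω m]

end View

section World

variable {n : ℕ} (P : WOTProtocol n) (W : Weights)

lemma correct_of_close
    (h : Close 0 (attachA P.A (attachB P.B (withComm n (wotColl W.dist).sys))) OT)
    (x : Bool × Bool) (c : Bool) : (worldMeasure P W).real {ω | ∃ N,
      (outB P c ω N (play (stratA P x ω) (stratB P c ω) N).1).head? = some [pick x c]} = 1 := by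
  rw [← obs_honest, h.obs_eq, obs_OT]

/-- No protocol implements oblivious transfer in the semi-honest model. -/
theorem not_passivelySecure :
    ¬ PassivelySecure 0 P ((wotColl W.dist).withComm n) OTPassive := by
  rintro ⟨h, ⟨SB, hB⟩, ⟨SA, hA⟩⟩
  refine not_correct_of_hit P W (fun x w a b => ?_) (fun w a b => ?_) (correct_of_close P W h)
  · have h1 : BlindA OTPassive.sysA (inB false) (inB true) := by
      rintro ω m hA (o | o)
      · rfl
      · exact o.elim
    rw [← obs_passiveA, ← obs_passiveA]
    exact (hA.obs_eq _ _).trans (((h1.observeA SA).obs_eq w a b _).trans (hA.obs_eq _ _).symm)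
  · have h1 : BlindB OTPassive.sysB (inA (false, false)) (inA (true, false)) (inB true) := by
      rintro ω m (o | o)
      · rfl
      · exact o.elim
    rw [← obs_passiveB, ← obs_passiveB]
    exact (hB.obs_eq _ _).trans (((h1.observeB SB).obs_eq w a b).trans (hB.obs_eq _ _).symm)

end World

/-! ### The ideal network with a corrupted player B -/

section Simulated

variable {U V U' V' : Type} (π : System (U ⊕ V') (V ⊕ U')) (S : System (U' ⊕ Unit) (V' ⊕ Unit))

/-- The state of oblivious transfer and a simulator `S` after `j` rounds. -/
abbrev inner (ωS : S.Ω) (m : ℕ) (x : Bool × Bool) (h : Hist U') (j : ℕ) :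
    Hist ((V' ⊕ Unit) ⊕ (Unit ⊕ Unit)) :=
  (par S OT).loop wireB (ωS, ()) m (Sum.elim (inA x) h) j

/-- The state of the network of B, a simulator and oblivious transfer after `k` rounds. -/
abbrev outer (ω : π.Ω × S.Ω) (hU : Hist U) (m : ℕ) (x : Bool × Bool) (k : ℕ) :
    Hist ((V ⊕ U') ⊕ (Unit ⊕ V')) :=
  (par π (attachB S OT)).loop wireB (ω.1, ω.2, ()) m (Sum.elim (inA x) hU) k

/-- The simulator asks for the bit `x_b`. -/
def Asks (ω : π.Ω × S.Ω) (hU : Hist U) (x : Bool × Bool) (b : Bool) : Prop :=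
  ∃ m k j, firstBit (inner S ω.2 m x (fun u => outer π S ω hU m x k (Sum.inl (Sum.inr u))) j
    (Sum.inl (Sum.inr ()))) = some b

lemma outer_mono (ω : π.Ω × S.Ω) (hU : Hist U) (x : Bool × Bool) {m m' k k' : ℕ} (hm : m ≤ m')
    (hk : k ≤ k') : (outer π S ω hU m x k).Le (outer π S ω hU m' x k') :=
  (par π (attachB S OT)).loop_mono wireB _ hm (Hist.Le.refl _) hk

/-- Oblivious transfer heeds only the first bit on its channel, and messages are never withdrawn, so
the simulator has a single query in the whole run. -/
lemma Asks.eq {π : System (U ⊕ V') (V ⊕ U')} {S : System (U' ⊕ Unit) (V' ⊕ Unit)} {ω : π.Ω × S.Ω}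
    {hU : Hist U} {x : Bool × Bool} {b b' : Bool}
    (h : Asks π S ω hU x b) (h' : Asks π S ω hU x b') : b = b' := by
  obtain ⟨m, k, j, h⟩ := h
  obtain ⟨m', k', j', h'⟩ := h'
  have key : ∀ {m m' k k' j j' : ℕ}, m ≤ m' → k ≤ k' → j ≤ j' →
      inner S ω.2 m x (fun u => outer π S ω hU m x k (Sum.inl (Sum.inr u))) j
        (Sum.inl (Sum.inr ())) <+:
      inner S ω.2 m' x (fun u => outer π S ω hU m' x k' (Sum.inl (Sum.inr u))) j'
        (Sum.inl (Sum.inr ())) := fun hm hk hj =>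
    (par S OT).loop_mono wireB _ hm
      (Hist.Le.elim (Hist.Le.refl _) fun u => outer_mono π S ω hU x hm hk _) hj _
  have h1 := head?_filterMap_prefix asBit
    (key (le_max_left m m') (le_max_left k k') (le_max_left j j')) h
  have h2 := head?_filterMap_prefix asBit
    (key (le_max_right m m') (le_max_right k k') (le_max_right j j')) h'
  exact Option.some.inj (h1.symm.trans h2)

lemma OT_out_congr {x x' : Bool × Bool} {t : Tape} {b : Bool} (ht : firstBit t ≠ some (!b))
    (hb : pick x b = pick x' b) (n : ℕ) :
    OT.out () n (Sum.elim (inA x) fun _ => t) = OT.out () n (Sum.elim (inA x') fun _ => t) := by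
  funext o
  rcases o with o | o
  · rfl
  · change otAnswer [[x.1, x.2]] t = otAnswer [[x'.1, x'.2]] t
    unfold otAnswer
    cases h : firstBit t with
    | none => rfl
    | some c =>
      have hc : c = b := by
        cases c <;> cases b <;> simp_all
      subst hc
      exact congrArg (fun v => ([[v]] : Tape)) hb

lemma inner_congr {x x' : Bool × Bool} {b : Bool} (hb : pick x b = pick x' b) {ωS : S.Ω} {m : ℕ}
    {h : Hist U'} (hn : ∀ j, firstBit (inner S ωS m x h j (Sum.inl (Sum.inr ()))) ≠ some (!b))
    (j : ℕ) : inner S ωS m x h j = inner S ωS m x' h j := by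
  induction j with
  | zero => rfl
  | succ j ih =>
    funext o
    rcases o with o | o
    · refine congrArg (fun r => S.out ωS m r o) (funext fun i => ?_)
      rcases i with i | i
      · rfl
      · exact congrFun ih _
    · have e : ∀ x, inner S ωS m x h (j + 1) (Sum.inr o) = OT.out () m
          (Sum.elim (inA x) fun _ => inner S ωS m x h j (Sum.inl (Sum.inr ()))) o := by
        intro x
        refine (show inner S ωS m x h (j + 1) (Sum.inr o) = OT.out () m (fun i =>
          Sum.elim (Sum.elim (inA x) h) (inner S ωS m x h j) (wireB (Sum.inr i))) o from rfl).trans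
          (congrArg (fun r => OT.out () m r o) (funext fun i => ?_))
        rcases i with i | i <;> rfl
      rw [e, e, OT_out_congr (hn j) hb, ih]

/-- As long as the other bit is not asked for, the answer of oblivious transfer depends on `x_b`
only. Induction on the rounds of the outer network, with `inner_congr` inside it, shows that both
runs coincide. -/
lemma outer_congr {x x' : Bool × Bool} {b : Bool} (hb : pick x b = pick x' b) {ω : π.Ω × S.Ω}
    {hU : Hist U} (hn : ¬ Asks π S ω hU x (!b)) (m k : ℕ) :
    outer π S ω hU m x k = outer π S ω hU m x' k := by
  induction k with
  | zero => rfl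
  | succ k ih =>
    have hπ : ∀ x o, outer π S ω hU m x (k + 1) (Sum.inl o) = π.out ω.1 m
        (Sum.elim hU fun v => outer π S ω hU m x k (Sum.inr (Sum.inr v))) o := by
      intro x o
      refine congrArg (fun r => π.out ω.1 m r o) (funext fun i => ?_)
      rcases i with i | i <;> rfl
    have hG : ∀ x o, outer π S ω hU m x (k + 1) (Sum.inr o) =
        inner S ω.2 m x (fun u => outer π S ω hU m x k (Sum.inl (Sum.inr u))) m (exposeB o) := by
      intro x o
      refine (congrFun (attachB_out S OT (ω.2, ()) m _) o).trans ?_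
      refine congrArg (fun r => (par S OT).loop wireB (ω.2, ()) m r m (exposeB o))
        (funext fun i => ?_)
      rcases i with i | i <;> rfl
    funext o
    rcases o with o | o
    · rw [hπ, hπ, ih]
    · rw [hG, hG, inner_congr S hb (fun j hj => hn ⟨m, k, j, hj⟩), ih]

lemma out_congr_of_not_asks {x x' : Bool × Bool} {b : Bool} (hb : pick x b = pick x' b)
    {ω : π.Ω × S.Ω} {hU : Hist U} (hn : ¬ Asks π S ω hU x (!b)) (m : ℕ) :
    (attachB π (attachB S OT)).out (ω.1, ω.2, ()) m (Sum.elim (inA x) hU) =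
      (attachB π (attachB S OT)).out (ω.1, ω.2, ()) m (Sum.elim (inA x') hU) := by
  refine (attachB_out _ _ _ _ _).trans (.trans ?_ (attachB_out _ _ _ _ _).symm)
  exact funext fun o => congrFun (outer_congr π S hb hn m m) (exposeB o)

/-- If B finally learns `x_c`, then his view does not depend on the other bit. -/
lemma obs_congr_of_correct (hU : Hist U) (v : V) (c : Bool)
    (hc : ∀ x, obs (attachB π (attachB S OT)) (Sum.elim (inA x) hU)
      (headTest (Sum.inr v) [pick x c]) = 1) {x x' x'' : Bool × Bool} (hx : pick x c = pick x' c)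
    (hx' : pick x c ≠ pick x'' c) (hx'' : pick x (!c) = pick x'' (!c)) (T : Test (Unit ⊕ V)) :
    obs (attachB π (attachB S OT)) (Sum.elim (inA x) hU) T =
      obs (attachB π (attachB S OT)) (Sum.elim (inA x') hU) T := by
  refine measureReal_congr ?_
  filter_upwards [ae_of_obs_eq_one (hc x), ae_of_obs_eq_one (hc x'')] with ⟨ω₁, ω₂, u⟩ h1 h2
  -- If `x_c` were not asked for, the runs on `x` and `x''` would coincide, although the correct
  -- outputs differ.
  have hask : Asks π S (ω₁, ω₂) hU x c := by
    by_contra hn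
    obtain ⟨N, h1⟩ := h1
    obtain ⟨N', h2⟩ := h2
    have hn' : ¬ Asks π S (ω₁, ω₂) hU x (!(!c)) := by rwa [Bool.not_not]
    have e := out_congr_of_not_asks π S hx'' hn' N
    have h3 : (headTest (Sum.inr v) [pick x c]).holds
        ((attachB π (attachB S OT)).out (ω₁, ω₂, u) N (Sum.elim (inA x'') hU)) := e ▸ h1
    have h4 := Test.mono _ ((attachB π (attachB S OT)).mono _ (le_max_left N N')
      (Hist.Le.refl _)) h3
    have h5 := Test.mono _ ((attachB π (attachB S OT)).mono _ (le_max_right N N')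
      (Hist.Le.refl _)) h2
    have h6 := Option.some.inj ((show _ = some _ from h4).symm.trans (show _ = some _ from h5))
    exact hx' (List.cons.inj h6).1
  -- The only query has been spent on `x_c`, so replacing the other bit changes nothing in the run.
  have hno : ¬ Asks π S (ω₁, ω₂) hU x (!c) := fun h => by
    have := hask.eq h
    cases c <;> simp at this
  refine propext (exists_congr fun N => ?_)
  exact iff_of_eq (congrArg T.holds (out_congr_of_not_asks π S hx hno N))

end Simulated

/-! ### Impossibility in the malicious model. -/

section World

variable {n : ℕ} (P : WOTProtocol n) (W : Weights)

/-- Weak oblivious transfer as a collection for the malicious model: a corrupted player receives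
the auxiliary output of the semi-honest model. -/
def activeColl (W : Weights) : ActiveColl Empty Unit Empty Unit where
  sys := (wotColl W.dist).sys
  JA := Empty
  KA := Unit ⊕ Unit
  JB := Empty
  KB := Unit ⊕ Unit
  sysA := (wotColl W.dist).sysA
  sysB := (wotColl W.dist).sysB

/-- No protocol implements oblivious transfer in the malicious model. -/
theorem not_activelySecure : ¬ ActivelySecure 0 P ((activeColl W).withComm n) OTActive := by
  rintro ⟨h, ⟨SB, hB⟩, ⟨SA, hA⟩⟩
  have hc := correct_of_close P W h
  refine not_correct_of_hit P W (fun x w a b => ?_) (fun w a b => ?_) hc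
  · have e := fun c => (obs_activeA P W x c w a b).symm.trans
      (hA.obs_attachA_eq (spy n P.A) (inA x) (inB c) (viewTestA w a b))
    rw [e, e]
    exact (((blindA_OT false true).attachA SA).attachA (spy n P.A)).obs_eq w a b _
  · have e := fun x => (obs_activeB P W x true w a b).symm.trans
      (hB.obs_attachB_eq (spy n P.B) (inA x) (inB true) (viewTestB w a b))
    rw [e, e]
    -- `x''` differs from `x` just in the bit that B chooses, and forces the simulator to ask for
    -- it; `x'` differs from `x` just in the other bit.
    refine obs_congr_of_correct (spy n P.B) SB (inB true) (Sum.inl ()) true (fun x => ?_)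
      (x := (false, false)) (x' := (true, false)) (x'' := (false, true)) rfl (by decide) rfl _
    have e' := (obs_activeB_output P W x true [pick x true]).symm.trans
      (hB.obs_attachB_eq (spy n P.B) (inA x) (inB true)
        (headTest (Sum.inr (Sum.inl ())) [pick x true]))
    exact e'.symm.trans (hc x true)

end World

/-! ### Weak oblivious transfer in the malicious model -/

section Source

variable {I O α β Ω : Type} [MeasurableSpace Ω] (Q : Measure Ω) [IsProbabilityMeasure Q]

lemma real_prod_map [Fintype β] [MeasurableSpace α] [DiscreteMeasurableSpace α] (ν : PMF β)
    (g : β → α) {A : Set (Ω × α)} (hA : MeasurableSet A) :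
    (Q.prod (ν.map g).toMeasure).real A = ∑ b, (ν b).toReal * Q.real {ω | (ω, g b) ∈ A} := by
  let _ : MeasurableSpace β := ⊤
  have : MeasurableSingletonClass β := ⟨fun _ => trivial⟩
  have hg : Measurable g := measurable_from_top
  have h1 : Q.prod (ν.map g).toMeasure A = ∑ b, Q {ω | (ω, g b) ∈ A} * ν b := by
    rw [← PMF.toMeasure_map g ν hg]
    have := Measure.isProbabilityMeasure_map (μ := ν.toMeasure) hg.aemeasurable
    rw [Measure.prod_apply_symm hA, lintegral_map .of_discrete hg, lintegral_fintype]
    refine Finset.sum_congr rfl fun b _ => ?_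
    rw [PMF.toMeasure_apply_singleton _ _ (MeasurableSet.singleton b)]
    rfl
  rw [Measure.real, h1, ENNReal.toReal_sum]
  · refine Finset.sum_congr rfl fun b _ => ?_
    rw [ENNReal.toReal_mul, mul_comm]
    rfl
  · exact fun b _ => ENNReal.mul_ne_top (measure_ne_top _ _) (ν.apply_ne_top b)

lemma real_prod_source [Fintype β] (ν : PMF β) (g : β → α) (f : α → O → Msg)
    {A : Set (Ω × (source (I := I) (ν.map g) f).Ω)} (hA : MeasurableSet A) :
    (Q.prod (source (I := I) (ν.map g) f).P).real A = ∑ b, (ν b).toReal *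
      Q.real {ω | (ω, g b) ∈ A} :=
  let _ : MeasurableSpace α := ⊤
  have : DiscreteMeasurableSpace α := ⟨fun _ => trivial⟩
  real_prod_map Q ν g hA

lemma measurableSet_prOne (D : System O (I ⊕ Unit)) (F : System I O) :
    MeasurableSet {ω : D.Ω × F.Ω | ∃ n,
      ((par D F).loop wireD ω n (fun _ => []) n (Sum.inl (Sum.inr ()))).head? = some [true]} :=
  measurableSet_holds (wire (par D F) wireD fun o : (I ⊕ Unit) ⊕ O => o) (fun _ => [])
    (headTest (Sum.inl (Sum.inr ())) [true])

/-- The probability that `D` outputs `1` if it receives the messages `m`. -/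
def response (D : System O (I ⊕ Unit)) (m : O → Msg) : ℝ :=
  D.P.real {ω | ∃ n, ((par D (source (I := I) (PMF.pure m) id)).loop wireD (ω, m) n
    (fun _ => []) n (Sum.inl (Sum.inr ()))).head? = some [true]}

lemma response_nonneg (D : System O (I ⊕ Unit)) (m : O → Msg) : 0 ≤ response D m :=
  measureReal_nonneg

lemma response_le_one (D : System O (I ⊕ Unit)) (m : O → Msg) : response D m ≤ 1 :=
  measureReal_le_one

/-- A source ignores inputs and step counts, so the distinguisher faces a finite mixture of constant
sources. -/
lemma prOne_source [Fintype β] (D : System O (I ⊕ Unit)) (ν : PMF β) (g : β → α)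
    (f : α → O → Msg) : prOne D (source (ν.map g) f) =
      ∑ b, (ν b).toReal * response D (f (g b)) := by
  rw [prOne_eq, real_prod_source D.P ν g f (measurableSet_prOne D _)]
  refine Finset.sum_congr rfl fun b _ => ?_
  have key : ∀ ω n k, (par D (source (I := I) (ν.map g) f)).loop wireD (ω, g b) n
      (fun _ => []) k = (par D (source (I := I) (PMF.pure (f (g b))) id)).loop wireD
        (ω, f (g b)) n (fun _ => []) k := by
    intro ω n k
    induction k with
    | zero => rfl
    | succ k ih =>
      funext o
      rcases o with o | o
      · refine congrArg (fun r => D.out ω n r o) (funext fun i => ?_)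
        exact congrFun ih _
      · rfl
  refine congrArg (fun s => (ν b).toReal * D.P.real s) (Set.ext fun ω => exists_congr fun n => ?_)
  exact iff_of_eq (congrArg (fun h : Hist _ => (h (Sum.inl (Sum.inr ()))).head? = some [true])
    (key ω n n))

end Source

/-! ### Equivalence of systems up to a delay. -/

section Cofinal

variable {I O : Type}

/-- Systems are equivalent if they have, up to a delay, the same outputs. -/
lemma close_of_cofinal {F F' : System I O} (φ : F.Ω → F'.Ω) (hφ : MeasurePreserving φ F.P F'.P)
    (d : ℕ) (h1 : ∀ ω n h, (F.out ω n h).Le (F'.out (φ ω) n h))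
    (h2 : ∀ ω n h, (F'.out (φ ω) n h).Le (F.out ω (n + d) h)) : Close 0 F F' := by
  intro D
  have hm := ((MeasurePreserving.id D.P).prod hφ).measure_preimage
    (measurableSet_prOne D F').nullMeasurableSet
  have up : ∀ ω n k, ((par D F).loop wireD ω n (fun _ => []) k).Le
      ((par D F').loop wireD (ω.1, φ ω.2) n (fun _ => []) k) := by
    intro ω n k
    induction k with
    | zero => exact fun _ => List.nil_prefix
    | succ k ih =>
      rintro (o | o)
      · refine D.mono ω.1 le_rfl (fun i => ?_) o
        exact ih (Sum.inr i)
      · refine (h1 ω.2 n _ o).trans (F'.mono (φ ω.2) le_rfl (fun i => ?_) o)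
        exact ih (Sum.inl (Sum.inl i))
  have low : ∀ ω n k, ((par D F').loop wireD (ω.1, φ ω.2) n (fun _ => []) k).Le
      ((par D F).loop wireD ω (n + d) (fun _ => []) k) := by
    intro ω n k
    induction k with
    | zero => exact fun _ => List.nil_prefix
    | succ k ih =>
      rintro (o | o)
      · refine D.mono ω.1 (Nat.le_add_right n d) (fun i => ?_) o
        exact ih (Sum.inr i)
      · refine (h2 ω.2 n _ o).trans (F.mono ω.2 le_rfl (fun i => ?_) o)
        exact ih (Sum.inl (Sum.inl i))
  have hset : {ω : D.Ω × F.Ω | ∃ n, ((par D F).loop wireD ω n (fun _ => []) n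
      (Sum.inl (Sum.inr ()))).head? = some [true]} = Prod.map id φ ⁻¹' {ω : D.Ω × F'.Ω | ∃ n,
        ((par D F').loop wireD ω n (fun _ => []) n (Sum.inl (Sum.inr ()))).head? =
          some [true]} := by
    ext ω
    constructor
    · rintro ⟨n, hn⟩
      exact ⟨n, head?_of_prefix (up ω n n _) hn⟩
    · rintro ⟨n, hn⟩
      exact ⟨n + d, head?_of_prefix ((low ω n n _).trans ((par D F).loop_mono wireD ω le_rfl
        (Hist.Le.refl _) (Nat.le_add_right n d) _)) hn⟩
  rw [prOne_eq, prOne_eq, hset]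
  exact (abs_eq_zero.2 (sub_eq_zero.2 (congrArg ENNReal.toReal hm))).le

end Cofinal

/-! ### A corrupted player can behave honestly. -/

section Honest

variable {X : Type}

/-- The corrupted player who ignores the auxiliary messages. -/
def ignore : System (Empty ⊕ (Unit ⊕ X)) (Unit ⊕ Empty) :=
  determ (fun h => Sum.elim (fun _ => h (Sum.inr (Sum.inl ()))) Empty.elim)
    (fun hh => by
      rintro (u | e)
      · exact hh _
      · exact e.elim)
    (by
      refine measurable_pi_iff.2 ?_
      rintro (u | e)
      · exact measurable_pi_apply _
      · exact e.elim)

lemma close_ignoreA {α : Type} (μ : PMF α) (f : α → (Unit ⊕ X) ⊕ Unit → Msg)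
    (f' : α → Unit ⊕ Unit → Msg) (h1 : ∀ a u, f a (Sum.inl (Sum.inl u)) = f' a (Sum.inl u))
    (h2 : ∀ a u, f a (Sum.inr u) = f' a (Sum.inr u)) :
    Close 0 (attachA ignore (source μ f : System (Empty ⊕ Empty) _)) (source μ f') := by
  let F : System (Empty ⊕ Empty) ((Unit ⊕ X) ⊕ Unit) := source μ f
  let F' : System (Empty ⊕ Empty) (Unit ⊕ Unit) := source μ f'
  have hφ : MeasurePreserving Prod.snd ((Measure.dirac ()).prod F.P) F.P := measurePreserving_snd
  -- The delay is two rounds: the source emits, then the attached player copies.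
  refine close_of_cofinal (F := attachA ignore F) (F' := F') Prod.snd hφ 2 ?_ ?_
  · rintro ⟨⟨⟩, a⟩ n h (u | u)
    · refine (prefix_of_eq (congrFun (attachA_out ignore F ((), a) n h) _)).trans ?_
      rcases n with _ | _ | n
      · exact List.nil_prefix
      · exact List.nil_prefix
      · exact prefix_of_eq (congrArg (fun m => ([m] : Tape)) (h1 a u))
    · refine (prefix_of_eq (congrFun (attachA_out ignore F ((), a) n h) _)).trans ?_
      rcases n with _ | n
      · exact List.nil_prefix
      · exact prefix_of_eq (congrArg (fun m => ([m] : Tape)) (h2 a u))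
  · rintro ⟨⟨⟩, a⟩ n h (u | u)
    · refine .trans ?_ (prefix_of_eq (congrFun (attachA_out ignore F ((), a) (n + 2) h) _).symm)
      exact prefix_of_eq (congrArg (fun m => ([m] : Tape)) (h1 a u).symm)
    · refine .trans ?_ (prefix_of_eq (congrFun (attachA_out ignore F ((), a) (n + 2) h) _).symm)
      exact prefix_of_eq (congrArg (fun m => ([m] : Tape)) (h2 a u).symm)

lemma close_ignoreB {α : Type} (μ : PMF α) (f : α → Unit ⊕ (Unit ⊕ X) → Msg)
    (f' : α → Unit ⊕ Unit → Msg) (h1 : ∀ a u, f a (Sum.inr (Sum.inl u)) = f' a (Sum.inr u))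
    (h2 : ∀ a u, f a (Sum.inl u) = f' a (Sum.inl u)) :
    Close 0 (attachB ignore (source μ f : System (Empty ⊕ Empty) _)) (source μ f') := by
  let F : System (Empty ⊕ Empty) (Unit ⊕ (Unit ⊕ X)) := source μ f
  let F' : System (Empty ⊕ Empty) (Unit ⊕ Unit) := source μ f'
  have hφ : MeasurePreserving Prod.snd ((Measure.dirac ()).prod F.P) F.P := measurePreserving_snd
  refine close_of_cofinal (F := attachB ignore F) (F' := F') Prod.snd hφ 2 ?_ ?_
  · rintro ⟨⟨⟩, a⟩ n h (u | u)
    · refine (prefix_of_eq (congrFun (attachB_out ignore F ((), a) n h) _)).trans ?_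
      rcases n with _ | n
      · exact List.nil_prefix
      · exact prefix_of_eq (congrArg (fun m => ([m] : Tape)) (h2 a u))
    · refine (prefix_of_eq (congrFun (attachB_out ignore F ((), a) n h) _)).trans ?_
      rcases n with _ | _ | n
      · exact List.nil_prefix
      · exact List.nil_prefix
      · exact prefix_of_eq (congrArg (fun m => ([m] : Tape)) (h1 a u))
  · rintro ⟨⟨⟩, a⟩ n h (u | u)
    · refine .trans ?_ (prefix_of_eq (congrFun (attachB_out ignore F ((), a) (n + 2) h) _).symm)
      exact prefix_of_eq (congrArg (fun m => ([m] : Tape)) (h2 a u).symm)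
    · refine .trans ?_ (prefix_of_eq (congrFun (attachB_out ignore F ((), a) (n + 2) h) _).symm)
      exact prefix_of_eq (congrArg (fun m => ([m] : Tape)) (h1 a u).symm)

end Honest

variable (W : Weights)

lemma activeColl_allowsHonest : (activeColl W).AllowsHonest :=
  ⟨⟨ignore, close_ignoreA _ _ _ (fun _ _ => rfl) fun _ _ => rfl⟩,
    ⟨ignore, close_ignoreB _ _ _ (fun _ _ => rfl) fun _ _ => rfl⟩⟩

lemma Weights.toReal_seedDist (s : Seed) : (W.seedDist s).toReal = W.w s.1 / 16 := by
  rw [Weights.seedDist, PMF.ofFintype_apply,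
    ENNReal.toReal_ofReal (div_nonneg (W.nonneg _) (by norm_num))]

/-- In the first two cases the honest outputs are exactly those of `ROT`. In the third, B's bit is
right with probability 1/2 independently of the rest, so the advantage is half the weight of that
case times a difference of two probabilities. -/
lemma close_ROT {ε : ℝ} (hε : W.w none / 2 ≤ ε) : Close ε (activeColl W).sys ROT := by
  intro D
  let K : Bool → Bool → Bool → Bool → ℝ := fun x₀ x₁ c y =>
    response D (Sum.elim (fun _ => [x₀, x₁]) fun _ => [c, y] : Unit ⊕ Unit → Msg)
  have e1 : prOne D (activeColl W).sys = ∑ s : Seed, W.w s.1 / 16 *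
      K (wotOutcome s).x.1 (wotOutcome s).x.2 (wotOutcome s).c (wotOutcome s).y := by
    refine (prOne_source D W.seedDist wotOutcome _).trans (Finset.sum_congr rfl fun s _ => ?_)
    rw [W.toReal_seedDist]
    refine congrArg (fun m => W.w s.1 / 16 * response D m) (funext fun o => ?_)
    rcases o with o | o <;> rfl
  have e2 : prOne D ROT = ∑ z : Bool × Bool × Bool, 1 / 8 *
      K z.1 z.2.1 z.2.2 (pick (z.1, z.2.1) z.2.2) := by
    have h := prOne_source D (PMF.uniformOfFintype (Bool × Bool × Bool)) id (fun w => fun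
      | Sum.inl _ => [w.1, w.2.1]
      | Sum.inr _ => [w.2.2, pick (w.1, w.2.1) w.2.2] : _ → Unit ⊕ Unit → Msg)
    rw [PMF.map_id] at h
    refine .trans ?_ (h.trans (Finset.sum_congr rfl fun z _ => ?_))
    · congr 1
    · congr 1
      · simp [PMF.uniformOfFintype_apply]
      · refine congrArg (response D) (funext fun o => ?_)
        rcases o with o | o <;> rfl
  have h0 : ∀ x₀ x₁ c y, 0 ≤ K x₀ x₁ c y := fun _ _ _ _ => response_nonneg _ _
  have h1 : ∀ x₀ x₁ c y, K x₀ x₁ c y ≤ 1 := fun _ _ _ _ => response_le_one _ _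
  -- `T` and `T'` are the probabilities that `D` outputs 1 on `ROT` and on `ROT` with B's bit
  -- flipped.
  let T : ℝ := ∑ z : Bool × Bool × Bool, 1 / 8 * K z.1 z.2.1 z.2.2 (pick (z.1, z.2.1) z.2.2)
  let T' : ℝ := ∑ z : Bool × Bool × Bool, 1 / 8 * K z.1 z.2.1 z.2.2 (!pick (z.1, z.2.1) z.2.2)
  have hT : 0 ≤ T ∧ T ≤ 1 := by
    refine ⟨Finset.sum_nonneg fun z _ => mul_nonneg (by norm_num) (h0 _ _ _ _), ?_⟩
    refine (Finset.sum_le_sum fun z _ => mul_le_mul_of_nonneg_left (h1 _ _ _ _)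
      (by norm_num : (0 : ℝ) ≤ 1 / 8)).trans ?_
    norm_num
  have hT' : 0 ≤ T' ∧ T' ≤ 1 := by
    refine ⟨Finset.sum_nonneg fun z _ => mul_nonneg (by norm_num) (h0 _ _ _ _), ?_⟩
    refine (Finset.sum_le_sum fun z _ => mul_le_mul_of_nonneg_left (h1 _ _ _ _)
      (by norm_num : (0 : ℝ) ≤ 1 / 8)).trans ?_
    norm_num
  have e3 : ∑ s : Seed, W.w s.1 / 16 *
      K (wotOutcome s).x.1 (wotOutcome s).x.2 (wotOutcome s).c (wotOutcome s).y =
      W.w (some true) * T + W.w (some false) * T + W.w none * ((T + T') / 2) := by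
    rw [Fintype.sum_prod_type, Fintype.sum_option, Fintype.sum_bool]
    simp only [← Finset.mul_sum]
    rw [Weights.sum_bits, Weights.sum_bits, Weights.sum_bits]
    simp only [T, T', Fintype.sum_prod_type, Fintype.sum_bool, wotOutcome, pick, cond_true,
      cond_false, Bool.not_true, Bool.not_false]
    ring
  rw [e1, e2, e3]
  change |W.w (some true) * T + W.w (some false) * T + W.w none * ((T + T') / 2) - T| ≤ ε
  have hs := W.sum_eq
  have hw := W.nonneg none
  have e4 : W.w (some true) * T + W.w (some false) * T + W.w none * ((T + T') / 2) - T =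
      W.w none / 2 * (T' - T) := by
    rw [show W.w (some true) = 1 - W.w (some false) - W.w none by linarith]
    ring
  rw [e4, abs_mul, abs_of_nonneg (by linarith : 0 ≤ W.w none / 2)]
  refine (mul_le_of_le_one_right (by linarith) ?_).trans hε
  exact abs_le.2 ⟨by linarith [hT.2, hT'.1], by linarith [hT.1, hT'.2]⟩

/-! ### Advantage of a malicious player's guess. -/

section Guess

variable {K O J : Type}

/-- The wiring of a strategy that guesses. -/
def wireG : K ⊕ J → Empty ⊕ ((J ⊕ Unit) ⊕ (K ⊕ O))
  | Sum.inl k => Sum.inr (Sum.inr (Sum.inl k))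
  | Sum.inr j => Sum.inr (Sum.inl (Sum.inl j))

/-- The exposed channels of a strategy that guesses. -/
def exposeG (o : O) : Unit ⊕ Unit → (J ⊕ Unit) ⊕ (K ⊕ O)
  | Sum.inl _ => Sum.inl (Sum.inr ())
  | Sum.inr _ => Sum.inr (Sum.inr o)

lemma hit_congr (S : System K (J ⊕ Unit)) (F : System J (K ⊕ O)) (o : O) (g : Bool × Bool → Bool)
    {w : K ⊕ J → Empty ⊕ ((J ⊕ Unit) ⊕ (K ⊕ O))} {e : Unit ⊕ Unit → (J ⊕ Unit) ⊕ (K ⊕ O)}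
    (hw : ∀ i, w i = wireG i) (he : ∀ c, e c = exposeG o c) (r : Bool) :
    (wire (par S F) w e).P.real {ω | ∃ n b,
        firstPair ((wire (par S F) w e).out ω n (fun _ => []) (Sum.inr ())) = some b ∧
        firstBit ((wire (par S F) w e).out ω n (fun _ => []) (Sum.inl ())) = some (xor r (g b))} =
      (S.P.prod F.P).real {ω | ∃ n b,
        firstPair ((par S F).loop wireG ω n (fun _ => []) n (Sum.inr (Sum.inr o))) = some b ∧
        firstBit ((par S F).loop wireG ω n (fun _ => []) n (Sum.inl (Sum.inr ()))) =
          some (xor r (g b))} := by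
  obtain rfl : w = wireG := funext hw
  obtain rfl : e = exposeG o := funext he
  rfl

lemma guessAdv_eq (S : System K (J ⊕ Unit)) (F : System J (K ⊕ O)) (o : O)
    (g : Bool × Bool → Bool) : guessAdv S F o g =
      (S.P.prod F.P).real {ω | ∃ n b,
        firstPair ((par S F).loop wireG ω n (fun _ => []) n (Sum.inr (Sum.inr o))) = some b ∧
        firstBit ((par S F).loop wireG ω n (fun _ => []) n (Sum.inl (Sum.inr ()))) =
          some (xor false (g b))} -
      (S.P.prod F.P).real {ω | ∃ n b,
        firstPair ((par S F).loop wireG ω n (fun _ => []) n (Sum.inr (Sum.inr o))) = some b ∧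
        firstBit ((par S F).loop wireG ω n (fun _ => []) n (Sum.inl (Sum.inr ()))) =
          some (xor true (g b))} := by
  unfold guessAdv
  exact congrArg₂ (· - ·)
    (hit_congr S F o g (by rintro (_ | _) <;> rfl) (by rintro (_ | _) <;> rfl) false)
    (hit_congr S F o g (by rintro (_ | _) <;> rfl) (by rintro (_ | _) <;> rfl) true)

/-- The probability that `S` guesses `b` if it receives `m`. -/
def guessProb (S : System K (Empty ⊕ Unit)) (m : K → Msg) (b : Bool) : ℝ :=
  S.P.real {ω | ∃ n, firstBit (S.out ω n (fun k => [m k]) (Sum.inr ())) = some b}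

lemma guessProb_nonneg (S : System K (Empty ⊕ Unit)) (m : K → Msg) (b : Bool) :
    0 ≤ guessProb S m b := measureReal_nonneg

lemma guessProb_le_one (S : System K (Empty ⊕ Unit)) (m : K → Msg) (b : Bool) :
    guessProb S m b ≤ 1 := measureReal_le_one

/-- The strategy `S` as a weighted guess. -/
def System.guess {κ : Type} (S : System K (Empty ⊕ Unit)) (m : κ → K → Msg) :
    Weights.Guess κ 0 where
  φ k x := guessProb S (m k) x - guessProb S (m k) (!x)
  add k := by
    simp only [Bool.not_true, Bool.not_false]
    ring
  le k x := by linarith [guessProb_nonneg S (m k) (!x), guessProb_le_one S (m k) x]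

variable (W : Weights) (S : System K (Empty ⊕ Unit)) (m : WOTOutcome → K → Msg)
  (z : WOTOutcome → Bool × Bool) (g : Bool × Bool → Bool)

lemma guessAdv_source :
    guessAdv S (source W.dist fun o => Sum.elim (m o) fun _ => [(z o).1, (z o).2]) () g =
      ∑ s : Seed, W.w s.1 / 16 * (guessProb S (m (wotOutcome s)) (g (z (wotOutcome s))) -
        guessProb S (m (wotOutcome s)) (!g (z (wotOutcome s)))) := by
  let F : System Empty (K ⊕ Unit) :=
    source W.dist fun o => Sum.elim (m o) fun _ => [(z o).1, (z o).2]
  let A (r : Bool) : Set (S.Ω × WOTOutcome) :=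
    {ω | ∃ n, firstBit (S.out ω.1 n (fun k => [m ω.2 k]) (Sum.inr ())) = some (xor r (g (z ω.2)))}
  have hA : ∀ r, MeasurableSet (A r) := by
    intro r
    have h1 : ∀ n, Measurable fun ω : S.Ω × WOTOutcome =>
        (S.out ω.1 n (fun k => [m ω.2 k]) (Sum.inr ()), ω.2) := by
      intro n
      have h2 : Measurable fun ω : S.Ω × WOTOutcome => (ω.1, (fun k => [m ω.2 k] : Hist K)) :=
        measurable_fst.prodMk (measurable_pi_iff.2 fun k =>
          (Measurable.of_discrete (f := fun o : WOTOutcome => ([m o k] : Tape))).comp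
            measurable_snd)
      exact ((measurable_pi_apply (Sum.inr ())).comp ((S.meas n).comp h2)).prodMk measurable_snd
    have h3 : A r = ⋃ n, (fun ω : S.Ω × WOTOutcome =>
        (S.out ω.1 n (fun k => [m ω.2 k]) (Sum.inr ()), ω.2)) ⁻¹'
          {t : Tape × WOTOutcome | firstBit t.1 = some (xor r (g (z t.2)))} := by
      ext ω
      simp only [Set.mem_iUnion]
      rfl
    rw [h3]
    exact .iUnion fun n => h1 n .of_discrete
  have hreal : ∀ r, (S.P.prod W.dist.toMeasure).real (A r) =
      ∑ s : Seed, W.w s.1 / 16 * guessProb S (m (wotOutcome s))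
        (xor r (g (z (wotOutcome s)))) := by
    intro r
    refine (real_prod_map S.P W.seedDist wotOutcome (hA r)).trans
      (Finset.sum_congr rfl fun s _ => ?_)
    rw [W.toReal_seedDist]
    rfl
  let x (ω : S.Ω × WOTOutcome) (n k : ℕ) : Hist ((Empty ⊕ Unit) ⊕ (K ⊕ Unit)) :=
    (par S F).loop wireG ω n (fun _ => []) k
  -- Two extra rounds suffice for the source to emit and for the strategy to have read all of it.
  have hx : ∀ ω n c, x ω n n c <+: x ω (n + 2) (n + 2) c := fun ω n c =>
    (par S F).loop_mono wireG ω (Nat.le_add_right n 2) (Hist.Le.refl _) (Nat.le_add_right n 2) c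
  have hset : ∀ r, {ω | ∃ n b, firstPair (x ω n n (Sum.inr (Sum.inr ()))) = some b ∧
      firstBit (x ω n n (Sum.inl (Sum.inr ()))) = some (xor r (g b))} = A r := by
    intro r
    ext ω
    constructor
    · rintro ⟨n, b, h1, h2⟩
      have e1 : firstPair [[(z ω.2).1, (z ω.2).2]] = some b :=
        head?_filterMap_prefix asPair (hx ω n _) h1
      obtain rfl : z ω.2 = b := Option.some.inj e1
      exact ⟨n + 2, head?_filterMap_prefix asBit (hx ω n _) h2⟩
    · rintro ⟨n, h⟩
      exact ⟨n + 2, z ω.2, rfl, head?_filterMap_prefix asBit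
        (S.mono ω.1 (Nat.le_add_right n 2) (Hist.Le.refl _) (Sum.inr ())) h⟩
  have key : guessAdv S F () g = (S.P.prod W.dist.toMeasure).real (A false) -
      (S.P.prod W.dist.toMeasure).real (A true) := by
    rw [← hset, ← hset]
    exact guessAdv_eq S F () g
  refine key.trans ?_
  rw [hreal, hreal, ← Finset.sum_sub_distrib]
  refine Finset.sum_congr rfl fun s _ => ?_
  rw [← mul_sub, Bool.false_xor, Bool.true_xor]

/-- There are no input channels, so the condition on the last input holds from the start and the
pair may appear at once. -/
lemma outputsPair_source (J : Type) [IsEmpty J] :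
    OutputsPairAfterLastInput (source W.dist fun o => Sum.elim (m o) fun _ => [(z o).1, (z o).2] :
      System J (K ⊕ Unit)) (Sum.inr ()) :=
  ⟨isEmptyElim, fun _ => ⟨fun _ => Filter.Eventually.of_forall fun o =>
    ⟨(z o).1, (z o).2, 0, fun _ _ => rfl⟩, fun h => absurd (fun j => isEmptyElim j) h⟩⟩

end Guess

variable (W : Weights)

lemma advB_activeColl : (activeColl W).advB = source W.dist fun o =>
    Sum.elim (Sum.elim (fun _ => [o.c, o.y]) fun _ => o.v) fun _ => [o.x.1, o.x.2] := by
  refine congrArg (source W.dist) (funext fun o => funext fun k => ?_)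
  rcases k with (k | k) | k <;> rfl

lemma advA_activeColl : (activeColl W).advA = source W.dist fun o =>
    Sum.elim (Sum.elim (fun _ => [o.x.1, o.x.2]) fun _ => o.u) fun _ => [o.c, o.y] := by
  refine congrArg (source W.dist) (funext fun o => funext fun k => ?_)
  rcases k with (k | k) | k <;> rfl

lemma isActiveWOT {p q ε : ℝ} (hp : W.w (some true) ≤ p) (hq : W.w (some false) ≤ q)
    (hε : W.w none / 2 ≤ ε) : IsActiveWOT p q ε (activeColl W) := by
  refine ⟨activeColl_allowsHonest W, close_ROT W hε, ⟨?_, fun S => ?_⟩, ⟨?_, fun S => ?_⟩⟩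
  · rw [advB_activeColl]
    exact outputsPair_source W (fun o => Sum.elim (fun _ => [o.c, o.y]) fun _ => o.v)
      (fun o => o.x) Empty
  · have h := W.guess_xor (S.guess fun k : Bool × Bool × Msg =>
      (Sum.elim (fun _ => [k.1, k.2.1]) fun _ => k.2.2 : Unit ⊕ Unit → Msg))
    rw [advB_activeColl]
    refine (guessAdv_source W S (fun o => Sum.elim (fun _ => [o.c, o.y]) fun _ => o.v)
      (fun o => o.x) fun b => xor b.1 b.2).trans_le (h.trans ?_)
    linarith
  · rw [advA_activeColl]
    exact outputsPair_source W (fun o => Sum.elim (fun _ => [o.x.1, o.x.2]) fun _ => o.u)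
      (fun o => (o.c, o.y)) Empty
  · have h := W.guess_choice (S.guess fun k : ((Bool × Bool) × Msg) × Bool =>
      (Sum.elim (fun _ => [k.1.1.1, k.1.1.2]) fun _ => k.1.2 : Unit ⊕ Unit → Msg))
    rw [advA_activeColl]
    refine (guessAdv_source W S (fun o => Sum.elim (fun _ => [o.x.1, o.x.2]) fun _ => o.u)
      (fun o => (o.c, o.y)) fun b => b.1).trans_le (h.trans ?_)
    linarith

/-- The weights that allow as much leakage and error as possible. -/
lemma exists_weights {p q ε : ℝ} (hp : 0 ≤ p) (hq : 0 ≤ q) (hε : 0 ≤ ε)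
    (h : 1 ≤ p + q + 2 * ε) :
    ∃ W : Weights, W.w (some true) ≤ p ∧ W.w (some false) ≤ q ∧ W.w none / 2 ≤ ε := by
  have h1 : min p 1 ≤ p := min_le_left _ _
  have h2 : min p 1 ≤ 1 := min_le_right _ _
  have h3 : 0 ≤ min p 1 := le_min hp zero_le_one
  have h4 : min q (1 - min p 1) ≤ q := min_le_left _ _
  have h5 : min q (1 - min p 1) ≤ 1 - min p 1 := min_le_right _ _
  have h6 : 0 ≤ min q (1 - min p 1) := le_min hq (by linarith)
  -- Greedy choice: as much as possible of `p`, then of `q`, and the remainder is at most `2ε` by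
  -- assumption.
  refine ⟨⟨fun
    | some true => min p 1
    | some false => min q (1 - min p 1)
    | none => 1 - min p 1 - min q (1 - min p 1), ?_, ?_⟩, h1, h4, ?_⟩
  · rintro (_ | _ | _)
    · change 0 ≤ 1 - min p 1 - min q (1 - min p 1)
      linarith
    · exact h6
    · exact h3
  · change min p 1 + min q (1 - min p 1) + (1 - min p 1 - min q (1 - min p 1)) = 1
    ring
  · change (1 - min p 1 - min q (1 - min p 1)) / 2 ≤ ε
    rcases min_choice p 1 with e | e <;> rcases min_choice q (1 - min p 1) with e' | e' <;>
      rw [e'] <;> linarith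

end OTRed

end

/-- If `p + q + 2ε ≥ 1`, then for no `n` is there a protocol that securely implements oblivious
transfer from `n` instances of `WOT(p,q,ε)` and communication, whichever instance of `WOT(p,q,ε)` it
is given, neither in the semi-honest nor in the malicious model. -/
theorem mainTheorem5 (p q ε : ℝ) (hp : 0 ≤ p) (hq : 0 ≤ q) (hε : 0 ≤ ε)
    (h : 1 ≤ p + q + 2 * ε) (n : ℕ) :
    (¬ ∃ P : OTRed.WOTProtocol n, ∀ μ : PMF OTRed.WOTOutcome, OTRed.IsPassiveWOT p q ε μ →
      OTRed.PassivelySecure 0 P ((OTRed.wotColl μ).withComm n) OTRed.OTPassive) ∧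
    (¬ ∃ P : OTRed.WOTProtocol n, ∀ F : OTRed.ActiveColl Empty Unit Empty Unit,
      OTRed.IsActiveWOT p q ε F →
      OTRed.ActivelySecure 0 P (F.withComm n) OTRed.OTActive) := by
  obtain ⟨W, h1, h2, h3⟩ := OTRed.exists_weights hp hq hε h
  exact ⟨fun ⟨P, hP⟩ => OTRed.not_passivelySecure P W (hP _ (W.isPassiveWOT h1 h2 h3)),
    fun ⟨P, hP⟩ => OTRed.not_activelySecure P W (hP _ (OTRed.isActiveWOT W h1 h2 h3))⟩
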